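/- Let $K\ge 1$ be a constant; all constants below depend only on $K$ and on the implied constants of the word length $w$. Let $1\le k\le d$ and $u\ge 0$, and consider vectors $x\in[0,u]^d$ with at most $k$ non-zero entries. Two vectors are neighbours if their $\ell_1$-distance is at most $1$, and a randomized algorithm $M$ is $(\varepsilon,\delta)$-differentially private if $\Pr[M(x)\in S]\le e^{\varepsilon}\Pr[M(x')\in S]+\delta$ for all neighbouring non-negative vectors $x,x'$ with at most $k$ non-zero entries and all events $S$. Suppose that $\alpha=\Theta(1)$ and $s=\Theta(k)$ with $s/k$ bounded below by a constant larger than $2$, precisely $1/K\le\alpha\le K$ and $(2+1/K)k\le s\le Kk$; that $k=\Omega(\log d)$, $\delta=O(1/k)$ and $\varepsilon=O(\log(1/\delta))$, precisely $\log d\le Kk$, $k\delta\le K$ and $\varepsilon\le K\log(1/\delta)$, with $\varepsilon,\delta>0$; that $\delta$ is bounded away from $1$, precisely $\log(1/\delta)\ge 1/K$; and that $\log(1/\delta)\le(d+u+1)^{K}$ (so that $\varepsilon$ and the exponent of $\delta$ fit in $O(1)$ words). The machine is a word RAM with word length $w=\Theta(\log(d+u+1))$, whose lower implied constant is sufficiently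 large in terms of $K$, and with unit-cost arithmetic (including division), bitwise, comparison and memory operations on words. There is a universal family of hash functions $[d]\to[s]$ for which the following mechanism (threshold ALP-projection) is $(\varepsilon,\delta)$-differentially private. Put $\varepsilon'=\varepsilon/2$, $t=\ln(1/\delta)/\varepsilon'+2$ and $m=\lceil t\varepsilon'/\alpha\rceil$. Random rounding maps a real $r$ to $\lceil r\rceil$ with probability $r-\lfloor r\rfloor$ and to $\lfloor r\rfloor$ otherwise. (a) Thresholding: entries $x_i\in(0,1)$ are rounded at random to $y_i$, other entries have $y_i=x_i$; set $\tilde v_i=y_i+\eta_i$ with independent $\eta_i\sim\mathrm{Lap}(1/\varepsilon')$ if $y_i\ne0$ and $y_i+\eta_i\ge t$, and $\tilde v_i=0$ otherwise. (b) ALP embedding, independent of (a): round every $x_i\varepsilon'/\alpha$ at random to an integer $y'_i$, draw independent $h_1,\dots,h_m$ from the hash family, put $z_{a,b}=1$ if $h_b(i)=a$ for some $i$ with $y'_i\ge b$ and $z_{a,b}=0$ otherwise, and obtain $\tilde z\in\{0,1\}^{s\times m}$ by flipping each bit of $z$ independently with probability $1/(\alpha+2)$. The output is $(\tilde v,h,\tilde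 z)$, and the estimate of $x_i$ is $\tilde v_i$ if $\tilde v_i\neq 0$, and otherwise $\alpha/\varepsilon'$ times the average of the set of $n\in\{0,\dots,m\}$ maximizing $\sum_{b=1}^n(2\tilde z_{h_b(i),b}-1)$; estimates are clamped to $[0,u]$. Moreover, the output can be encoded as a memory image, by an encoding that is a function of the output only, so that the encoded representation is also $(\varepsilon,\delta)$-differentially private, and so that one fixed word RAM program, the same for all parameters, answers queries with the following guarantees for every $x\in[0,u]^d$ with at most $k$ non-zero entries. Almost surely, the image has $O(k(\log(d+u)+\log(1/\delta)))$ bits, and for every $i$ the program returns in $O(\log(1/\delta))$ steps a rational number $\tilde x_i$ that differs from the clamped estimate of $x_i$ by at most $1/\varepsilon$. The expected per-entry error is $\mathbb E|x_i-\tilde x_i|=O(1/\varepsilon)$ for every $i$, and the expected maximum error is $\mathbb E\max_i|x_i-\tilde x_i|=O(\log(1/\delta)/\varepsilon)$. -/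

import Mathlib

open MeasureTheory ProbabilityTheory

/-! # Input vectors and differential privacy -/

/-- `x` has at most `k` non-zero entries. -/
def IsSparse {d : ℕ} (k : ℕ) (x : Fin d → ℝ) : Prop :=
  {i | x i ≠ 0}.ncard ≤ k

/-- `(ε, δ)`-differential privacy of a randomized algorithm `M` on the non-negative `k`-sparse
vectors of dimension `d`: `M x` is the law of the output on input `x`, and two vectors are
neighbours when their `ℓ¹`-distance is at most `1`. -/
def IsDP {d : ℕ} (k : ℕ) (ε δ : ℝ) {R : Type*} [MeasurableSpace R]
    (M : (Fin d → ℝ) → Measure R) : Prop :=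
  ∀ x x' : Fin d → ℝ, (∀ i, 0 ≤ x i) → (∀ i, 0 ≤ x' i) → IsSparse k x → IsSparse k x' →
    ∑ i, |x i - x' i| ≤ 1 →
    ∀ S : Set R, MeasurableSet S →
      M x S ≤ ENNReal.ofReal (Real.exp ε) * M x' S + ENNReal.ofReal δ

/-! # Sources of randomness -/

/-- The Laplace distribution with scale `1 / ε`, by its density. -/
noncomputable def laplaceLaw (ε : ℝ) : Measure ℝ :=
  volume.withDensity fun τ => ENNReal.ofReal (ε / 2 * Real.exp (-|τ| * ε))

/-- Random rounding: `⌈r⌉` with probability `r - ⌊r⌋`, otherwise `⌊r⌋`. -/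
noncomputable def randomRound (r : ℝ) : Measure ℤ :=
  ENNReal.ofReal (r - ⌊r⌋) • Measure.dirac ⌈r⌉ +
    ENNReal.ofReal (1 - (r - ⌊r⌋)) • Measure.dirac ⌊r⌋

/-- A coin that is `true` with probability `p`. -/
noncomputable def coin (p : ℝ) : Measure Bool :=
  ENNReal.ofReal p • Measure.dirac true + ENNReal.ofReal (1 - p) • Measure.dirac false

/-- The family `hash 0, …, hash (N - 1)` of functions from `[d]` to `[s]` is universal: two
distinct keys collide with probability at most `1 / s` under a uniformly random member. -/
def IsUniversal {N d s : ℕ} (hash : Fin N → Fin d → Fin s) : Prop :=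
  ∀ i j : Fin d, i ≠ j → ({g | hash g i = hash g j} : Set (Fin N)).ncard * s ≤ N

/-! # Thresholding with random rounding -/

/-- One rounded entry: `x` is rounded at random when `0 < x < 1` and left alone otherwise. -/
noncomputable def roundSmall (x : ℝ) : Measure ℝ :=
  open Classical in
  if 0 < x ∧ x < 1 then (randomRound x).map (fun n : ℤ => (n : ℝ)) else Measure.dirac x

/-- One entry of the thresholded vector: Laplace noise is added to the rounded entry `y`, and the
result is stored if `y ≠ 0` and the noisy value is at least `t`. -/
noncomputable def thresholdEntry (ε t x : ℝ) : Measure ℝ :=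
  open Classical in
  ((roundSmall x).prod (laplaceLaw ε)).map fun q =>
    if q.1 ≠ 0 ∧ t ≤ q.1 + q.2 then q.1 + q.2 else 0

/-- The threshold `ln (1 / δ) / ε + 2`. -/
noncomputable def thresholdValue (ε δ : ℝ) : ℝ := Real.log (1 / δ) / ε + 2

/-- The thresholding mechanism with random rounding, with parameters `ε` and `δ`; all entries are
treated independently. -/
noncomputable def thresholdMechanism {d : ℕ} (ε δ : ℝ) (x : Fin d → ℝ) : Measure (Fin d → ℝ) :=
  Measure.pi fun i => thresholdEntry ε (thresholdValue ε δ) (x i)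

/-! # The ALP mechanism -/

/-- What the ALP projection releases: `m` members of the hash family, and an `s × m` bit array. -/
abbrev ALPOutput (N s m : ℕ) : Type := (Fin m → Fin N) × (Fin s → Fin m → Bool)

/-- The bit array before randomized response: the unary representations of the entries of `y`,
hashed to the rows. Column `b : Fin m` is the column with number `b + 1`. -/
noncomputable def embedding {N d s m : ℕ} (hash : Fin N → Fin d → Fin s) (h : Fin m → Fin N)
    (y : Fin d → ℤ) (a : Fin s) (b : Fin m) : Bool :=
  open Classical in
  decide (∃ i, (b : ℤ) + 1 ≤ y i ∧ hash (h b) i = a)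

/-- ALP1-projection with scaling parameter `α` and an array of `m` columns. The hash functions
`h`, the rounded entries `y` and the flips `e` of randomized response are independent. -/
noncomputable def alp1Projection {N d s : ℕ} (α : ℝ) (m : ℕ) (hash : Fin N → Fin d → Fin s)
    (x : Fin d → ℝ) : Measure (ALPOutput N s m) :=
  ((Measure.pi fun _ : Fin m => uniformOn (Set.univ : Set (Fin N))).prod
    ((Measure.pi fun i => randomRound (x i / α)).prod
      (Measure.pi fun _ : Fin s => Measure.pi fun _ : Fin m => coin (1 / (α + 2))))).map
    fun q => (q.1, fun a b => xor (embedding hash q.1 q.2.1 a b) (q.2.2 a b))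

/-- ALP-projection for privacy parameter `ε`: scale the input by `ε`. -/
noncomputable def alpProjection {N d s : ℕ} (α ε : ℝ) (m : ℕ) (hash : Fin N → Fin d → Fin s)
    (x : Fin d → ℝ) : Measure (ALPOutput N s m) :=
  alp1Projection α m hash fun i => x i * ε

/-- The partial sums `f n = ∑ (2 z_{h_a(i), a} - 1)`, over the first `n` columns `a`. -/
def partialSum {N d s m : ℕ} (hash : Fin N → Fin d → Fin s) (o : ALPOutput N s m) (i : Fin d)
    (n : ℕ) : ℤ :=
  ∑ a : Fin m, if (a : ℕ) < n then (if o.2 (hash (o.1 a) i) a then 1 else -1) else 0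

/-- The set `P ⊆ {0, …, m}` of maximizers of the partial sums. -/
noncomputable def peaks {N d s m : ℕ} (hash : Fin N → Fin d → Fin s) (o : ALPOutput N s m) (i : Fin d) :
    Finset ℕ :=
  open Classical in
  (Finset.range (m + 1)).filter fun n =>
    ∀ a ∈ Finset.range (m + 1), partialSum hash o i a ≤ partialSum hash o i n

/-- The ALP estimate of entry `i`: the average of the peaks, scaled back by `α` and `1 / ε`. -/
noncomputable def alpEstimate {N d s m : ℕ} (α ε : ℝ) (hash : Fin N → Fin d → Fin s)
    (o : ALPOutput N s m) (i : Fin d) : ℝ :=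
  ((∑ n ∈ peaks hash o i, (n : ℝ)) / (peaks hash o i).card) * α / ε

/-! # The combined mechanism -/

/-- The number of columns `⌈β ε' / α⌉`, where each of the two parts of the combined mechanism has
the privacy parameter `ε' = ε / 2`, and `β` is the threshold. -/
noncomputable def columns (α ε δ : ℝ) : ℕ :=
  ⌈thresholdValue (ε / 2) δ * (ε / 2) / α⌉₊

/-- Threshold ALP-projection: the thresholded vector and, independently, the ALP projection,
each with half of the privacy parameter `ε`. -/
noncomputable def thresholdALP {N d s : ℕ} (α ε δ : ℝ) (hash : Fin N → Fin d → Fin s)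
    (x : Fin d → ℝ) : Measure ((Fin d → ℝ) × ALPOutput N s (columns α ε δ)) :=
  (thresholdMechanism (ε / 2) δ x).prod (alpProjection α (ε / 2) (columns α ε δ) hash x)

/-- Threshold ALP-estimator: use the thresholded vector where it stores a value and the ALP
estimate elsewhere, and clamp the result to `[0, u]`. -/
noncomputable def thresholdALPEstimate {N d s m : ℕ} (α ε u : ℝ) (hash : Fin N → Fin d → Fin s)
    (r : (Fin d → ℝ) × ALPOutput N s m) (i : Fin d) : ℝ :=
  open Classical in
  max 0 (min u (if r.1 i ≠ 0 then r.1 i else alpEstimate α (ε / 2) hash r.2 i))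

/-! # The word RAM -/

namespace WordRAM

/-- Operations on words, each taking unit time; arithmetic is modulo `2 ^ w`. -/
inductive BinOp where
  | add | sub | mul | div | mod | and | or | xor | shl | shr

/-- The value of an operation on `w`-bit words. -/
def BinOp.eval {w : ℕ} : BinOp → BitVec w → BitVec w → BitVec w
  | .add, a, b => a + b
  | .sub, a, b => a - b
  | .mul, a, b => a * b
  | .div, a, b => BitVec.udiv a b
  | .mod, a, b => BitVec.umod a b
  | .and, a, b => a &&& b
  | .or, a, b => a ||| b
  | .xor, a, b => a ^^^ b
  | .shl, a, b => a <<< b.toNat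
  | .shr, a, b => a >>> b.toNat

/-- Instructions; registers and jump targets are fixed numbers in the program text. -/
inductive Instr where
  /-- `R[dst] := c` -/
  | const (dst c : ℕ)
  /-- `R[dst] := R[a] o R[b]` -/
  | op (o : BinOp) (dst a b : ℕ)
  /-- `R[dst] := M[R[addr]]` -/
  | load (dst addr : ℕ)
  /-- `M[R[addr]] := R[src]` -/
  | store (addr src : ℕ)
  /-- continue at `target` -/
  | jump (target : ℕ)
  /-- continue at `target` if `R[a] < R[b]` as natural numbers -/
  | jumpLt (a b target : ℕ)
  /-- continue at `target` if `R[a] = R[b]` -/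
  | jumpEq (a b target : ℕ)
  /-- stop -/
  | halt

/-- A program is a finite list of instructions. It is independent of the word length. -/
abbrev Program : Type := List Instr

/-- A configuration: program counter, registers, and a memory of `2 ^ w` words. -/
structure Config (w : ℕ) where
  pc : ℕ
  reg : ℕ → BitVec w
  mem : BitVec w → BitVec w

/-- One step; `none` means that the machine has stopped. -/
def step {w : ℕ} (P : Program) (σ : Config w) : Option (Config w) :=
  match P[σ.pc]? with
  | none => none
  | some .halt => none
  | some (.const dst c) =>
    some ⟨σ.pc + 1, Function.update σ.reg dst (BitVec.ofNat w c), σ.mem⟩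
  | some (.op o dst a b) =>
    some ⟨σ.pc + 1, Function.update σ.reg dst (o.eval (σ.reg a) (σ.reg b)), σ.mem⟩
  | some (.load dst addr) =>
    some ⟨σ.pc + 1, Function.update σ.reg dst (σ.mem (σ.reg addr)), σ.mem⟩
  | some (.store addr src) =>
    some ⟨σ.pc + 1, σ.reg, Function.update σ.mem (σ.reg addr) (σ.reg src)⟩
  | some (.jump target) => some ⟨target, σ.reg, σ.mem⟩
  | some (.jumpLt a b target) =>
    some ⟨if (σ.reg a).toNat < (σ.reg b).toNat then target else σ.pc + 1, σ.reg, σ.mem⟩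
  | some (.jumpEq a b target) =>
    some ⟨if σ.reg a = σ.reg b then target else σ.pc + 1, σ.reg, σ.mem⟩

/-- The final configuration, if the machine stops within `T` steps. -/
def exec {w : ℕ} (P : Program) : ℕ → Config w → Option (Config w)
  | 0, σ => match step P σ with
    | none => some σ
    | some _ => none
  | T + 1, σ => match step P σ with
    | none => some σ
    | some σ' => exec P T σ'

/-- A memory image: a sequence of `w`-bit words. -/
def Image (w : ℕ) : Type := List (BitVec w)

/-- The number of bits of a memory image. -/
def Image.bits {w : ℕ} (I : Image w) : ℕ := List.length I * w

/-- Every set of memory images is an event. -/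
instance (w : ℕ) : MeasurableSpace (Image w) := ⊤

/-- The initial configuration of a query for entry `i`: the image fills the first memory cells,
register `0` holds `i`, everything else is zero. -/
def initial {w : ℕ} (I : Image w) (i : ℕ) : Config w where
  pc := 0
  reg := fun n => if n = 0 then BitVec.ofNat w i else 0
  mem := fun a => List.getD I a.toNat 0

/-- On the memory image `I`, a query for entry `i` stops within `T` steps with the answer `v`, given
as a fraction whose numerator and denominator are the words in registers `0` and `1`. -/
def Answers {w : ℕ} (P : Program) (I : Image w) (i T : ℕ) (v : ℝ) : Prop :=
  ∃ σ : Config w, exec P T (initial I i) = some σ ∧ σ.reg 1 ≠ 0 ∧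
    v = ((σ.reg 0).toNat : ℝ) / ((σ.reg 1).toNat : ℝ)

end WordRAM

/-! # Product measures -/

/-! Privacy is proved by comparing the output measures of neighbouring inputs. On `[0, 1]` the law
of a thresholded entry is affine in the entry, and only a tiny mass `p` of the unit entry's law
survives the threshold. Above `1` the Laplace density changes by a factor of at most `exp (ε |x -
x'|)`. So each entry's law is at most this factor times the neighbouring law plus a defect of mass
at most `|x - x'| p` (`exists_thresholdEntry_le`). Over the product the factors multiply to at most
`exp ε` and the defects raise the total mass by at most `2 p` (`isDP_thresholdMechanism`).

For the ALP projection, raising one rounded entry by one changes at most one bit, which randomized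
response hides up to a factor `α + 1` (`outputProb_le`). Random rounding interpolates linearly
between integers, and this turns the factor into `exp (α |r - r'|)` (`lintegral_pi_randomRound_le`).
This half is therefore purely private, the two halves compose (`IsDP.prod`), and the memory image is
post-processing.

Accuracy of the projection is a random-walk argument. If `n` maximizes the partial sums and `Y` is
the true unary length, then at least half of the bits between `n` and `Y` are wrong. A bit is wrong
with probability at most `1 / 2 - γ`, since `s > 2 k` by a constant factor, and the columns are
independent. A Chernoff bound gives decay geometric in `|n - Y|` (`lintegral_peak_le`), and summing
over `n` bounds the mean error by a constant. Thresholding contributes only Laplace tails. For the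
maximum error, the ALP part is bounded by the number of columns, and only the at most `k` non-zero
entries carry noise, so a union over their tails costs `log k = O(log (1 / δ))`.

The hash family is the Carter–Wegman family modulo a prime between `d` and `2 d`. The image holds a
header, a sorted dictionary of quantized values padded to a power of two, the packed hash codes and
the bit array. A query is a binary search followed, if the key is absent, by one pass over the
columns that maintains the maximum of the partial sums together with the sum and number of the
places where it is attained (`halts_accessProgram`). Fixed-point arithmetic with denominator about
`(m + 1) ε` keeps the answer within `1 / ε`. A long enough word makes a quarter of a word hold each
parameter, so that no product overflows (`fits_thresholdHeader`). -/

theorem pi_le_pi {ι : Type*} [Fintype ι] {X : ι → Type*} [∀ i, MeasurableSpace (X i)]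
    {μ ν : ∀ i, Measure (X i)} (h : ∀ i, μ i ≤ ν i) : Measure.pi μ ≤ Measure.pi ν := by
  refine Measure.le_iff.2 fun s hs => ?_
  rw [Measure.pi, Measure.pi, toMeasure_apply _ _ hs, toMeasure_apply _ _ hs]
  -- The product outer measure is the largest one bounded by the products on boxes, so a comparison
  -- on boxes suffices.
  refine (OuterMeasure.le_pi.2 fun t _ => ?_ :
    OuterMeasure.pi (fun i => (μ i).toOuterMeasure) ≤
      OuterMeasure.pi fun i => (ν i).toOuterMeasure) s
  exact (OuterMeasure.pi_pi_le _ t).trans (Finset.prod_le_prod' fun i _ => h i (t i))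

theorem pi_smul_eq {ι : Type*} [Fintype ι] {X : ι → Type*} [∀ i, MeasurableSpace (X i)]
    (μ : ∀ i, Measure (X i)) [∀ i, IsFiniteMeasure (μ i)] (c : ι → NNReal) :
    Measure.pi (fun i => c i • μ i) = (∏ i, c i) • Measure.pi μ := by
  refine Measure.pi_eq fun s _ => ?_
  simp only [Measure.smul_apply, Measure.pi_pi, ENNReal.smul_def, smul_eq_mul,
    Finset.prod_mul_distrib, ENNReal.ofNNReal_finsetProd]

theorem lintegral_pi_prod {ι : Type*} [Fintype ι] {X : ι → Type*} [∀ i, MeasurableSpace (X i)]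
    (μ : ∀ i, Measure (X i)) [∀ i, IsProbabilityMeasure (μ i)] (f : ∀ i, X i → ENNReal)
    (hf : ∀ i, Measurable (f i)) :
    ∫⁻ x, ∏ i, f i (x i) ∂Measure.pi μ = ∏ i, ∫⁻ y, f i y ∂μ i := by
  have h := lintegral_prod_eq_prod_lintegral_of_indepFun Finset.univ
    (fun i (x : ∀ i, X i) => f i (x i))
    (iIndepFun_pi (μ := μ) fun i => (hf i).aemeasurable)
    (fun i => (hf i).comp (measurable_pi_apply i))
  rw [h]
  refine Finset.prod_congr rfl fun i _ => ?_
  exact (measurePreserving_eval μ i).lintegral_comp (hf i)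

/-! # The Laplace distribution -/

theorem lintegral_exp_neg_abs_mul {a : ℝ} (ha : 0 < a) :
    ∫⁻ τ : ℝ, ENNReal.ofReal (Real.exp (-|τ| * a)) = ENNReal.ofReal (2 / a) := by
  have h : ∫ τ : ℝ, Real.exp (-|τ| * a) = 2 / a := by
    have h1 := integral_comp_abs (f := fun τ : ℝ => Real.exp (-τ * a))
    have h2 : ∫ τ in Set.Ioi (0 : ℝ), Real.exp (-τ * a) = 1 / a := by
      have := integral_exp_mul_Ioi (a := -a) (by linarith) 0
      simp only [mul_zero, Real.exp_zero] at this
      rw [← neg_div_neg_eq, ← this]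
      congr 1; ext τ; ring_nf
    rw [h1, h2]; ring
  -- The integral of a non-integrable function is `0` by convention, which contradicts the positive
  -- value just found.
  have hi : Integrable fun τ : ℝ => Real.exp (-|τ| * a) := by
    by_contra hn
    rw [integral_undef hn] at h
    have : 0 < 2 / a := by positivity
    linarith
  rw [← h, ofReal_integral_eq_lintegral_ofReal hi (ae_of_all _ fun τ => (Real.exp_pos _).le)]

theorem lintegral_laplaceLaw {ε : ℝ} (f : ℝ → ENNReal) :
    ∫⁻ τ, f τ ∂laplaceLaw ε =
      ∫⁻ τ, ENNReal.ofReal (ε / 2 * Real.exp (-|τ| * ε)) * f τ := by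
  rw [laplaceLaw, lintegral_withDensity_eq_lintegral_mul_non_measurable _ (by fun_prop)
    (ae_of_all _ fun τ => ENNReal.ofReal_lt_top)]
  rfl

/-- With `a = 0` this is the total mass; with `a = ε / 2` it controls the tails. -/
theorem lintegral_exp_abs_laplaceLaw {ε a : ℝ} (hε : 0 < ε) (ha : a < ε) :
    ∫⁻ τ, ENNReal.ofReal (Real.exp (|τ| * a)) ∂laplaceLaw ε = ENNReal.ofReal (ε / (ε - a)) := by
  rw [lintegral_laplaceLaw]
  have : ∀ τ : ℝ, ENNReal.ofReal (ε / 2 * Real.exp (-|τ| * ε)) *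
      ENNReal.ofReal (Real.exp (|τ| * a)) =
      ENNReal.ofReal (ε / 2) * ENNReal.ofReal (Real.exp (-|τ| * (ε - a))) := by
    intro τ
    rw [← ENNReal.ofReal_mul (by positivity), ← ENNReal.ofReal_mul (by positivity), mul_assoc,
      ← Real.exp_add]
    congr 3; ring
  simp_rw [this]
  rw [lintegral_const_mul _ (by fun_prop), lintegral_exp_neg_abs_mul (by linarith),
    ← ENNReal.ofReal_mul (by positivity)]
  congr 1
  field_simp

theorem isProbabilityMeasure_laplaceLaw {ε : ℝ} (hε : 0 < ε) :
    IsProbabilityMeasure (laplaceLaw ε) := by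
  constructor
  have h := lintegral_exp_abs_laplaceLaw (a := 0) hε hε
  simpa [hε.ne'] using h

theorem laplaceLaw_Ici_le {ε c : ℝ} (hε : 0 < ε) (hc : 0 ≤ c) :
    laplaceLaw ε (Set.Ici c) ≤ ENNReal.ofReal (Real.exp (-c * ε) / 2) := by
  rw [laplaceLaw, withDensity_apply _ measurableSet_Ici, setLIntegral_congr Ioi_ae_eq_Ici.symm]
  have h1 : ∫⁻ τ in Set.Ioi c, ENNReal.ofReal (ε / 2 * Real.exp (-|τ| * ε)) =
      ∫⁻ τ in Set.Ioi c, ENNReal.ofReal (ε / 2 * Real.exp (-ε * τ)) := by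
    refine setLIntegral_congr_fun measurableSet_Ioi fun τ hτ => ?_
    have : 0 ≤ τ := hc.trans (le_of_lt hτ)
    simp only [abs_of_nonneg this]
    congr 3; ring
  have hi : IntegrableOn (fun τ => ε / 2 * Real.exp (-ε * τ)) (Set.Ioi c) :=
    (integrableOn_exp_mul_Ioi (by linarith) c).const_mul _
  rw [h1, ← ofReal_integral_eq_lintegral_ofReal hi (ae_of_all _ fun τ => by positivity),
    integral_const_mul, integral_exp_mul_Ioi (by linarith)]
  refine le_of_eq ?_
  congr 1
  field_simp

theorem map_add_laplaceLaw (ε x : ℝ) :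
    (laplaceLaw ε).map (fun τ => x + τ) =
      volume.withDensity fun τ => ENNReal.ofReal (ε / 2 * Real.exp (-|τ - x| * ε)) := by
  ext S hS
  rw [Measure.map_apply (by fun_prop) hS, laplaceLaw,
    withDensity_apply _ (measurableSet_preimage (by fun_prop) hS), withDensity_apply _ hS,
    ← lintegral_indicator hS,
    ← lintegral_indicator (measurableSet_preimage (by fun_prop) hS)]
  refine Eq.trans ?_ (lintegral_add_left_eq_self _ x)
  congr 1
  ext τ
  simp [Set.indicator]
  rfl

/-- By the triangle inequality the two shifted densities have this ratio at every point. -/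
theorem map_add_laplaceLaw_le {ε : ℝ} (hε : 0 < ε) (x x' : ℝ) :
    (laplaceLaw ε).map (fun τ => x + τ) ≤
      ENNReal.ofReal (Real.exp (ε * |x - x'|)) • (laplaceLaw ε).map (fun τ => x' + τ) := by
  rw [map_add_laplaceLaw, map_add_laplaceLaw,
    ← withDensity_smul _ (by fun_prop)]
  refine withDensity_mono (ae_of_all _ fun τ => ?_)
  simp only [Pi.smul_apply, smul_eq_mul]
  rw [← ENNReal.ofReal_mul (by positivity)]
  refine ENNReal.ofReal_le_ofReal ?_
  rw [mul_left_comm, ← Real.exp_add]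
  gcongr
  have : |τ - x'| ≤ |τ - x| + |x - x'| := abs_sub_le _ _ _
  nlinarith

/-! # Privacy of thresholding -/

/-- The law of a thresholded entry whose rounded value is `y`. -/
noncomputable def noisyEntry (ε t y : ℝ) : Measure ℝ :=
  open Classical in
  (laplaceLaw ε).map fun τ => if y ≠ 0 ∧ t ≤ y + τ then y + τ else 0

theorem measurable_thresholdMap (t : ℝ) :
    open Classical in
    Measurable fun q : ℝ × ℝ => if q.1 ≠ 0 ∧ t ≤ q.1 + q.2 then q.1 + q.2 else 0 := by
  classical
  refine Measurable.ite ?_ (measurable_fst.add measurable_snd) measurable_const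
  exact (measurableSet_eq_fun measurable_fst measurable_const).compl.inter
    (measurableSet_le measurable_const (measurable_fst.add measurable_snd))

theorem measurable_noisyMap (t y : ℝ) :
    open Classical in
    Measurable fun τ : ℝ => if y ≠ 0 ∧ t ≤ y + τ then y + τ else 0 :=
  (measurable_thresholdMap t).comp (measurable_const.prodMk measurable_id)

theorem isProbabilityMeasure_noisyEntry {ε : ℝ} (hε : 0 < ε) (t y : ℝ) :
    IsProbabilityMeasure (noisyEntry ε t y) :=
  have := isProbabilityMeasure_laplaceLaw hε
  Measure.isProbabilityMeasure_map (measurable_noisyMap t y).aemeasurable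

theorem noisyEntry_zero {ε : ℝ} (hε : 0 < ε) (t : ℝ) : noisyEntry ε t 0 = Measure.dirac 0 := by
  have := isProbabilityMeasure_laplaceLaw hε
  simp [noisyEntry, Measure.map_const]

theorem noisyEntry_of_ne_zero {ε t y : ℝ} (hy : y ≠ 0) :
    noisyEntry ε t y =
      ((laplaceLaw ε).map fun τ => y + τ).map fun v => if t ≤ v then v else 0 := by
  have hm : Measurable fun v : ℝ => if t ≤ v then v else 0 :=
    Measurable.ite measurableSet_Ici measurable_id measurable_const
  rw [Measure.map_map hm (by fun_prop)]
  simp [noisyEntry, hy, Function.comp_def]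

theorem noisyEntry_le {ε t y y' : ℝ} (hε : 0 < ε) (hy : y ≠ 0) (hy' : y' ≠ 0) :
    noisyEntry ε t y ≤ ENNReal.ofReal (Real.exp (ε * |y - y'|)) • noisyEntry ε t y' := by
  rw [noisyEntry_of_ne_zero hy, noisyEntry_of_ne_zero hy', ← Measure.map_smul]
  exact Measure.map_mono (map_add_laplaceLaw_le hε y y')
    (Measurable.ite measurableSet_Ici measurable_id measurable_const)

theorem randomRound_of_mem {x : ℝ} (h0 : 0 < x) (h1 : x < 1) :
    randomRound x = ENNReal.ofReal x • Measure.dirac 1 +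
      ENNReal.ofReal (1 - x) • Measure.dirac 0 := by
  have hf : ⌊x⌋ = 0 := Int.floor_eq_iff.2 ⟨by simpa using h0.le, by simpa using h1⟩
  have hc : ⌈x⌉ = 1 := Int.ceil_eq_iff.2 ⟨by simpa using h0, by simpa using h1.le⟩
  simp [randomRound, hf, hc]

theorem roundSmall_of_le_one {x : ℝ} (h0 : 0 ≤ x) (h1 : x ≤ 1) :
    roundSmall x = ENNReal.ofReal x • Measure.dirac 1 +
      ENNReal.ofReal (1 - x) • Measure.dirac 0 := by
  rcases h0.eq_or_lt with rfl | h0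
  · simp [roundSmall]
  rcases h1.eq_or_lt with rfl | h1
  · simp [roundSmall]
  rw [roundSmall, if_pos ⟨h0, h1⟩, randomRound_of_mem h0 h1, Measure.map_add _ _ (by fun_prop),
    Measure.map_smul, Measure.map_smul, Measure.map_dirac, Measure.map_dirac]
  simp

theorem roundSmall_of_one_le {x : ℝ} (h1 : 1 ≤ x) : roundSmall x = Measure.dirac x := by
  rw [roundSmall, if_neg (fun h => absurd h.2 h1.not_gt)]

theorem map_prod_dirac_laplaceLaw {ε : ℝ} (hε : 0 < ε) (t y : ℝ) :
    open Classical in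
    ((Measure.dirac y).prod (laplaceLaw ε)).map
      (fun q => if q.1 ≠ 0 ∧ t ≤ q.1 + q.2 then q.1 + q.2 else 0) = noisyEntry ε t y := by
  have := isProbabilityMeasure_laplaceLaw hε
  rw [Measure.dirac_prod, Measure.map_map (measurable_thresholdMap t) (by fun_prop)]
  rfl

theorem thresholdEntry_of_one_le {ε t x : ℝ} (hε : 0 < ε) (h1 : 1 ≤ x) :
    thresholdEntry ε t x = noisyEntry ε t x := by
  rw [thresholdEntry, roundSmall_of_one_le h1, map_prod_dirac_laplaceLaw hε]

/-- Rounding makes the entry a mixture of the cases `1` and `0`. The closed interval is allowed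
because the unrounded endpoints obey the same formula. -/
theorem thresholdEntry_of_le_one {ε t x : ℝ} (hε : 0 < ε) (h0 : 0 ≤ x) (h1 : x ≤ 1) :
    thresholdEntry ε t x = ENNReal.ofReal x • noisyEntry ε t 1 +
      ENNReal.ofReal (1 - x) • Measure.dirac 0 := by
  have := isProbabilityMeasure_laplaceLaw hε
  rw [thresholdEntry, roundSmall_of_le_one h0 h1, Measure.add_prod,
    Measure.prod_smul_left, Measure.prod_smul_left,
    Measure.map_add _ _ (measurable_thresholdMap t), Measure.map_smul, Measure.map_smul,
    map_prod_dirac_laplaceLaw hε, map_prod_dirac_laplaceLaw hε, noisyEntry_zero hε]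

theorem thresholdEntry_zero {ε t : ℝ} (hε : 0 < ε) :
    thresholdEntry ε t 0 = Measure.dirac 0 := by
  rw [thresholdEntry_of_le_one hε le_rfl zero_le_one]
  simp

theorem isProbabilityMeasure_thresholdEntry {ε t x : ℝ} (hε : 0 < ε) (h0 : 0 ≤ x) :
    IsProbabilityMeasure (thresholdEntry ε t x) := by
  rcases le_total x 1 with h1 | h1
  · have := isProbabilityMeasure_noisyEntry hε t 1
    constructor
    rw [thresholdEntry_of_le_one hε h0 h1]
    simp [← ENNReal.ofReal_add h0 (sub_nonneg.2 h1)]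
  · rw [thresholdEntry_of_one_le hε h1]
    exact isProbabilityMeasure_noisyEntry hε t x

/-- The law of a noisy unit entry is an atom at `0` and a part of small mass. -/
theorem exists_noisyEntry_one_eq {ε t : ℝ} (hε : 0 < ε) (ht : 1 ≤ t) :
    ∃ (κ : Measure ℝ) (p : ℝ), 0 ≤ p ∧ p ≤ 1 ∧ p ≤ Real.exp (-(t - 1) * ε) / 2 ∧
      κ Set.univ = ENNReal.ofReal p ∧
      noisyEntry ε t 1 = κ + ENNReal.ofReal (1 - p) • Measure.dirac 0 := by
  have := isProbabilityMeasure_laplaceLaw hε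
  set S : Set ℝ := Set.Ici (t - 1) with hS
  have hSm : MeasurableSet S := measurableSet_Ici
  have hm := measurable_noisyMap t 1
  refine ⟨((laplaceLaw ε).restrict S).map
    (open Classical in fun τ => if (1 : ℝ) ≠ 0 ∧ t ≤ 1 + τ then 1 + τ else 0),
    (laplaceLaw ε S).toReal, ENNReal.toReal_nonneg,
    ENNReal.toReal_le_of_le_ofReal zero_le_one (by simpa using prob_le_one),
    ENNReal.toReal_le_of_le_ofReal (by positivity) (laplaceLaw_Ici_le hε (by linarith)), ?_, ?_⟩
  · rw [Measure.map_apply hm MeasurableSet.univ]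
    simp
  · have h1 : ENNReal.ofReal (1 - (laplaceLaw ε S).toReal) = laplaceLaw ε Sᶜ := by
      rw [prob_compl_eq_one_sub hSm, ENNReal.ofReal_sub _ ENNReal.toReal_nonneg]
      simp
    have h2 : ((laplaceLaw ε).restrict Sᶜ).map
        (open Classical in fun τ => if (1 : ℝ) ≠ 0 ∧ t ≤ 1 + τ then 1 + τ else 0) =
        laplaceLaw ε Sᶜ • Measure.dirac 0 := by
      rw [Measure.map_congr (g := fun _ => (0 : ℝ)), Measure.map_const]
      · simp
      · filter_upwards [ae_restrict_mem hSm.compl] with τ hτ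
        have : ¬ t ≤ 1 + τ := fun h => hτ (by simp only [hS, Set.mem_Ici]; linarith)
        simp [this]
    rw [h1, ← h2, ← Measure.map_add _ _ hm, Measure.restrict_add_restrict_compl hSm, noisyEntry]

/-- Inside `[0, 1]` the law at `z` is `z • κ` plus an atom of mass `1 - z p`. Two such laws differ
by mass `|x - x'| p`, taken from `κ` if `x` is the larger entry and from the atom otherwise, so no
multiplicative factor is needed. -/
theorem exists_thresholdEntry_le_add {ε t x x' : ℝ} (hε : 0 < ε) (ht : 1 ≤ t) (h0 : 0 ≤ x)
    (h1 : x ≤ 1) (h0' : 0 ≤ x') (h1' : x' ≤ 1) :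
    ∃ ρ : Measure ℝ, ρ Set.univ ≤ ENNReal.ofReal (|x - x'| * (Real.exp (-(t - 1) * ε) / 2)) ∧
      thresholdEntry ε t x ≤ thresholdEntry ε t x' + ρ := by
  obtain ⟨κ, p, hp0, hp1, hp, hκ, hE⟩ := exists_noisyEntry_one_eq hε ht
  have key : ∀ z, 0 ≤ z → z ≤ 1 → thresholdEntry ε t z =
      ENNReal.ofReal z • κ + ENNReal.ofReal (1 - z * p) • Measure.dirac 0 := by
    intro z hz0 hz1
    rw [thresholdEntry_of_le_one hε hz0 hz1, hE, smul_add, smul_smul, add_assoc, ← add_smul,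
      ← ENNReal.ofReal_mul hz0, ← ENNReal.ofReal_add (mul_nonneg hz0 (by linarith)) (by linarith)]
    congr 3; ring
  rw [key x h0 h1, key x' h0' h1']
  rcases le_total x' x with h | h
  · refine ⟨ENNReal.ofReal (x - x') • κ, ?_, ?_⟩
    · rw [Measure.smul_apply, hκ, smul_eq_mul, ← ENNReal.ofReal_mul (by linarith),
        abs_of_nonneg (by linarith)]
      exact ENNReal.ofReal_le_ofReal (mul_le_mul_of_nonneg_left hp (by linarith))
    · rw [add_right_comm, ← add_smul, ← ENNReal.ofReal_add h0' (by linarith), add_sub_cancel]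
      gcongr
  · refine ⟨ENNReal.ofReal ((x' - x) * p) • Measure.dirac 0, ?_, ?_⟩
    · simp only [Measure.smul_apply, measure_univ, smul_eq_mul, mul_one]
      rw [abs_sub_comm, abs_of_nonneg (by linarith)]
      exact ENNReal.ofReal_le_ofReal (mul_le_mul_of_nonneg_left hp (by linarith))
    · rw [add_assoc, ← add_smul, ← ENNReal.ofReal_add
        (by nlinarith) (mul_nonneg (by linarith) hp0)]
      have : 1 - x' * p + (x' - x) * p = 1 - x * p := by ring
      rw [this]
      gcongr

/-- The comparison is additive below `1` and multiplicative above; a pair on both sides of `1` is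
compared through `1`, each regime paying only for its part of the distance. The defect stands inside
the scalar multiple so that the factors can be pulled out of a product over the entries. -/
theorem exists_thresholdEntry_le {ε t x x' : ℝ} (hε : 0 < ε) (ht : 1 ≤ t) (h0 : 0 ≤ x)
    (h0' : 0 ≤ x') :
    ∃ ρ : Measure ℝ, ρ Set.univ ≤ ENNReal.ofReal (|x - x'| * (Real.exp (-(t - 1) * ε) / 2)) ∧
      thresholdEntry ε t x ≤
        ENNReal.ofReal (Real.exp (ε * |x - x'|)) • (thresholdEntry ε t x' + ρ) := by
  have hexp : ∀ z : ℝ, 0 ≤ z → (1 : ENNReal) ≤ ENNReal.ofReal (Real.exp (ε * z)) := fun z hz => by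
    rw [← ENNReal.ofReal_one]
    exact ENNReal.ofReal_le_ofReal (Real.one_le_exp (by positivity))
  have hsm : ∀ (z : ℝ) (μ : Measure ℝ), 0 ≤ z → μ ≤ ENNReal.ofReal (Real.exp (ε * z)) • μ :=
    fun z μ hz => by
      conv_lhs => rw [← one_smul ENNReal μ]
      gcongr
      exact hexp z hz
  have habove : ∀ {z z' : ℝ}, 1 ≤ z → 1 ≤ z' → thresholdEntry ε t z ≤
      ENNReal.ofReal (Real.exp (ε * |z - z'|)) • thresholdEntry ε t z' := fun hz hz' => by
    rw [thresholdEntry_of_one_le hε hz, thresholdEntry_of_one_le hε hz']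
    exact noisyEntry_le hε (by linarith) (by linarith)
  rcases le_total x 1 with h1 | h1 <;> rcases le_total x' 1 with h1' | h1'
  · obtain ⟨ρ, hρ, h⟩ := exists_thresholdEntry_le_add hε ht h0 h1 h0' h1'
    exact ⟨ρ, hρ, h.trans (hsm _ _ (abs_nonneg _))⟩
  · obtain ⟨ρ, hρ, h⟩ := exists_thresholdEntry_le_add hε ht h0 h1 zero_le_one le_rfl
    refine ⟨ρ, hρ.trans ?_, h.trans ?_⟩
    · gcongr ENNReal.ofReal (?_ * _)
      rw [abs_sub_comm, abs_of_nonneg (by linarith), abs_sub_comm, abs_of_nonneg (by linarith)]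
      linarith
    · rw [smul_add]
      refine add_le_add ((habove le_rfl h1').trans ?_) (hsm _ _ (abs_nonneg _))
      gcongr ENNReal.ofReal (Real.exp (_ * ?_)) • _
      rw [abs_sub_comm, abs_of_nonneg (by linarith), abs_sub_comm, abs_of_nonneg (by linarith)]
      linarith
  · obtain ⟨ρ, hρ, h⟩ := exists_thresholdEntry_le_add hε ht zero_le_one le_rfl h0' h1'
    refine ⟨ρ, hρ.trans ?_, (habove h1 le_rfl).trans ?_⟩
    · gcongr ENNReal.ofReal (?_ * _)
      rw [abs_of_nonneg (by linarith), abs_of_nonneg (by linarith)]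
      linarith
    · gcongr ENNReal.ofReal (Real.exp (_ * ?_)) • ?_
      · rw [abs_of_nonneg (by linarith), abs_of_nonneg (by linarith)]
        linarith
  · exact ⟨0, by simp, by simpa using habove h1 h1'⟩

/-- A measure above a probability measure with total mass at most `1 + c` cannot exceed it by more
than `c` on any set, since it does not fall short on the complement. -/
theorem measure_le_add_sub {Ω : Type*} [MeasurableSpace Ω] {μ ν : Measure Ω}
    [IsProbabilityMeasure ν] (h : ν ≤ μ) {c : ENNReal} (hμ : μ Set.univ ≤ 1 + c) {S : Set Ω}
    (hS : MeasurableSet S) : μ S ≤ ν S + c := by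
  have h1 : μ S + ν Sᶜ ≤ ν S + c + ν Sᶜ := by
    calc μ S + ν Sᶜ ≤ μ S + μ Sᶜ := by gcongr
      _ = μ Set.univ := measure_add_measure_compl hS
      _ ≤ 1 + c := hμ
      _ = (ν S + ν Sᶜ) + c := by rw [measure_add_measure_compl hS, measure_univ]
      _ = ν S + c + ν Sᶜ := by ring
  exact (ENNReal.add_le_add_iff_right (measure_ne_top ν _)).1 h1

theorem exp_sub_one_le {p : ℝ} (h0 : 0 ≤ p) (h1 : p ≤ 1 / 2) : Real.exp p - 1 ≤ 2 * p := by
  have h := Real.one_sub_le_exp_neg p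
  have h2 : Real.exp p * Real.exp (-p) = 1 := by rw [← Real.exp_add]; simp
  have h3 := Real.exp_pos p
  nlinarith

theorem isProbabilityMeasure_thresholdMechanism {d : ℕ} {ε δ : ℝ} {x : Fin d → ℝ} (hε : 0 < ε)
    (hx : ∀ i, 0 ≤ x i) : IsProbabilityMeasure (thresholdMechanism ε δ x) := by
  have := fun i => isProbabilityMeasure_thresholdEntry (t := thresholdValue ε δ) hε (hx i)
  unfold thresholdMechanism
  infer_instance

theorem isDP_thresholdMechanism {d k : ℕ} {ε δ : ℝ} (hε : 0 < ε) (hδ : 0 < δ) (hδ1 : δ ≤ 1) :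
    IsDP k ε δ (thresholdMechanism (d := d) ε δ) := by
  intro x x' hx hx' _ _ hxx S hS
  set t := thresholdValue ε δ with ht
  have hlog : 0 ≤ Real.log (1 / δ) := Real.log_nonneg (by rw [le_div_iff₀ hδ]; linarith)
  have ht1 : 1 ≤ t := by
    have : 0 ≤ Real.log (1 / δ) / ε := by positivity
    rw [ht, thresholdValue]; linarith
  set p := Real.exp (-(t - 1) * ε) / 2 with hp
  -- This explains the summand `2` of the threshold: one unit compensates for the value of a unit
  -- entry, the other for the factor `exp ε` that multiplies the defect.
  have hpe : Real.exp ε * (2 * p) = δ := by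
    have : -(t - 1) * ε = Real.log δ - ε := by
      rw [ht, thresholdValue, one_div, Real.log_inv]; field_simp; ring
    rw [hp, this, Real.exp_sub, Real.exp_log hδ]
    field_simp
  have hp0 : 0 ≤ p := by positivity
  have hp1 : p ≤ 1 / 2 := by
    have : Real.exp (-(t - 1) * ε) ≤ 1 := Real.exp_le_one_iff.2 (by nlinarith)
    linarith
  choose ρ hρ hT using fun i => exists_thresholdEntry_le hε ht1 (hx i) (hx' i)
  have := fun i => isProbabilityMeasure_thresholdEntry (t := t) hε (hx' i)
  have hρf : ∀ i, IsFiniteMeasure (ρ i) := fun i => ⟨(hρ i).trans_lt ENNReal.ofReal_lt_top⟩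
  have := isProbabilityMeasure_thresholdMechanism (δ := δ) hε hx'
  have hle : thresholdMechanism ε δ x ≤ ENNReal.ofReal (Real.exp ε) •
      Measure.pi fun i => thresholdEntry ε t (x' i) + ρ i := by
    refine (pi_le_pi hT).trans ?_
    have h := pi_smul_eq (fun i => thresholdEntry ε t (x' i) + ρ i)
      (fun i => (Real.exp (ε * |x i - x' i|)).toNNReal)
    refine (le_of_eq h).trans ?_
    have h2 : (∏ i, (Real.exp (ε * |x i - x' i|)).toNNReal) ≤ (Real.exp ε).toNNReal := by
      rw [← Real.toNNReal_prod_of_nonneg (fun i _ => (Real.exp_pos _).le), ← Real.exp_sum,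
        ← Finset.mul_sum]
      gcongr
      nlinarith
    refine Measure.le_iff.2 fun A _ => ?_
    simp only [Measure.smul_apply, ENNReal.smul_def, smul_eq_mul]
    gcongr
    exact ENNReal.coe_le_coe.2 h2
  -- Since the distances sum to at most one, the defects raise the mass of the product to at most
  -- `exp p ≤ 1 + 2 p`.
  have hmass : (Measure.pi fun i => thresholdEntry ε t (x' i) + ρ i) Set.univ ≤
      1 + ENNReal.ofReal (2 * p) := by
    rw [Measure.pi_univ]
    calc ∏ i, (thresholdEntry ε t (x' i) + ρ i) Set.univ
        ≤ ∏ i, ENNReal.ofReal (Real.exp (|x i - x' i| * p)) := by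
          refine Finset.prod_le_prod' fun i _ => ?_
          rw [Measure.add_apply, measure_univ]
          calc 1 + ρ i Set.univ ≤ ENNReal.ofReal 1 + ENNReal.ofReal (|x i - x' i| * p) := by
                rw [ENNReal.ofReal_one]; gcongr; exact hρ i
            _ = ENNReal.ofReal (1 + |x i - x' i| * p) :=
                (ENNReal.ofReal_add zero_le_one (by positivity)).symm
            _ ≤ _ := ENNReal.ofReal_le_ofReal (by
                have := Real.add_one_le_exp (|x i - x' i| * p); linarith)
      _ = ENNReal.ofReal (Real.exp (∑ i, |x i - x' i| * p)) := by
          rw [← ENNReal.ofReal_prod_of_nonneg (fun i _ => (Real.exp_pos _).le), Real.exp_sum]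
      _ ≤ ENNReal.ofReal (1 + 2 * p) := by
          refine ENNReal.ofReal_le_ofReal ?_
          have h1 := exp_sub_one_le hp0 hp1
          have h2 : Real.exp (∑ i, |x i - x' i| * p) ≤ Real.exp p := by
            rw [Real.exp_le_exp, ← Finset.sum_mul]; nlinarith
          linarith
      _ = _ := by rw [ENNReal.ofReal_add zero_le_one (by positivity), ENNReal.ofReal_one]
  calc thresholdMechanism ε δ x S
      ≤ ENNReal.ofReal (Real.exp ε) *
        (Measure.pi fun i => thresholdEntry ε t (x' i) + ρ i) S := hle S
    _ ≤ ENNReal.ofReal (Real.exp ε) *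
        (thresholdMechanism ε δ x' S + ENNReal.ofReal (2 * p)) := by
        gcongr
        exact measure_le_add_sub
          (pi_le_pi fun i => Measure.le_add_right le_rfl) hmass hS
    _ = _ := by
        rw [mul_add, ← ENNReal.ofReal_mul (Real.exp_pos _).le, hpe]

/-! # Privacy of the ALP projection -/

theorem isProbabilityMeasure_coin {p : ℝ} (h0 : 0 ≤ p) (h1 : p ≤ 1) :
    IsProbabilityMeasure (coin p) := by
  constructor
  simp [coin, ← ENNReal.ofReal_add h0 (sub_nonneg.2 h1)]

instance (p : ℝ) : IsFiniteMeasure (coin p) := by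
  constructor
  simp [coin]

theorem isProbabilityMeasure_randomRound (r : ℝ) : IsProbabilityMeasure (randomRound r) := by
  constructor
  have h0 := Int.floor_le r
  have h1 := (Int.lt_floor_add_one r).le
  simp only [randomRound, Measure.add_apply, Measure.smul_apply, measure_univ, smul_eq_mul, mul_one]
  rw [← ENNReal.ofReal_add (by linarith) (by linarith)]
  simp

/-- With flip probability `1 / (α + 2)` the odds of no flip are exactly `α + 1`. -/
theorem coin_map_xor_le {α : ℝ} (hα : 0 ≤ α) (c : Bool) :
    (coin (1 / (α + 2))).map (xor c) ≤
      (if c then (α + 1).toNNReal else 1) • coin (1 / (α + 2)) := by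
  cases c
  · have : xor false = id := by ext b; simp
    simp [this]
  · have h1 : (1 : ℝ) - 1 / (α + 2) = (α + 1) * (1 / (α + 2)) := by field_simp; ring
    have hle : 1 / (α + 2) ≤ 1 := by rw [div_le_one (by linarith)]; linarith
    have hn : (1 : ℝ) / (α + 2) ≤ (α + 1) * (1 - 1 / (α + 2)) := by
      rw [h1, ← mul_assoc]
      exact le_mul_of_one_le_left (by positivity) (by nlinarith)
    rw [coin, Measure.map_add _ _ .of_discrete, Measure.map_smul, Measure.map_smul,
      Measure.map_dirac, Measure.map_dirac, if_pos rfl, smul_add]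
    simp only [Bool.bne_true, Bool.not_true, Bool.not_false, ← smul_assoc, ENNReal.smul_def,
      smul_eq_mul, Bool.true_bne]
    rw [add_comm]
    change _ ≤ (ENNReal.ofReal (α + 1) * _) • _ + (ENNReal.ofReal (α + 1) * _) • _
    rw [← ENNReal.ofReal_mul (by linarith), ← ENNReal.ofReal_mul (by linarith), h1]
    rw [h1] at hn
    gcongr

/-- The law of the flips of randomized response. -/
noncomputable def flips (s m : ℕ) (p : ℝ) : Measure (Fin s → Fin m → Bool) :=
  Measure.pi fun _ : Fin s => Measure.pi fun _ : Fin m => coin p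

theorem prod_ite_le {ι κ : Type*} [Fintype ι] [Fintype κ] {c : ι → κ → Bool}
    (hc : ∀ a b a' b', c a b = true → c a' b' = true → a = a' ∧ b = b') {v : NNReal}
    (hv : 1 ≤ v) : ∏ a, ∏ b, (if c a b = true then v else 1) ≤ v := by
  classical
  by_cases h : ∃ a b, c a b = true
  · obtain ⟨a, b, hab⟩ := h
    rw [Finset.prod_eq_single a, Finset.prod_eq_single b]
    · simp [hab]
    · intro b' _ hb'
      rw [if_neg]
      exact fun h => hb' (hc _ _ _ _ h hab).2
    · simp
    · intro a' _ ha'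
      refine Finset.prod_eq_one fun b' _ => ?_
      rw [if_neg]
      exact fun h => ha' (hc _ _ _ _ h hab).1
    · simp
  · push Not at h
    simpa [h] using hv

/-- The array `c` has at most one true cell, so the randomized-response ratio is paid at most once.
-/
theorem flips_map_xor_le {s m : ℕ} {α : ℝ} (hα : 0 ≤ α) {c : Fin s → Fin m → Bool}
    (hc : ∀ a b a' b', c a b = true → c a' b' = true → a = a' ∧ b = b') :
    (flips s m (1 / (α + 2))).map (fun e a b => xor (c a b) (e a b)) ≤
      ENNReal.ofReal (α + 1) • flips s m (1 / (α + 2)) := by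
  have h1 : (flips s m (1 / (α + 2))).map (fun e a b => xor (c a b) (e a b)) =
      Measure.pi fun a => Measure.pi fun b => (coin (1 / (α + 2))).map (xor (c a b)) := by
    rw [flips, Measure.pi_map_pi (f := fun a (e : Fin m → Bool) b => xor (c a b) (e b))
      fun a => (Measurable.of_discrete).aemeasurable]
    congr 1; ext1 a
    exact Measure.pi_map_pi (f := fun b => xor (c a b))
      fun b => (Measurable.of_discrete).aemeasurable
  rw [h1]
  have h2 := pi_le_pi fun a => pi_le_pi fun b => coin_map_xor_le hα (c a b)
  refine h2.trans ?_
  simp_rw [pi_smul_eq]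
  refine Measure.le_iff.2 fun A _ => ?_
  simp only [Measure.smul_apply, ENNReal.smul_def, smul_eq_mul]
  gcongr
  · refine ENNReal.coe_le_coe.2 (prod_ite_le hc ?_)
    rw [← Real.toNNReal_one]
    exact Real.toNNReal_le_toNNReal (by linarith)
  · rfl

/-- The law of the hash functions. -/
noncomputable def hashLaw (N m : ℕ) : Measure (Fin m → Fin N) :=
  Measure.pi fun _ : Fin m => uniformOn (Set.univ : Set (Fin N))

theorem isProbabilityMeasure_hashLaw {N : ℕ} (hN : 0 < N) (m : ℕ) :
    IsProbabilityMeasure (hashLaw N m) := by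
  have : Nonempty (Fin N) := ⟨⟨0, hN⟩⟩
  unfold hashLaw; infer_instance

instance (s m : ℕ) (p : ℝ) : IsFiniteMeasure (flips s m p) := by
  unfold flips; infer_instance

instance (N m : ℕ) : IsFiniteMeasure (hashLaw N m) := by
  unfold hashLaw; infer_instance

theorem isProbabilityMeasure_flips (s m : ℕ) {α : ℝ} (hα : 0 ≤ α) :
    IsProbabilityMeasure (flips s m (1 / (α + 2))) := by
  have := isProbabilityMeasure_coin (p := 1 / (α + 2)) (by positivity)
    (by rw [div_le_one (by linarith)]; linarith)
  unfold flips; infer_instance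

/-- The array with flips `e`. -/
noncomputable def noisyArray {N d s m : ℕ} (hash : Fin N → Fin d → Fin s) (y : Fin d → ℤ)
    (h : Fin m → Fin N) (e : Fin s → Fin m → Bool) : ALPOutput N s m :=
  (h, fun a b => xor (embedding hash h y a b) (e a b))

/-- The probability of an output in `S`, given the rounded vector. -/
noncomputable def outputProb {N d s m : ℕ} (hash : Fin N → Fin d → Fin s) (p : ℝ)
    (S : Set (ALPOutput N s m)) (y : Fin d → ℤ) : ENNReal :=
  ∫⁻ h, flips s m p {e | noisyArray hash y h e ∈ S} ∂hashLaw N m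

/-- By independence the rounding can be integrated last; the later arguments fix the rounded vector
and work with the hash functions and flips alone. -/
theorem lintegral_alp1Projection {N d s m : ℕ} {α : ℝ}
    (hash : Fin N → Fin d → Fin s) (x : Fin d → ℝ) (f : ALPOutput N s m → ENNReal) :
    ∫⁻ o, f o ∂alp1Projection α m hash x =
      ∫⁻ y, ∫⁻ h, ∫⁻ e, f (noisyArray hash y h e) ∂flips s m (1 / (α + 2)) ∂hashLaw N m
        ∂Measure.pi fun i => randomRound (x i / α) := by
  have := fun i => isProbabilityMeasure_randomRound (x i / α)
  have hfl : IsFiniteMeasure (flips s m (1 / (α + 2))) := inferInstance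
  have hhl : IsFiniteMeasure (hashLaw N m) := inferInstance
  rw [alp1Projection, lintegral_map .of_discrete .of_discrete]
  change ∫⁻ q, f (noisyArray hash q.2.1 q.1 q.2.2) ∂(hashLaw N m).prod
    ((Measure.pi fun i => randomRound (x i / α)).prod (flips s m (1 / (α + 2)))) = _
  rw [lintegral_prod _ Measurable.of_discrete.aemeasurable]
  symm
  rw [lintegral_lintegral_swap Measurable.of_discrete.aemeasurable]
  refine lintegral_congr fun h => ?_
  rw [lintegral_prod _ Measurable.of_discrete.aemeasurable]

theorem alp1Projection_apply {N d s m : ℕ} {α : ℝ}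
    (hash : Fin N → Fin d → Fin s) (x : Fin d → ℝ) (S : Set (ALPOutput N s m)) :
    alp1Projection α m hash x S =
      ∫⁻ y, outputProb hash (1 / (α + 2)) S y ∂Measure.pi fun i => randomRound (x i / α) := by
  rw [← lintegral_indicator_one (.of_discrete), lintegral_alp1Projection]
  simp only [outputProb]
  congr 1; ext y; congr 1; ext h
  rw [← lintegral_indicator_one (.of_discrete)]
  rfl

/-- Raising `y i` by one extends its unary representation by a single column, whose index is the old
value, and the hash function of that column selects a single row. -/
theorem embedding_ne {N d s m : ℕ} {hash : Fin N → Fin d → Fin s} {h : Fin m → Fin N}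
    {y : Fin d → ℤ} {i : Fin d} {a : Fin s} {b : Fin m}
    (hne : embedding hash h y a b ≠ embedding hash h (Function.update y i (y i + 1)) a b) :
    (b : ℤ) = y i ∧ hash (h b) i = a := by
  classical
  by_contra hn
  refine hne ?_
  simp only [embedding, decide_eq_decide]
  refine exists_congr fun j => ?_
  rcases eq_or_ne j i with rfl | hj
  · simp only [Function.update_self]
    refine and_congr_left fun ha => ?_
    have : (b : ℤ) ≠ y j := fun hb => hn ⟨hb, ha⟩
    omega
  · simp [hj]

/-- For fixed hash functions the two embeddings differ in at most one bit. Translating the flips by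
this difference carries one output to the other. -/
theorem outputProb_le {N d s m : ℕ} {α : ℝ} (hα : 0 ≤ α) (hash : Fin N → Fin d → Fin s)
    (S : Set (ALPOutput N s m)) {y y' : Fin d → ℤ}
    (hyy : ∃ i, y' = Function.update y i (y i + 1) ∨ y = Function.update y' i (y' i + 1)) :
    outputProb hash (1 / (α + 2)) S y ≤
      ENNReal.ofReal (α + 1) * outputProb hash (1 / (α + 2)) S y' := by
  obtain ⟨i, hi⟩ := hyy
  rw [outputProb, outputProb, ← lintegral_const_mul _ .of_discrete]
  refine lintegral_mono fun h => ?_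
  have hc : ∀ a b a' b', xor (embedding hash h y a b) (embedding hash h y' a b) = true →
      xor (embedding hash h y a' b') (embedding hash h y' a' b') = true → a = a' ∧ b = b' := by
    intro a b a' b' h1 h2
    simp only [bne_iff_ne] at h1 h2
    obtain ⟨z, hz⟩ : ∃ z : ℤ, ∀ a b, embedding hash h y a b ≠ embedding hash h y' a b →
        (b : ℤ) = z ∧ hash (h b) i = a := by
      rcases hi with rfl | rfl
      · exact ⟨y i, fun a b => embedding_ne⟩
      · exact ⟨y' i, fun a b hab => embedding_ne hab.symm⟩
    have e1 := hz a b h1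
    have e2 := hz a' b' h2
    have hb : b = b' := Fin.ext (by have := e1.1.trans e2.1.symm; exact_mod_cast this)
    subst hb
    exact ⟨e1.2.symm.trans e2.2, rfl⟩
  have := flips_map_xor_le hα hc {e | noisyArray hash y' h e ∈ S}
  rw [Measure.map_apply .of_discrete .of_discrete] at this
  refine le_trans (le_of_eq ?_) this
  congr 1
  ext e
  simp only [Set.mem_ofPred_eq, noisyArray, Set.mem_preimage]
  have : ∀ u v e : Bool, xor u e = xor v (xor (xor u v) e) := by decide
  simp_rw [← this]

/-- The closed cell makes the mean an affine interpolation up to both endpoints, so that adjacent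
cells can be glued. -/
theorem lintegral_randomRound (g : ℤ → ENNReal) {r : ℝ} {n : ℤ} (h0 : n ≤ r) (h1 : r ≤ n + 1) :
    ∫⁻ z, g z ∂randomRound r =
      ENNReal.ofReal (r - n) * g (n + 1) + ENNReal.ofReal (1 - (r - n)) * g n := by
  rw [randomRound, lintegral_add_measure, lintegral_smul_measure, lintegral_smul_measure,
    lintegral_dirac, lintegral_dirac]
  rcases h1.eq_or_lt with rfl | h1
  · have hf : ⌊(n : ℝ) + 1⌋ = n + 1 := by simp
    have hc : ⌈(n : ℝ) + 1⌉ = n + 1 := by simp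
    simp [hf, hc]
  · have hf : ⌊r⌋ = n := Int.floor_eq_iff.2 ⟨h0, h1⟩
    rcases h0.eq_or_lt with rfl | h0
    · simp
    · have hc : ⌈r⌉ = n + 1 := Int.ceil_eq_iff.2 ⟨by push_cast; linarith, by push_cast; linarith⟩
      simp [hf, hc]

/-- Endpoint values within a factor `α + 1` of each other give an interpolation whose slope is at
most `α` times any of its values; then `1 + z ≤ exp z` applies. -/
theorem mixture_le {A B : ENNReal} {α f f' : ℝ} (hα : 0 ≤ α)
    (hA : A ≤ ENNReal.ofReal (α + 1) * B) (hB : B ≤ ENNReal.ofReal (α + 1) * A) (hf0 : 0 ≤ f)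
    (hf1 : f ≤ 1) (hf0' : 0 ≤ f') (hf1' : f' ≤ 1) :
    ENNReal.ofReal f * B + ENNReal.ofReal (1 - f) * A ≤ ENNReal.ofReal (Real.exp (α * |f - f'|)) *
      (ENNReal.ofReal f' * B + ENNReal.ofReal (1 - f') * A) := by
  rcases eq_or_ne A ⊤ with rfl | hAt
  · have hBt : B = ⊤ := by
      by_contra hBt
      exact (ENNReal.mul_lt_top ENNReal.ofReal_lt_top (lt_top_iff_ne_top.2 hBt)).not_ge hA
    have hone : ENNReal.ofReal f' + ENNReal.ofReal (1 - f') ≠ 0 := by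
      rw [← ENNReal.ofReal_add hf0' (by linarith)]; simp
    rw [hBt, ← add_mul, ← add_mul, ENNReal.mul_top hone,
      ENNReal.mul_top (a := ENNReal.ofReal (Real.exp _)) (by simp [Real.exp_pos])]
    exact le_top
  have hBt : B ≠ ⊤ := fun h => (ENNReal.mul_lt_top ENNReal.ofReal_lt_top
    (lt_top_iff_ne_top.2 hAt)).not_ge (h ▸ hB)
  obtain ⟨a, ha, rfl⟩ : ∃ a : ℝ, 0 ≤ a ∧ A = ENNReal.ofReal a :=
    ⟨A.toReal, ENNReal.toReal_nonneg, (ENNReal.ofReal_toReal hAt).symm⟩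
  obtain ⟨b, hb, rfl⟩ : ∃ b : ℝ, 0 ≤ b ∧ B = ENNReal.ofReal b :=
    ⟨B.toReal, ENNReal.toReal_nonneg, (ENNReal.ofReal_toReal hBt).symm⟩
  rw [← ENNReal.ofReal_mul (by linarith), ENNReal.ofReal_le_ofReal_iff (by positivity)] at hA hB
  have hf2 : 0 ≤ 1 - f := by linarith
  have hf2' : 0 ≤ 1 - f' := by linarith
  rw [← ENNReal.ofReal_mul hf0, ← ENNReal.ofReal_mul hf2, ← ENNReal.ofReal_mul hf0',
    ← ENNReal.ofReal_mul hf2', ← ENNReal.ofReal_add (by positivity) (by positivity),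
    ← ENNReal.ofReal_add (by positivity) (by positivity),
    ← ENNReal.ofReal_mul (Real.exp_pos _).le]
  refine ENNReal.ofReal_le_ofReal ?_
  have hexp := Real.add_one_le_exp (α * |f - f'|)
  have hM : 0 ≤ f' * b + (1 - f') * a := by positivity
  refine le_trans ?_ (mul_le_mul_of_nonneg_right hexp hM)
  -- The endpoints differ by at most `α` times the smaller one, and the smaller one is at most the
  -- mixture.
  have hab : |b - a| ≤ α * (f' * b + (1 - f') * a) := by
    rw [abs_le]
    rcases le_total a b with h | h
    · have : a ≤ f' * b + (1 - f') * a := by nlinarith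
      constructor <;> nlinarith
    · have : b ≤ f' * b + (1 - f') * a := by nlinarith
      constructor <;> nlinarith
  have h3 : (f - f') * (b - a) ≤ |f - f'| * (α * (f' * b + (1 - f') * a)) := by
    refine (le_abs_self _).trans ?_
    rw [abs_mul]
    gcongr
  nlinarith

/-- The bound on one cell is chained through the integers between `r` and `r'`; lengths add along
the chain, so the exponentials multiply without loss. -/
theorem lintegral_randomRound_le {g : ℤ → ENNReal} {α : ℝ} (hα : 0 ≤ α)
    (h1 : ∀ n, g n ≤ ENNReal.ofReal (α + 1) * g (n + 1))
    (h2 : ∀ n, g (n + 1) ≤ ENNReal.ofReal (α + 1) * g n) (r r' : ℝ) :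
    ∫⁻ z, g z ∂randomRound r ≤
      ENNReal.ofReal (Real.exp (α * |r - r'|)) * ∫⁻ z, g z ∂randomRound r' := by
  have cell : ∀ (n : ℤ) (q q' : ℝ), n ≤ q → q ≤ n + 1 → n ≤ q' → q' ≤ n + 1 →
      ∫⁻ z, g z ∂randomRound q ≤
        ENNReal.ofReal (Real.exp (α * |q - q'|)) * ∫⁻ z, g z ∂randomRound q' := by
    intro n q q' h3 h4 h5 h6
    rw [lintegral_randomRound g h3 h4, lintegral_randomRound g h5 h6]
    have := mixture_le (f := q - n) (f' := q' - n) hα (h1 n) (h2 n) (by linarith) (by linarith)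
      (by linarith) (by linarith)
    rwa [sub_sub_sub_cancel_right] at this
  have chain : ∀ {a b c : ℝ}, |a - b| + |b - c| = |a - c| →
      (∫⁻ z, g z ∂randomRound a ≤
        ENNReal.ofReal (Real.exp (α * |a - b|)) * ∫⁻ z, g z ∂randomRound b) →
      (∫⁻ z, g z ∂randomRound b ≤
        ENNReal.ofReal (Real.exp (α * |b - c|)) * ∫⁻ z, g z ∂randomRound c) →
      ∫⁻ z, g z ∂randomRound a ≤
        ENNReal.ofReal (Real.exp (α * |a - c|)) * ∫⁻ z, g z ∂randomRound c := by
    intro a b c hd hab hbc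
    refine hab.trans ?_
    rw [← hd, mul_add, Real.exp_add, ENNReal.ofReal_mul (Real.exp_pos _).le, mul_assoc]
    gcongr
  -- The induction is on the number of integers crossed. Both directions are carried along, since
  -- the inequality is not symmetric.
  have main : ∀ (k : ℕ) (q q' : ℝ), q ≤ q' → q' ≤ ⌊q⌋ + 1 + k →
      (∫⁻ z, g z ∂randomRound q ≤
        ENNReal.ofReal (Real.exp (α * |q - q'|)) * ∫⁻ z, g z ∂randomRound q') ∧
      ∫⁻ z, g z ∂randomRound q' ≤
        ENNReal.ofReal (Real.exp (α * |q' - q|)) * ∫⁻ z, g z ∂randomRound q := by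
    intro k
    induction k with
    | zero =>
      intro q q' h3 h4
      have h5 := Int.floor_le q
      have h6 := (Int.lt_floor_add_one q).le
      simp only [Nat.cast_zero, add_zero] at h4
      exact ⟨cell ⌊q⌋ q q' h5 h6 (h5.trans h3) h4, cell ⌊q⌋ q' q (h5.trans h3) h4 h5 h6⟩
    | succ k ih =>
      intro q q' h3 h4
      have h5 := Int.floor_le q
      have h6 := (Int.lt_floor_add_one q).le
      rcases le_total q' (⌊q⌋ + 1) with h7 | h7
      · exact ⟨cell ⌊q⌋ q q' h5 h6 (h5.trans h3) h7, cell ⌊q⌋ q' q (h5.trans h3) h7 h5 h6⟩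
      · have hfl : ⌊(⌊q⌋ : ℝ) + 1⌋ = ⌊q⌋ + 1 := by simp
        have h8 := ih (⌊q⌋ + 1) q' h7 (by rw [hfl]; push_cast at h4 ⊢; linarith)
        have e1 : |q - (⌊q⌋ + 1)| + |(⌊q⌋ : ℝ) + 1 - q'| = |q - q'| := by
          rw [abs_of_nonpos (by linarith), abs_of_nonpos (by linarith),
            abs_of_nonpos (by linarith)]
          ring
        refine ⟨chain e1 (cell ⌊q⌋ _ _ h5 h6 (by linarith) le_rfl) h8.1,
          chain ?_ h8.2 (cell ⌊q⌋ _ _ (by linarith) le_rfl h5 h6)⟩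
        rw [abs_sub_comm q' q, ← e1, abs_sub_comm q', abs_sub_comm _ q, add_comm]
  rcases le_total r r' with h | h
  · obtain ⟨k, hk⟩ := exists_nat_ge (r' - ⌊r⌋ - 1)
    exact (main k r r' h (by linarith)).1
  · obtain ⟨k, hk⟩ := exists_nat_ge (r - ⌊r'⌋ - 1)
    exact (main k r' r h (by linarith)).2

/-- A hybrid argument replaces the rounding laws one coordinate at a time. Averaging over other
coordinates preserves the ratio bound in coordinate `i`, which is what `lip` records. -/
theorem lintegral_pi_randomRound_le {d : ℕ} {G : (Fin d → ℤ) → ENNReal} {α : ℝ} (hα : 0 ≤ α)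
    (h1 : ∀ y i, G y ≤ ENNReal.ofReal (α + 1) * G (Function.update y i (y i + 1)))
    (h2 : ∀ y i, G (Function.update y i (y i + 1)) ≤ ENNReal.ofReal (α + 1) * G y)
    (r r' : Fin d → ℝ) :
    ∫⁻ y, G y ∂(Measure.pi fun i => randomRound (r i)) ≤
      ENNReal.ofReal (Real.exp (α * ∑ i, |r i - r' i|)) *
        ∫⁻ y, G y ∂(Measure.pi fun i => randomRound (r' i)) := by
  have hp := fun i => isProbabilityMeasure_randomRound (r i)
  have hp' := fun i => isProbabilityMeasure_randomRound (r' i)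
  set μ : Fin d → Measure ℤ := fun i => randomRound (r i)
  set ν : Fin d → Measure ℤ := fun i => randomRound (r' i)
  have hG : Measurable G := .of_discrete
  have lip : ∀ (s : Finset (Fin d)) (i : Fin d), i ∉ s → ∀ y n n',
      (∀ z, G (Function.update z i n) ≤ ENNReal.ofReal (α + 1) * G (Function.update z i n')) →
      lmarginal ν s G (Function.update y i n) ≤
        ENNReal.ofReal (α + 1) * lmarginal ν s G (Function.update y i n') := by
    intro s i hi y n n' h
    rw [lmarginal_update_of_notMem hG hi, lmarginal_update_of_notMem hG hi, lmarginal, lmarginal,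
      ← lintegral_const_mul _ .of_discrete]
    exact lintegral_mono fun z => h _
  have main : ∀ (s : Finset (Fin d)) (y : Fin d → ℤ), lmarginal μ s G y ≤
      ENNReal.ofReal (Real.exp (α * ∑ i ∈ s, |r i - r' i|)) * lmarginal ν s G y := by
    intro s
    induction s using Finset.induction with
    | empty => simp
    | insert i s hi ih =>
      intro y
      rw [lmarginal_insert _ hG hi, lmarginal_insert _ hG hi, Finset.sum_insert hi, mul_add,
        Real.exp_add, mul_comm (Real.exp _), ENNReal.ofReal_mul (Real.exp_pos _).le, mul_assoc]
      calc ∫⁻ n, lmarginal μ s G (Function.update y i n) ∂μ i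
          ≤ ∫⁻ n, ENNReal.ofReal (Real.exp (α * ∑ i ∈ s, |r i - r' i|)) *
              lmarginal ν s G (Function.update y i n) ∂μ i := lintegral_mono fun n => ih _
        _ = ENNReal.ofReal (Real.exp (α * ∑ i ∈ s, |r i - r' i|)) *
              ∫⁻ n, lmarginal ν s G (Function.update y i n) ∂μ i :=
            lintegral_const_mul _ .of_discrete
        _ ≤ _ := by
            gcongr
            refine lintegral_randomRound_le hα (fun n => lip s i hi y _ _ fun z => ?_)
              (fun n => lip s i hi y _ _ fun z => ?_) _ _
            · simpa using h1 (Function.update z i n) i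
            · simpa using h2 (Function.update z i n) i
  have := main Finset.univ 0
  rwa [lmarginal_univ, lmarginal_univ] at this

/-- The scaling by `ε / α` makes a unit of distance cost `α * (ε / α) = ε`, with no additive loss.
-/
theorem alpProjection_le {N d s m : ℕ} {α ε : ℝ} (hα : 0 < α) (hε : 0 ≤ ε)
    (hash : Fin N → Fin d → Fin s) {x x' : Fin d → ℝ} (hxx : ∑ i, |x i - x' i| ≤ 1) :
    alpProjection α ε m hash x ≤
      ENNReal.ofReal (Real.exp ε) • alpProjection α ε m hash x' := by
  refine Measure.le_iff.2 fun S _ => ?_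
  rw [Measure.smul_apply, alpProjection, alpProjection, alp1Projection_apply,
    alp1Projection_apply, smul_eq_mul]
  refine (lintegral_pi_randomRound_le hα.le
    (fun y i => outputProb_le hα.le hash S ⟨i, .inl rfl⟩)
    (fun y i => outputProb_le hα.le hash S ⟨i, .inr rfl⟩) _
    fun i => x' i * ε / α).trans ?_
  gcongr
  calc α * ∑ i, |x i * ε / α - x' i * ε / α| = ε * ∑ i, |x i - x' i| := by
        rw [Finset.mul_sum, Finset.mul_sum]
        refine Finset.sum_congr rfl fun i _ => ?_
        rw [← sub_div, ← sub_mul, abs_div, abs_mul, abs_of_pos hα, abs_of_nonneg hε]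
        field_simp
    _ ≤ ε := by nlinarith

/-! # Privacy of the combined mechanism -/

theorem isProbabilityMeasure_alpProjection {N d s m : ℕ} (hN : 0 < N) {α ε : ℝ} (hα : 0 ≤ α)
    (hash : Fin N → Fin d → Fin s) (x : Fin d → ℝ) :
    IsProbabilityMeasure (alpProjection α ε m hash x) := by
  have := isProbabilityMeasure_hashLaw hN m
  have : IsProbabilityMeasure
      (Measure.pi fun _ : Fin s => Measure.pi fun _ : Fin m => coin (1 / (α + 2))) :=
    isProbabilityMeasure_flips s m hα
  have := fun i => isProbabilityMeasure_randomRound (x i * ε / α)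
  have : IsProbabilityMeasure
      (Measure.pi fun _ : Fin m => uniformOn (Set.univ : Set (Fin N))) :=
    isProbabilityMeasure_hashLaw hN m
  exact Measure.isProbabilityMeasure_map Measurable.of_discrete.aemeasurable

/-- The set is sliced along the second output. Changing the first law on each slice before changing
the second means that `δ` is integrated against a probability measure and is not multiplied by `exp
ε₂`. -/
theorem IsDP.prod {d k : ℕ} {ε₁ ε₂ δ : ℝ} {R₁ R₂ : Type*} [MeasurableSpace R₁]
    [MeasurableSpace R₂] {M₁ : (Fin d → ℝ) → Measure R₁} {M₂ : (Fin d → ℝ) → Measure R₂}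
    (h₁ : IsDP k ε₁ δ M₁)
    (h₂ : ∀ x x' : Fin d → ℝ, ∑ i, |x i - x' i| ≤ 1 →
      M₂ x ≤ ENNReal.ofReal (Real.exp ε₂) • M₂ x')
    (hp₁ : ∀ x, (∀ i, 0 ≤ x i) → IsProbabilityMeasure (M₁ x))
    (hp₂ : ∀ x, IsProbabilityMeasure (M₂ x)) :
    IsDP k (ε₁ + ε₂) δ fun x => (M₁ x).prod (M₂ x) := by
  intro x x' hx hx' hs hs' hxx S hS
  have := hp₁ x hx
  have := hp₁ x' hx'
  rw [Measure.prod_apply_symm hS, Measure.prod_apply_symm hS]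
  have hm : ∀ (z : Fin d → ℝ) [SFinite (M₁ z)],
      Measurable fun y => M₁ z ((fun a => (a, y)) ⁻¹' S) :=
    fun z _ => measurable_measure_prodMk_right hS
  calc ∫⁻ y, M₁ x ((fun a => (a, y)) ⁻¹' S) ∂M₂ x
      ≤ ∫⁻ y, ENNReal.ofReal (Real.exp ε₁) * M₁ x' ((fun a => (a, y)) ⁻¹' S) +
          ENNReal.ofReal δ ∂M₂ x :=
        lintegral_mono fun y => h₁ x x' hx hx' hs hs' hxx _ (hS.preimage (by fun_prop))
    _ = ENNReal.ofReal (Real.exp ε₁) * ∫⁻ y, M₁ x' ((fun a => (a, y)) ⁻¹' S) ∂M₂ x +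
          ENNReal.ofReal δ := by
        rw [lintegral_add_right _ measurable_const, lintegral_const_mul _ (hm x')]
        simp
    _ ≤ ENNReal.ofReal (Real.exp ε₁) * (ENNReal.ofReal (Real.exp ε₂) *
          ∫⁻ y, M₁ x' ((fun a => (a, y)) ⁻¹' S) ∂M₂ x') + ENNReal.ofReal δ := by
        gcongr
        rw [← smul_eq_mul, ← lintegral_smul_measure]
        exact lintegral_mono' (h₂ x x' hxx) le_rfl
    _ = _ := by
        rw [← mul_assoc, ← ENNReal.ofReal_mul (Real.exp_pos _).le, ← Real.exp_add]

theorem IsDP.map {d k : ℕ} {ε δ : ℝ} {R R' : Type*} [MeasurableSpace R] [MeasurableSpace R']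
    {M : (Fin d → ℝ) → Measure R} (h : IsDP k ε δ M) {f : R → R'} (hf : Measurable f) :
    IsDP k ε δ fun x => (M x).map f := by
  intro x x' hx hx' hs hs' hxx S hS
  rw [Measure.map_apply hf hS, Measure.map_apply hf hS]
  exact h x x' hx hx' hs hs' hxx _ (hf hS)

theorem isProbabilityMeasure_thresholdALP {N d s : ℕ} (hN : 0 < N) {α ε δ : ℝ} (hα : 0 < α)
    (hε : 0 < ε) (hash : Fin N → Fin d → Fin s) {x : Fin d → ℝ} (hx : ∀ i, 0 ≤ x i) :
    IsProbabilityMeasure (thresholdALP α ε δ hash x) := by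
  have := isProbabilityMeasure_thresholdMechanism (δ := δ) (half_pos hε) hx
  have := isProbabilityMeasure_alpProjection (ε := ε / 2) (m := columns α ε δ) hN hα.le hash x
  unfold thresholdALP
  infer_instance

theorem isDP_thresholdALP {N d k s : ℕ} (hN : 0 < N) {α ε δ : ℝ} (hα : 0 < α) (hε : 0 < ε)
    (hδ : 0 < δ) (hδ1 : δ ≤ 1) (hash : Fin N → Fin d → Fin s) :
    IsDP k ε δ (thresholdALP α ε δ hash) := by
  have := IsDP.prod (k := k) (isDP_thresholdMechanism (d := d) (half_pos hε) hδ hδ1)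
    (fun x x' h => alpProjection_le (m := columns α ε δ) hα (half_pos hε).le hash h)
    (fun x hx => isProbabilityMeasure_thresholdMechanism (half_pos hε) hx)
    (fun x => isProbabilityMeasure_alpProjection hN hα.le hash x)
  rwa [add_halves] at this

/-! # Accuracy of the ALP projection -/

theorem lintegral_coin (p : ℝ) (g : Bool → ENNReal) :
    ∫⁻ c, g c ∂coin p = ENNReal.ofReal p * g true + ENNReal.ofReal (1 - p) * g false := by
  simp [coin, lintegral_add_measure, lintegral_smul_measure, lintegral_dirac]

/-- One flip is read in each column, whatever the rows `a` are, so the flips that are read are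
independent. The product is regrouped by rows, with factor `1` at the unread cells. -/
theorem lintegral_flips_prod {s m : ℕ} {p : ℝ} (h0 : 0 ≤ p) (h1 : p ≤ 1) (a : Fin m → Fin s)
    (g : Fin m → Bool → ENNReal) :
    ∫⁻ e, ∏ b, g b (e (a b) b) ∂flips s m p = ∏ b, ∫⁻ c, g b c ∂coin p := by
  classical
  have := isProbabilityMeasure_coin h0 h1
  set F : Fin s → (Fin m → Bool) → ENNReal := fun a' v =>
    ∏ b, (fun c => if a b = a' then g b c else 1) (v b) with hF
  have h : ∀ e : Fin s → Fin m → Bool, ∏ b, g b (e (a b) b) = ∏ a', F a' (e a') := by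
    intro e
    simp only [hF]
    rw [Finset.prod_comm]
    refine Finset.prod_congr rfl fun b _ => ?_
    simp
  rw [lintegral_congr h, flips, lintegral_pi_prod _ F fun _ => .of_discrete]
  simp only [hF]
  have h2 : ∀ a', ∫⁻ v, ∏ b, (fun c => if a b = a' then g b c else 1) (v b)
      ∂(Measure.pi fun _ : Fin m => coin p) =
      ∏ b, ∫⁻ c, (if a b = a' then g b c else 1) ∂coin p := fun a' =>
    lintegral_pi_prod (fun _ : Fin m => coin p) (fun b c => if a b = a' then g b c else 1)
      fun _ => Measurable.of_discrete
  simp_rw [h2]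
  rw [Finset.prod_comm]
  refine Finset.prod_congr rfl fun b _ => ?_
  rw [Finset.prod_eq_single (a b)]
  · simp
  · intro a' _ ha'
    simp only [if_neg ha'.symm, lintegral_const, measure_univ, mul_one]
  · simp

/-- The collisions of the universal family with the non-zero entries. -/
theorem uniformOn_collision_le {N d s k : ℕ} (hs : 0 < s) {hash : Fin N → Fin d → Fin s}
    (hu : IsUniversal hash) (i : Fin d) {J : Set (Fin d)} (hJ : J.ncard ≤ k) (hi : i ∉ J) :
    uniformOn (Set.univ : Set (Fin N)) {g | ∃ j ∈ J, hash g j = hash g i} ≤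
      ENNReal.ofReal (k / s) := by
  classical
  rcases Nat.eq_zero_or_pos N with rfl | hN
  · rw [Set.eq_empty_of_isEmpty {g : Fin 0 | _}]; simp
  have h1 : ∀ j, j ∈ J → uniformOn (Set.univ : Set (Fin N)) {g | hash g j = hash g i} ≤
      ENNReal.ofReal (1 / s) := by
    intro j hj
    have h2 := hu j i (fun h => hi (h ▸ hj))
    rw [uniformOn_univ, Measure.count_apply .of_discrete, ← Set.Finite.cast_ncard_eq (Set.toFinite _),
      Fintype.card_fin, ENat.toENNReal_coe]
    rw [ENNReal.div_le_iff (by simpa using hN.ne') (by simp)]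
    have h3 : ((({g | hash g j = hash g i} : Set (Fin N)).ncard : ℕ) : ℝ) ≤ 1 / s * N := by
      rw [one_div, ← div_eq_inv_mul, le_div_iff₀ (by positivity)]
      exact_mod_cast h2
    have h4 := ENNReal.ofReal_le_ofReal h3
    rw [ENNReal.ofReal_mul (by positivity), ENNReal.ofReal_natCast, ENNReal.ofReal_natCast] at h4
    exact h4
  have hsub : ({g | ∃ j ∈ J, hash g j = hash g i} : Set (Fin N)) ⊆
      ⋃ j ∈ J.toFinset, {g | hash g j = hash g i} := by
    intro g ⟨j, hj, hg⟩
    simp only [Set.mem_toFinset, Set.mem_iUnion]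
    exact ⟨j, hj, hg⟩
  calc _ ≤ _ := measure_mono hsub
    _ ≤ ∑ j ∈ J.toFinset, uniformOn (Set.univ : Set (Fin N)) {g | hash g j = hash g i} :=
        measure_biUnion_finset_le _ _
    _ ≤ ∑ j ∈ J.toFinset, ENNReal.ofReal (1 / s) :=
        Finset.sum_le_sum fun j hj => h1 j (by simpa using hj)
    _ = ENNReal.ofReal (J.ncard / s) := by
        rw [Finset.sum_const, ← Set.ncard_eq_toFinset_card', nsmul_eq_mul,
          ← ENNReal.ofReal_natCast, ← ENNReal.ofReal_mul (by positivity)]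
        congr 1; ring
    _ ≤ _ := by
        gcongr

/-- The estimate before scaling: the average of the peaks. -/
noncomputable def averagePeak {N d s m : ℕ} (hash : Fin N → Fin d → Fin s)
    (o : ALPOutput N s m) (i : Fin d) : ℝ :=
  (∑ n ∈ peaks hash o i, (n : ℝ)) / (peaks hash o i).card

theorem alpEstimate_eq {N d s m : ℕ} (α ε : ℝ) (hash : Fin N → Fin d → Fin s)
    (o : ALPOutput N s m) (i : Fin d) :
    alpEstimate α ε hash o i = averagePeak hash o i * (α / ε) := by
  rw [alpEstimate, averagePeak, mul_div_assoc]

theorem mem_peaks {N d s m : ℕ} {hash : Fin N → Fin d → Fin s} {o : ALPOutput N s m}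
    {i : Fin d} {n : ℕ} : n ∈ peaks hash o i ↔
      n ≤ m ∧ ∀ a ≤ m, partialSum hash o i a ≤ partialSum hash o i n := by
  simp [peaks]

theorem peaks_nonempty {N d s m : ℕ} (hash : Fin N → Fin d → Fin s)
    (o : ALPOutput N s m) (i : Fin d) : (peaks hash o i).Nonempty := by
  obtain ⟨n, hn, h⟩ := Finset.exists_max_image (Finset.range (m + 1)) (partialSum hash o i)
    ⟨0, by simp⟩
  exact ⟨n, by simp only [peaks, Finset.mem_filter]; exact ⟨hn, h⟩⟩

/-- Replacing the average by the whole sum over the peaks makes the bound linear in the events that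
`n` is a peak, as the union bound requires. -/
theorem abs_averagePeak_sub_le {N d s m : ℕ} (hash : Fin N → Fin d → Fin s)
    (o : ALPOutput N s m) (i : Fin d) (c : ℝ) :
    |averagePeak hash o i - c| ≤ ∑ n ∈ peaks hash o i, |(n : ℝ) - c| := by
  have h1 : 1 ≤ ((peaks hash o i).card : ℝ) := by
    exact_mod_cast (peaks_nonempty hash o i).card_pos
  have h2 : averagePeak hash o i - c =
      (∑ n ∈ peaks hash o i, ((n : ℝ) - c)) / (peaks hash o i).card := by
    rw [averagePeak, Finset.sum_sub_distrib, Finset.sum_const, nsmul_eq_mul]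
    field_simp
  rw [h2, abs_div, abs_of_pos (a := ((peaks hash o i).card : ℝ)) (by linarith)]
  exact (div_le_self (abs_nonneg _) h1).trans (Finset.abs_sum_le_sum_abs _ _)

theorem averagePeak_mem {N d s m : ℕ} (hash : Fin N → Fin d → Fin s)
    (o : ALPOutput N s m) (i : Fin d) :
    0 ≤ averagePeak hash o i ∧ averagePeak hash o i ≤ m := by
  have h1 : 0 < ((peaks hash o i).card : ℝ) := by
    exact_mod_cast (peaks_nonempty hash o i).card_pos
  refine ⟨div_nonneg (Finset.sum_nonneg fun n _ => n.cast_nonneg) h1.le, ?_⟩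
  rw [averagePeak, div_le_iff₀ h1]
  calc ∑ n ∈ peaks hash o i, (n : ℝ) ≤ ∑ n ∈ peaks hash o i, (m : ℝ) := by
        refine Finset.sum_le_sum fun n hn => ?_
        simp only [peaks, Finset.mem_filter, Finset.mem_range] at hn
        exact_mod_cast Nat.lt_succ_iff.1 hn.1
    _ = m * (peaks hash o i).card := by rw [Finset.sum_const, nsmul_eq_mul, mul_comm]

/-- The columns between two numbers. -/
def columnsBetween (m n Y : ℕ) : Finset (Fin m) :=
  Finset.univ.filter fun b => min n Y ≤ b ∧ (b : ℕ) < max n Y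

theorem card_columnsBetween {m n Y : ℕ} (hn : n ≤ m) (hY : Y ≤ m) :
    (columnsBetween m n Y).card = max n Y - min n Y := by
  rw [← Nat.card_Ico, ← Finset.card_map Fin.valEmbedding]
  congr 1
  ext b
  simp only [columnsBetween, Finset.mem_map, Finset.mem_filter, Finset.mem_univ, true_and,
    Fin.valEmbedding_apply, Finset.mem_Ico]
  constructor
  · rintro ⟨a, h, rfl⟩; exact h
  · intro h; exact ⟨⟨b, by omega⟩, h, rfl⟩

/-- If `n` is a peak, then at least half of the bits between `n` and `Y` are not the bits of the
unary representation of `Y`. -/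
theorem sum_wrong_nonneg {N d s m : ℕ} {hash : Fin N → Fin d → Fin s} {o : ALPOutput N s m}
    {i : Fin d} {n Y : ℕ} (hn : n ∈ peaks hash o i) (hY : Y ≤ m) :
    (0 : ℤ) ≤ ∑ b ∈ columnsBetween m n Y,
      if o.2 (hash (o.1 b) i) b = decide ((b : ℕ) < Y) then -1 else 1 := by
  simp only [peaks, Finset.mem_filter, Finset.mem_range] at hn
  -- The peak is compared with `Y` itself; the columns outside the gap cancel in the difference of
  -- the partial sums.
  have h := hn.2 Y (by omega)
  rw [← sub_nonneg, partialSum, partialSum, ← Finset.sum_sub_distrib] at h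
  refine h.trans (le_of_eq ?_)
  rw [columnsBetween, Finset.sum_filter]
  refine Finset.sum_congr rfl fun b _ => ?_
  by_cases h1 : (b : ℕ) < n <;> by_cases h2 : (b : ℕ) < Y <;>
    cases h3 : o.2 (hash (o.1 b) i) b <;> simp [h1, h2]

/-- Whether the bit of column `b` that entry `i` uses is wrong before randomized response. -/
noncomputable def badBit {N d s : ℕ} (hash : Fin N → Fin d → Fin s) (y : Fin d → ℤ) (i : Fin d)
    (Y b : ℕ) (g : Fin N) : Bool :=
  open Classical in
  xor (decide (∃ j, (b : ℤ) + 1 ≤ y j ∧ hash g j = hash g i)) (decide (b < Y))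

/-- Below `Y` the entry sets its own bit, so nothing can go wrong. From `Y` on the bit is wrong only
through a collision with some entry that reaches column `b`; entry `i` is not one of these, and
there are at most `k` of them. -/
theorem uniformOn_badBit_le {N d s k : ℕ} (hs : 0 < s) {hash : Fin N → Fin d → Fin s}
    (hu : IsUniversal hash) {y : Fin d → ℤ} (hk : {j | y j ≠ 0}.ncard ≤ k)
    (i : Fin d) {m b : ℕ} (hb : b < m) :
    uniformOn (Set.univ : Set (Fin N))
      {g | badBit hash y i (min (y i).toNat m) b g = true} ≤ ENNReal.ofReal (k / s) := by
  by_cases hbY : (b : ℤ) < y i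
  · have h0 : {g | badBit hash y i (min (y i).toNat m) b g = true} = ∅ := by
      refine Set.eq_empty_of_forall_notMem fun g hg => ?_
      have h1 : b < min (y i).toNat m := by omega
      simp only [badBit, h1, decide_true, Bool.bne_true, Set.mem_ofPred_eq, Bool.not_eq_true',
        decide_eq_false_iff_not] at hg
      exact hg ⟨i, by omega, rfl⟩
    rw [h0, measure_empty]
    exact zero_le
  · refine le_trans (measure_mono ?_) (uniformOn_collision_le hs hu i
      (J := {j | (b : ℤ) + 1 ≤ y j}) (le_trans (Set.ncard_le_ncard ?_ (Set.toFinite _)) hk) ?_)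
    · intro g hg
      have h1 : ¬ b < min (y i).toNat m := by omega
      simpa [badBit, h1] using hg
    · intro j hj
      simp only [Set.mem_ofPred_eq] at hj ⊢
      omega
    · simp only [Set.mem_ofPred_eq]
      omega

/-- The left side is the mean weight of a bit that is wrong with probability `p + κ (1 - 2 p)`. It
increases with this probability, and at `1 / 2 - γ` it equals `(1 / 2 - γ) (1 + 2 γ) + (1 / 2 + γ) /
(1 + 2 γ) = 1 - 2 γ ^ 2`. -/
theorem chernoff_factor {p κ γ : ℝ} (hγ : 0 < γ) (hq : p + κ * (1 - 2 * p) ≤ 1 / 2 - γ) :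
    (p * (1 + 2 * γ) + (1 - p) * (1 + 2 * γ)⁻¹) +
      (((1 - p) * (1 + 2 * γ) + p * (1 + 2 * γ)⁻¹) - (p * (1 + 2 * γ) + (1 - p) * (1 + 2 * γ)⁻¹)) *
        κ ≤ 1 - 2 * γ ^ 2 := by
  have hl : 0 < 1 + 2 * γ := by linarith
  have h1 : (1 + 2 * γ)⁻¹ ≤ 1 := inv_le_one_of_one_le₀ (by linarith)
  have h3 : (1 / 2 + γ) * (1 + 2 * γ)⁻¹ = 1 / 2 := by field_simp
  have h2 : 0 ≤ ((1 + 2 * γ) - (1 + 2 * γ)⁻¹) * (1 / 2 - γ - (p + κ * (1 - 2 * p))) :=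
    mul_nonneg (by linarith) (by linarith)
  nlinarith

/-- The weight of a right or wrong bit in the Chernoff bound. -/
noncomputable def bitWeight (γ : ℝ) (wrong : Bool) : ENNReal :=
  ENNReal.ofReal (if wrong then 1 + 2 * γ else (1 + 2 * γ)⁻¹)

theorem lintegral_bitWeight_coin {p γ : ℝ} (h0 : 0 ≤ p) (h1 : p ≤ 1) (hγ : 0 < γ) (bad : Bool) :
    ∫⁻ c, bitWeight γ (xor bad c) ∂coin p =
      ENNReal.ofReal (if bad then (1 - p) * (1 + 2 * γ) + p * (1 + 2 * γ)⁻¹ else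
        p * (1 + 2 * γ) + (1 - p) * (1 + 2 * γ)⁻¹) := by
  have h2 : 0 ≤ 1 - p := by linarith
  rw [lintegral_coin]
  cases bad
  · simp only [bitWeight, Bool.false_bne, if_true, Bool.false_eq_true, if_false]
    rw [← ENNReal.ofReal_mul h0, ← ENNReal.ofReal_mul h2, ← ENNReal.ofReal_add] <;> positivity
  · simp only [bitWeight, Bool.true_bne, Bool.not_true, Bool.not_false, if_true,
      Bool.false_eq_true, if_false]
    rw [← ENNReal.ofReal_mul h0, ← ENNReal.ofReal_mul h2, ← ENNReal.ofReal_add, add_comm] <;>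
      positivity

/-- Given the hash function, the mean weight is affine in the indicator of a bad bit. Its slope is
non-negative because `p ≤ 1 / 2`, so the collision bound may be inserted. -/
theorem lintegral_bitWeight_hash_le {N d s k : ℕ} (hN : 0 < N) (hs : 0 < s)
    {hash : Fin N → Fin d → Fin s} (hu : IsUniversal hash) {y : Fin d → ℤ}
    (hk : {j | y j ≠ 0}.ncard ≤ k) (i : Fin d) {m b : ℕ} (hb : b < m) {p γ : ℝ} (h0 : 0 ≤ p)
    (h1 : p ≤ 1 / 2) (hγ : 0 < γ) (hq : p + k / s * (1 - 2 * p) ≤ 1 / 2 - γ) :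
    ∫⁻ g, ∫⁻ c, bitWeight γ (xor (badBit hash y i (min (y i).toNat m) b g) c) ∂coin p
      ∂uniformOn (Set.univ : Set (Fin N)) ≤ ENNReal.ofReal (1 - 2 * γ ^ 2) := by
  have : Nonempty (Fin N) := ⟨⟨0, hN⟩⟩
  have hc := chernoff_factor hγ hq
  set U₀ := p * (1 + 2 * γ) + (1 - p) * (1 + 2 * γ)⁻¹ with hU₀
  set U₁ := (1 - p) * (1 + 2 * γ) + p * (1 + 2 * γ)⁻¹ with hU₁
  have h2 : 0 ≤ 1 - p := by linarith
  have hU0 : 0 ≤ U₀ := by positivity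
  have hle : 0 ≤ U₁ - U₀ := by
    have hl : (1 + 2 * γ)⁻¹ ≤ 1 := inv_le_one_of_one_le₀ (by linarith)
    have : 0 ≤ (1 - 2 * p) * ((1 + 2 * γ) - (1 + 2 * γ)⁻¹) :=
      mul_nonneg (by linarith) (by linarith)
    rw [hU₁, hU₀]; nlinarith
  have hpt : ∀ g, ∫⁻ c, bitWeight γ (xor (badBit hash y i (min (y i).toNat m) b g) c) ∂coin p =
      ENNReal.ofReal U₀ + ENNReal.ofReal (U₁ - U₀) *
        Set.indicator {g | badBit hash y i (min (y i).toNat m) b g = true} 1 g := by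
    intro g
    rw [lintegral_bitWeight_coin h0 (by linarith) hγ]
    cases hb : badBit hash y i (min (y i).toNat m) b g
    · simp [hb, hU₀]
    · rw [Set.indicator_of_mem (by exact hb), if_pos rfl, Pi.one_apply, mul_one,
        ← ENNReal.ofReal_add hU0 hle, add_sub_cancel]
  simp_rw [hpt]
  rw [lintegral_add_left measurable_const, lintegral_const_mul _ .of_discrete,
    lintegral_indicator_one .of_discrete]
  simp only [lintegral_const, measure_univ, mul_one]
  calc _ ≤ ENNReal.ofReal U₀ + ENNReal.ofReal (U₁ - U₀) * ENNReal.ofReal (k / s) := by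
        gcongr; exact uniformOn_badBit_le hs hu hk i hb
    _ = ENNReal.ofReal (U₀ + (U₁ - U₀) * (k / s)) := by
        rw [← ENNReal.ofReal_mul hle, ← ENNReal.ofReal_add hU0 (by positivity)]
    _ ≤ _ := ENNReal.ofReal_le_ofReal hc

theorem one_le_prod_bitWeight {ι : Type*} {B : Finset ι} {γ : ℝ} (hγ : 0 < γ) {wr : ι → Bool}
    (h : (0 : ℤ) ≤ ∑ b ∈ B, if wr b = true then 1 else -1) :
    1 ≤ ∏ b ∈ B, bitWeight γ (wr b) := by
  have hl : 0 < 1 + 2 * γ := by linarith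
  have h1 : ∀ b, (if wr b = true then 1 + 2 * γ else (1 + 2 * γ)⁻¹) =
      Real.exp (Real.log (1 + 2 * γ) * ((if wr b = true then 1 else -1 : ℤ) : ℝ)) := by
    intro b
    split_ifs
    · simp [Real.exp_log hl]
    · simp [Real.exp_neg, Real.exp_log hl]
  simp only [bitWeight]
  rw [← ENNReal.ofReal_prod_of_nonneg fun b _ => by split_ifs <;> positivity]
  simp_rw [h1]
  rw [← Real.exp_sum, ← Finset.mul_sum, ← Int.cast_sum, ← ENNReal.ofReal_one]
  refine ENNReal.ofReal_le_ofReal (Real.one_le_exp (mul_nonneg (Real.log_nonneg (by linarith)) ?_))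
  exact_mod_cast h

/-- A peak at `n` forces at least as many wrong as right bits between `n` and `Y`, so the product of
the weights is at least one. Its mean factors over the columns, because these have independent hash
functions and flips. -/
theorem lintegral_peak_le {N d s k m : ℕ} (hN : 0 < N) (hs : 0 < s)
    {hash : Fin N → Fin d → Fin s} (hu : IsUniversal hash) {y : Fin d → ℤ}
    (hk : {j | y j ≠ 0}.ncard ≤ k) (i : Fin d) {p γ : ℝ} (h0 : 0 ≤ p)
    (h1 : p ≤ 1 / 2) (hγ : 0 < γ) (hq : p + k / s * (1 - 2 * p) ≤ 1 / 2 - γ) {n : ℕ}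
    (hn : n ≤ m) :
    ∫⁻ h, ∫⁻ e, (open Classical in
        if n ∈ peaks hash (noisyArray hash y h e : ALPOutput N s m) i then 1 else 0)
      ∂flips s m p ∂hashLaw N m ≤
      ENNReal.ofReal (1 - 2 * γ ^ 2) ^ (max n (min (y i).toNat m) - min n (min (y i).toNat m)) := by
  classical
  have : Nonempty (Fin N) := ⟨⟨0, hN⟩⟩
  set Y := min (y i).toNat m with hY
  have hYm : Y ≤ m := min_le_right _ _
  set B := columnsBetween m n Y
  set g : Fin m → Fin N → Bool → ENNReal := fun b h c =>
    if b ∈ B then bitWeight γ (xor (badBit hash y i Y b h) c) else 1 with hg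
  have hpt : ∀ h e, (if n ∈ peaks hash (noisyArray hash y h e : ALPOutput N s m) i then 1 else 0) ≤
      ∏ b, g b (h b) (e (hash (h b) i) b) := by
    intro h e
    split_ifs with hpk
    · have hw := sum_wrong_nonneg hpk hYm
      simp only [hg]
      rw [Finset.prod_ite, Finset.prod_const_one, mul_one, Finset.filter_mem_eq_inter,
        Finset.univ_inter]
      refine one_le_prod_bitWeight hγ (hw.trans (Finset.sum_le_sum fun b _ => ?_))
      have key : ∀ u v t : Bool, (if xor u t = v then (-1 : ℤ) else 1) ≤
          if xor (xor u v) t = true then 1 else -1 := by decide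
      exact key _ _ _
    · exact zero_le
  calc _ ≤ ∫⁻ h, ∫⁻ e, ∏ b, g b (h b) (e (hash (h b) i) b) ∂flips s m p ∂hashLaw N m :=
        lintegral_mono fun h => lintegral_mono fun e => hpt h e
    _ = ∫⁻ h, ∏ b, ∫⁻ c, g b (h b) c ∂coin p ∂hashLaw N m :=
        lintegral_congr fun h => lintegral_flips_prod h0 (by linarith) _ _
    _ = ∏ b, ∫⁻ h, ∫⁻ c, g b h c ∂coin p ∂uniformOn (Set.univ : Set (Fin N)) := by
        rw [hashLaw, lintegral_pi_prod (fun _ : Fin m => uniformOn (Set.univ : Set (Fin N)))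
          (fun b h => ∫⁻ c, g b h c ∂coin p) fun _ => .of_discrete]
    _ ≤ ∏ b, (if b ∈ B then ENNReal.ofReal (1 - 2 * γ ^ 2) else 1) := by
        refine Finset.prod_le_prod' fun b _ => ?_
        simp only [hg]
        split_ifs
        · exact lintegral_bitWeight_hash_le hN hs hu hk i b.2 h0 h1 hγ hq
        · have := isProbabilityMeasure_coin h0 (by linarith)
          simp only [lintegral_const, measure_univ, mul_one, le_refl]
    _ = _ := by
        rw [Finset.prod_ite, Finset.prod_const_one, mul_one, Finset.filter_mem_eq_inter,
          Finset.univ_inter, Finset.prod_const, card_columnsBetween hn hYm]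

/-- Each side of `Y` is dominated by the full series `∑ j ρ ^ j = ρ / (1 - ρ) ^ 2`. -/
theorem sum_dist_mul_pow_le {ρ : ℝ} (h0 : 0 ≤ ρ) (h1 : ρ < 1) (m Y : ℕ) :
    ∑ n ∈ Finset.range (m + 1), |(n : ℝ) - Y| * ρ ^ (max n Y - min n Y) ≤
      2 * (ρ / (1 - ρ) ^ 2) := by
  have hs := hasSum_coe_mul_geometric_of_norm_lt_one (𝕜 := ℝ) (r := ρ)
    (by rwa [Real.norm_of_nonneg h0])
  have hbound : ∀ (S : Finset ℕ) (φ : ℕ → ℕ), Set.InjOn φ S →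
      ∑ n ∈ S, (φ n : ℝ) * ρ ^ φ n ≤ ρ / (1 - ρ) ^ 2 := by
    intro S φ hφ
    rw [← Finset.sum_image (f := fun j : ℕ => (j : ℝ) * ρ ^ j) hφ]
    exact sum_le_hasSum _ (fun j _ => by positivity) hs
  rw [← Finset.sum_filter_add_sum_filter_not _ fun n => n < Y, two_mul]
  refine add_le_add ?_ ?_
  · refine le_trans (le_of_eq (Finset.sum_congr rfl fun n hn => ?_))
      (hbound _ (fun n => Y - n) fun a ha b hb hab => ?_)
    · have hn' := (Finset.mem_filter.1 hn).2
      rw [max_eq_right hn'.le, min_eq_left hn'.le, Nat.cast_sub hn'.le, abs_sub_comm,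
        abs_of_nonneg (sub_nonneg.2 (Nat.cast_le.2 hn'.le))]
    · have ha' := (Finset.mem_filter.1 ha).2
      have hb' := (Finset.mem_filter.1 hb).2
      simp only at hab
      omega
  · refine le_trans (le_of_eq (Finset.sum_congr rfl fun n hn => ?_))
      (hbound _ (fun n => n - Y) fun a ha b hb hab => ?_)
    · have hn' := not_lt.1 (Finset.mem_filter.1 hn).2
      rw [max_eq_left hn', min_eq_right hn', Nat.cast_sub hn',
        abs_of_nonneg (sub_nonneg.2 (Nat.cast_le.2 hn'))]
    · have ha' := (Finset.mem_filter.1 ha).2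
      have hb' := (Finset.mem_filter.1 hb).2
      simp only at hab
      omega

/-- The union bound over all candidate peaks stays bounded, independently of `m`, because the peak
probabilities decay geometrically; here `1 - ρ = 2 γ ^ 2`. -/
theorem lintegral_abs_averagePeak_sub_le {N d s k m : ℕ} (hN : 0 < N) (hs : 0 < s)
    {hash : Fin N → Fin d → Fin s} (hu : IsUniversal hash) {y : Fin d → ℤ}
    (hk : {j | y j ≠ 0}.ncard ≤ k) (i : Fin d) {p γ : ℝ} (h0 : 0 ≤ p)
    (h1 : p ≤ 1 / 2) (hγ : 0 < γ) (hγ1 : γ ≤ 1 / 2)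
    (hq : p + k / s * (1 - 2 * p) ≤ 1 / 2 - γ) :
    ∫⁻ h, ∫⁻ e, ENNReal.ofReal |averagePeak hash (noisyArray hash y h e : ALPOutput N s m) i -
        (min (y i).toNat m : ℕ)| ∂flips s m p ∂hashLaw N m ≤
      ENNReal.ofReal (1 / γ ^ 4) := by
  classical
  set Y := min (y i).toNat m with hY
  set ρ := 1 - 2 * γ ^ 2 with hρ
  have hρ0 : 0 ≤ ρ := by rw [hρ]; nlinarith
  have hpt : ∀ h e, ENNReal.ofReal |averagePeak hash (noisyArray hash y h e : ALPOutput N s m) i -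
      (Y : ℕ)| ≤ ∑ n ∈ Finset.range (m + 1), ENNReal.ofReal |(n : ℝ) - Y| *
        if n ∈ peaks hash (noisyArray hash y h e : ALPOutput N s m) i then 1 else 0 := by
    intro h e
    refine (ENNReal.ofReal_le_ofReal (abs_averagePeak_sub_le _ _ _ _)).trans ?_
    rw [ENNReal.ofReal_sum_of_nonneg fun n _ => abs_nonneg _]
    simp only [mul_ite, mul_one, mul_zero]
    rw [← Finset.sum_filter]
    refine Finset.sum_le_sum_of_subset fun n hn => ?_
    rw [Finset.mem_filter]
    exact ⟨Finset.mem_range.2 (Nat.lt_succ_of_le (mem_peaks.1 hn).1), hn⟩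
  calc _ ≤ ∫⁻ h, ∫⁻ e, ∑ n ∈ Finset.range (m + 1), ENNReal.ofReal |(n : ℝ) - Y| *
        (if n ∈ peaks hash (noisyArray hash y h e : ALPOutput N s m) i then 1 else 0)
          ∂flips s m p ∂hashLaw N m :=
        lintegral_mono fun h => lintegral_mono fun e => hpt h e
    _ = ∑ n ∈ Finset.range (m + 1), ENNReal.ofReal |(n : ℝ) - Y| * ∫⁻ h, ∫⁻ e,
        (if n ∈ peaks hash (noisyArray hash y h e : ALPOutput N s m) i then 1 else 0)
          ∂flips s m p ∂hashLaw N m := by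
        simp_rw [lintegral_finsetSum _ fun _ _ => Measurable.of_discrete,
          lintegral_const_mul _ Measurable.of_discrete]
    _ ≤ ∑ n ∈ Finset.range (m + 1), ENNReal.ofReal |(n : ℝ) - Y| *
          ENNReal.ofReal ρ ^ (max n Y - min n Y) := by
        refine Finset.sum_le_sum fun n hn => ?_
        gcongr
        exact lintegral_peak_le hN hs hu hk i h0 h1 hγ hq (Nat.lt_succ_iff.1 (Finset.mem_range.1 hn))
    _ = ENNReal.ofReal (∑ n ∈ Finset.range (m + 1), |(n : ℝ) - Y| * ρ ^ (max n Y - min n Y)) := by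
        rw [ENNReal.ofReal_sum_of_nonneg fun n _ => by positivity]
        refine Finset.sum_congr rfl fun n _ => ?_
        rw [ENNReal.ofReal_mul (abs_nonneg _), ENNReal.ofReal_pow hρ0]
    _ ≤ _ := by
        refine ENNReal.ofReal_le_ofReal ((sum_dist_mul_pow_le hρ0 (by rw [hρ]; nlinarith) m Y).trans ?_)
        have : (1 - ρ) ^ 2 = 4 * γ ^ 4 := by rw [hρ]; ring
        rw [this, ← mul_div_assoc, div_le_div_iff₀ (by positivity) (by positivity)]
        have : ρ ≤ 1 := by rw [hρ]; nlinarith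
        have : 0 < γ ^ 4 := by positivity
        nlinarith

theorem ae_randomRound (r : ℝ) : ∀ᵐ z ∂randomRound r, z = ⌊r⌋ ∨ z = ⌈r⌉ := by
  rw [ae_iff]
  simp [randomRound]

theorem abs_min_round_sub_le {r τ : ℝ} (hr : 0 ≤ r) (hτ : 0 ≤ τ) {z : ℤ}
    (hz : z = ⌊r⌋ ∨ z = ⌈r⌉) :
    |((min z.toNat ⌈τ⌉₊ : ℕ) : ℝ) - min r τ| ≤ 1 := by
  have h1 : r - 1 < z ∧ (z : ℝ) < r + 1 := by
    rcases hz with rfl | rfl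
    · exact ⟨Int.sub_one_lt_floor r, (Int.floor_le r).trans_lt (by linarith)⟩
    · exact ⟨(by linarith : r - 1 < r).trans_le (Int.le_ceil r), Int.ceil_lt_add_one r⟩
  have h2 : (z.toNat : ℝ) = z := by
    have : 0 ≤ z := by
      have : (-1 : ℝ) < z := by linarith
      have : (-1 : ℤ) < z := by exact_mod_cast this
      omega
    exact_mod_cast Int.toNat_of_nonneg this
  have h3 := Nat.le_ceil τ
  have h4 := Nat.ceil_lt_add_one hτ
  rw [Nat.cast_min, h2, abs_le]
  constructor
  · rcases min_choice (z : ℝ) ⌈τ⌉₊ with h | h <;> rw [h]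
    · linarith [min_le_left r τ]
    · linarith [min_le_right r τ]
  · rcases min_choice r τ with h | h <;> rw [h]
    · linarith [min_le_left (z : ℝ) ⌈τ⌉₊]
    · linarith [min_le_right (z : ℝ) ⌈τ⌉₊]

/-- The target is truncated at `τ` because an array of `⌈τ⌉₊` columns cannot represent more.
Rounding keeps zero entries at zero almost surely, so sparsity passes to the rounded vector. -/
theorem lintegral_alpProjection_le {N d s k : ℕ} (hN : 0 < N) (hs : 0 < s)
    {hash : Fin N → Fin d → Fin s} (hu : IsUniversal hash) {α ε τ γ : ℝ} (hα : 0 < α)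
    (hε : 0 ≤ ε) (hτ : 0 ≤ τ) (hγ : 0 < γ) (hγ1 : γ ≤ 1 / 2)
    (hq : 1 / (α + 2) + k / s * (1 - 2 * (1 / (α + 2))) ≤ 1 / 2 - γ) {x : Fin d → ℝ}
    (hx : ∀ i, 0 ≤ x i) (hk : IsSparse k x) (i : Fin d) :
    ∫⁻ o, ENNReal.ofReal |averagePeak hash o i - min (x i * ε / α) τ|
      ∂alpProjection (s := s) α ε ⌈τ⌉₊ hash x ≤ ENNReal.ofReal (1 / γ ^ 4 + 1) := by
  have hp := fun j => isProbabilityMeasure_randomRound (x j * ε / α)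
  have := isProbabilityMeasure_hashLaw hN ⌈τ⌉₊
  have := isProbabilityMeasure_flips s ⌈τ⌉₊ hα.le
  rw [alpProjection, lintegral_alp1Projection]
  have hae : ∀ᵐ y ∂(Measure.pi fun j => randomRound (x j * ε / α)),
      ∀ j, y j = ⌊x j * ε / α⌋ ∨ y j = ⌈x j * ε / α⌉ := by
    rw [ae_all_iff]
    intro j
    have hj := ae_randomRound (x j * ε / α)
    exact (Measure.quasiMeasurePreserving_eval (fun j => randomRound (x j * ε / α)) j).ae hj
  have hle : ∀ᵐ y ∂(Measure.pi fun j => randomRound (x j * ε / α)),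
      ∫⁻ h, ∫⁻ e, ENNReal.ofReal |averagePeak hash (noisyArray hash y h e) i -
        min (x i * ε / α) τ| ∂flips s ⌈τ⌉₊ (1 / (α + 2)) ∂hashLaw N ⌈τ⌉₊ ≤
          ENNReal.ofReal (1 / γ ^ 4 + 1) := by
    filter_upwards [hae] with y hy
    have hsp : {j | y j ≠ 0}.ncard ≤ k := by
      refine le_trans (Set.ncard_le_ncard (t := {j | x j ≠ 0})
        (fun j hj (hx0 : x j = 0) => ?_) (Set.toFinite _)) hk
      rcases hy j with h | h <;> simp [h, hx0] at hj
    have h1 := lintegral_abs_averagePeak_sub_le (m := ⌈τ⌉₊) hN hs hu hsp i (p := 1 / (α + 2))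
      (by positivity) (by rw [div_le_div_iff₀] <;> linarith) hγ hγ1 hq
    have h2 := abs_min_round_sub_le (by have := hx i; positivity) hτ (hy i)
    calc _ ≤ ∫⁻ h, ∫⁻ e, (ENNReal.ofReal |averagePeak hash
              (noisyArray hash y h e : ALPOutput N s ⌈τ⌉₊) i - (min (y i).toNat ⌈τ⌉₊ : ℕ)| + 1)
            ∂flips s ⌈τ⌉₊ (1 / (α + 2)) ∂hashLaw N ⌈τ⌉₊ := by
          refine lintegral_mono fun h => lintegral_mono fun e => ?_
          rw [← ENNReal.ofReal_one, ← ENNReal.ofReal_add (abs_nonneg _) zero_le_one]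
          exact ENNReal.ofReal_le_ofReal ((abs_sub_le _ _ _).trans (add_le_add_right h2 _))
      _ ≤ _ := by
          simp_rw [lintegral_add_right _ measurable_const, lintegral_const, measure_univ, mul_one]
          rw [ENNReal.ofReal_add (by positivity) zero_le_one, ENNReal.ofReal_one]
          gcongr
  calc _ ≤ ∫⁻ y, ENNReal.ofReal (1 / γ ^ 4 + 1)
        ∂(Measure.pi fun j => randomRound (x j * ε / α)) := lintegral_mono_ae hle
    _ = _ := by simp

/-! # Accuracy of thresholding -/

/-- The part of the error of an entry `x` with stored value `v` that is due to thresholding. -/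
noncomputable def thresholdError (t x v : ℝ) : ℝ :=
  open Classical in if v ≠ 0 then |x - v| else max (x - t) 0

theorem thresholdError_nonneg (t x v : ℝ) : 0 ≤ thresholdError t x v := by
  unfold thresholdError
  split_ifs
  · exact abs_nonneg _
  · exact le_max_right _ _

theorem measurable_thresholdError (t x : ℝ) : Measurable (thresholdError t x) := by
  classical
  refine Measurable.ite ?_ (by fun_prop) measurable_const
  exact (measurableSet_eq_fun measurable_id measurable_const).compl

/-- The excess is dominated by an exponential of rate `ε / 2`. The cutoff `T` lets one bound serve
both the mean error, with `T = 0`, and the maximum error, with `T` of order `log k / ε`. -/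
theorem lintegral_laplaceLaw_excess_le {ε : ℝ} (hε : 0 < ε) (T : ℝ) :
    ∫⁻ τ, ENNReal.ofReal (max (|τ| - T) 0) ∂laplaceLaw ε ≤
      ENNReal.ofReal (4 / ε * Real.exp (-T * (ε / 2))) := by
  have hpt : ∀ τ : ℝ, ENNReal.ofReal (max (|τ| - T) 0) ≤
      ENNReal.ofReal (2 / ε * Real.exp (-T * (ε / 2))) *
        ENNReal.ofReal (Real.exp (|τ| * (ε / 2))) := by
    intro τ
    rw [← ENNReal.ofReal_mul (by positivity), mul_assoc, ← Real.exp_add]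
    refine ENNReal.ofReal_le_ofReal (max_le ?_ (by positivity))
    have h := Real.add_one_le_exp (-T * (ε / 2) + |τ| * (ε / 2))
    rw [div_mul_eq_mul_div, le_div_iff₀ hε]
    nlinarith
  calc _ ≤ _ := lintegral_mono hpt
    _ = ENNReal.ofReal (2 / ε * Real.exp (-T * (ε / 2))) * ENNReal.ofReal (ε / (ε - ε / 2)) := by
        rw [lintegral_const_mul _ (by fun_prop),
          lintegral_exp_abs_laplaceLaw hε (half_lt_self hε)]
    _ = _ := by
        rw [← ENNReal.ofReal_mul (by positivity)]
        congr 1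
        field_simp
        ring

theorem lintegral_noisyEntry {ε t y : ℝ} {f : ℝ → ENNReal} (hf : Measurable f) :
    ∫⁻ v, f v ∂noisyEntry ε t y =
      ∫⁻ τ, f (open Classical in if y ≠ 0 ∧ t ≤ y + τ then y + τ else 0) ∂laplaceLaw ε := by
  rw [noisyEntry, lintegral_map hf (measurable_noisyMap t y)]

/-- For `x ≥ 1` the error is at most `|τ|` even if the value is dropped, since dropping means `x - t
< -τ`. For `x ≤ 1` only a stored value causes an error; it costs at most one more than `|τ|`, on an
event of tail probability. -/
theorem lintegral_thresholdError_le {ε t x : ℝ} (hε : 0 < ε) (ht : 1 ≤ t) (hx : 0 ≤ x) {T : ℝ}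
    (hT : 0 ≤ T) :
    ∫⁻ v, ENNReal.ofReal (max (thresholdError t x v - T) 0) ∂thresholdEntry ε t x ≤
      ENNReal.ofReal (4 / ε * Real.exp (-T * (ε / 2)) + Real.exp (-(t - 1) * ε) / 2) := by
  have hprob := isProbabilityMeasure_laplaceLaw hε
  have hm : Measurable fun v => ENNReal.ofReal (max (thresholdError t x v - T) 0) :=
    (((measurable_thresholdError _ _).sub_const _).max measurable_const).ennreal_ofReal
  have hL := lintegral_laplaceLaw_excess_le hε T
  rcases le_total 1 x with h1 | h1
  · rw [thresholdEntry_of_one_le hε h1, lintegral_noisyEntry hm]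
    refine (lintegral_mono fun τ => ?_).trans
      (hL.trans (ENNReal.ofReal_le_ofReal (le_add_of_nonneg_right (by positivity))))
    refine ENNReal.ofReal_le_ofReal (max_le_max_right _ (sub_le_sub_right ?_ _))
    split_ifs with h
    · rw [thresholdError, if_pos (by linarith)]
      simp
    · have h2 : x + τ < t := by
        by_contra h3
        exact h ⟨by linarith, not_lt.1 h3⟩
      rw [thresholdError, if_neg (by simp)]
      exact max_le (by linarith [neg_abs_le τ]) (abs_nonneg _)
  · have hz : thresholdError t x 0 = 0 := by
      rw [thresholdError, if_neg (by simp), max_eq_right (by linarith)]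
    rw [thresholdEntry_of_le_one hε hx h1, lintegral_add_measure, lintegral_smul_measure,
      lintegral_smul_measure, lintegral_dirac, hz, zero_sub, max_eq_right (by linarith),
      ENNReal.ofReal_zero, smul_zero, add_zero, lintegral_noisyEntry hm]
    have h2 : ENNReal.ofReal x ≤ 1 := by simpa using h1
    refine (mul_le_of_le_one_left' h2).trans ?_
    have hpt : ∀ τ : ℝ, ENNReal.ofReal (max (thresholdError t x
        (open Classical in if (1 : ℝ) ≠ 0 ∧ t ≤ 1 + τ then 1 + τ else 0) - T) 0) ≤
        ENNReal.ofReal (max (|τ| - T) 0) + (Set.Ici (t - 1)).indicator 1 τ := by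
      intro τ
      split_ifs with h
      · have h3 : τ ∈ Set.Ici (t - 1) := by simp only [Set.mem_Ici]; linarith [h.2]
        rw [Set.indicator_of_mem h3, Pi.one_apply, ← ENNReal.ofReal_one,
          ← ENNReal.ofReal_add (le_max_right _ _) zero_le_one]
        refine ENNReal.ofReal_le_ofReal ?_
        have h4 : thresholdError t x (1 + τ) ≤ |τ| + 1 := by
          rw [thresholdError, if_pos (by linarith [h.2]), abs_le]
          constructor <;> linarith [neg_abs_le τ, le_abs_self τ]
        refine max_le ?_ (by positivity)
        linarith [le_max_left (|τ| - T) 0]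
      · rw [hz, zero_sub, max_eq_right (by linarith), ENNReal.ofReal_zero]
        exact zero_le
    refine (lintegral_mono hpt).trans ?_
    rw [lintegral_add_left (by fun_prop), lintegral_indicator_one measurableSet_Ici,
      ENNReal.ofReal_add (by positivity) (by positivity)]
    exact add_le_add hL (laplaceLaw_Ici_le hε (by linarith))

/-! # Accuracy of the combined mechanism -/

theorem abs_sub_clamp_le {x u : ℝ} (h0 : 0 ≤ x) (hu : x ≤ u) (v : ℝ) :
    |x - max 0 (min u v)| ≤ |x - v| := by
  rcases le_total u v with h | h <;> rcases le_total v 0 with h' | h' <;>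
    rcases le_total 0 u with h'' | h'' <;>
    simp only [h, h', h'', min_eq_left, min_eq_right, max_eq_left, max_eq_right] <;>
    first
    | exact le_rfl
    | (rw [abs_of_nonneg, abs_of_nonneg] <;> linarith)
    | (rw [abs_of_nonpos, abs_of_nonpos] <;> linarith)

/-- If nothing is stored, the ALP part aims at `min x t` and thresholding is charged with the rest.
The sum covers both cases, so the two errors can be averaged separately. -/
theorem abs_sub_thresholdALPEstimate_le {N d s m : ℕ} {α ε u t : ℝ} (hα : 0 < α) (hε : 0 < ε)
    (hash : Fin N → Fin d → Fin s) (r : (Fin d → ℝ) × ALPOutput N s m) {x : Fin d → ℝ}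
    {i : Fin d} (h0 : 0 ≤ x i) (hu : x i ≤ u) :
    |x i - thresholdALPEstimate α ε u hash r i| ≤ thresholdError t (x i) (r.1 i) +
      α / (ε / 2) * |averagePeak hash r.2 i - min (x i * (ε / 2) / α) (t * (ε / 2) / α)| := by
  refine (abs_sub_clamp_le h0 hu _).trans ?_
  have hc : 0 < α / (ε / 2) := by positivity
  unfold thresholdError
  by_cases hv : r.1 i ≠ 0
  · rw [if_pos hv, if_pos hv]
    exact le_add_of_nonneg_right (by positivity)
  · rw [if_neg hv, if_neg hv, alpEstimate_eq]
    have h1 : x i - averagePeak hash r.2 i * (α / (ε / 2)) = (x i - min (x i) t) -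
        α / (ε / 2) * (averagePeak hash r.2 i - min (x i * (ε / 2) / α) (t * (ε / 2) / α)) := by
      rw [mul_sub, mul_min_of_nonneg _ _ hc.le]
      have h2 : ∀ z : ℝ, α / (ε / 2) * (z * (ε / 2) / α) = z := fun z => by field_simp
      rw [h2, h2]
      ring
    rw [h1]
    refine (abs_sub _ _).trans (add_le_add ?_ ?_)
    · rcases le_total (x i) t with h | h
      · simp [h]
      · rw [min_eq_right h, max_eq_left (by linarith), abs_of_nonneg (by linarith)]
    · rw [abs_mul, abs_of_pos hc]

theorem columns_eq (α ε δ : ℝ) :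
    columns α ε δ = ⌈thresholdValue (ε / 2) δ * (ε / 2) / α⌉₊ := rfl

theorem exp_thresholdValue {ε δ : ℝ} (hε : 0 < ε) (hδ : 0 < δ) :
    Real.exp (-(thresholdValue ε δ - 1) * ε) = δ * Real.exp (-ε) := by
  have : -(thresholdValue ε δ - 1) * ε = Real.log δ + -ε := by
    rw [thresholdValue, one_div, Real.log_inv]; field_simp; ring
  rw [this, Real.exp_add, Real.exp_log hδ]

theorem one_le_thresholdValue {ε δ : ℝ} (hε : 0 < ε) (hδ : 0 < δ) (hδ1 : δ ≤ 1) :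
    1 ≤ thresholdValue ε δ := by
  have hlog : 0 ≤ Real.log (1 / δ) := Real.log_nonneg (by rw [le_div_iff₀ hδ]; linarith)
  have : 0 ≤ Real.log (1 / δ) / ε := by positivity
  rw [thresholdValue]; linarith

/-! ### Mean error of an entry and mean maximum error. -/

section Expected

variable {N d k s : ℕ} {hash : Fin N → Fin d → Fin s} {α ε δ u γ : ℝ} {x : Fin d → ℝ}

theorem lintegral_thresholdALP_thresholdError_le (hN : 0 < N) (hα : 0 < α) (hε : 0 < ε)
    (hδ : 0 < δ) (hδ1 : δ ≤ 1) (hx : ∀ i, 0 ≤ x i) (i : Fin d) {T : ℝ} (hT : 0 ≤ T) :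
    ∫⁻ r, ENNReal.ofReal (max (thresholdError (thresholdValue (ε / 2) δ) (x i) (r.1 i) - T) 0)
        ∂thresholdALP α ε δ hash x ≤
      ENNReal.ofReal (8 / ε * Real.exp (-T * (ε / 4)) + δ * Real.exp (-(ε / 2)) / 2) := by
  have := fun i => isProbabilityMeasure_thresholdEntry
    (t := thresholdValue (ε / 2) δ) (half_pos hε) (hx i)
  have := isProbabilityMeasure_thresholdMechanism (δ := δ) (half_pos hε) hx
  have := isProbabilityMeasure_alpProjection (ε := ε / 2) (m := columns α ε δ) hN hα.le hash x
  have hm : Measurable fun v : ℝ =>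
      ENNReal.ofReal (max (thresholdError (thresholdValue (ε / 2) δ) (x i) v - T) 0) :=
    (((measurable_thresholdError _ _).sub_const _).max measurable_const).ennreal_ofReal
  have h1 := (measurePreserving_fst (μ := thresholdMechanism (ε / 2) δ x)
    (ν := alpProjection α (ε / 2) (columns α ε δ) hash x)).lintegral_comp
    (hm.comp (measurable_pi_apply i))
  have h2 := (measurePreserving_eval
    (fun i => thresholdEntry (ε / 2) (thresholdValue (ε / 2) δ) (x i)) i).lintegral_comp hm
  refine (h1.trans h2).trans_le ((lintegral_thresholdError_le (half_pos hε)
    (one_le_thresholdValue (half_pos hε) hδ hδ1) (hx i) hT).trans (le_of_eq ?_))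
  rw [exp_thresholdValue (half_pos hε) hδ]
  congr 3
  · field_simp; norm_num
  · congr 1; ring

theorem lintegral_error_le (hN : 0 < N) (hs : 0 < s) (hu : IsUniversal hash) (hα : 0 < α)
    (hε : 0 < ε) (hδ : 0 < δ) (hδ1 : δ ≤ 1) (hγ : 0 < γ) (hγ1 : γ ≤ 1 / 2)
    (hq : 1 / (α + 2) + k / s * (1 - 2 * (1 / (α + 2))) ≤ 1 / 2 - γ)
    (hx : ∀ i, 0 ≤ x i) (hxu : ∀ i, x i ≤ u) (hk : IsSparse k x) (i : Fin d) :
    ∫⁻ r, ENNReal.ofReal |x i - thresholdALPEstimate α ε u hash r i| ∂thresholdALP α ε δ hash x ≤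
      ENNReal.ofReal (8 / ε + δ * Real.exp (-(ε / 2)) / 2 +
        α / (ε / 2) * (1 / γ ^ 4 + 1)) := by
  have := isProbabilityMeasure_thresholdMechanism (δ := δ) (half_pos hε) hx
  have := isProbabilityMeasure_alpProjection (ε := ε / 2) (m := columns α ε δ) hN hα.le hash x
  set t := thresholdValue (ε / 2) δ with ht
  have ht1 : 1 ≤ t := one_le_thresholdValue (half_pos hε) hδ hδ1
  have h1 := lintegral_thresholdALP_thresholdError_le (hash := hash) hN hα hε hδ hδ1 hx i le_rfl
  have h2 := (measurePreserving_snd (μ := thresholdMechanism (ε / 2) δ x)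
    (ν := alpProjection α (ε / 2) (columns α ε δ) hash x)).lintegral_comp
    (f := fun o => ENNReal.ofReal |averagePeak hash o i -
      min (x i * (ε / 2) / α) (t * (ε / 2) / α)|) .of_discrete
  have h3 := lintegral_alpProjection_le hN hs hu hα (half_pos hε).le
    (τ := t * (ε / 2) / α) (by positivity) hγ hγ1 hq hx hk i
  have hc : 0 ≤ α / (ε / 2) := by positivity
  have hm : Measurable fun r : (Fin d → ℝ) × ALPOutput N s (columns α ε δ) =>
      ENNReal.ofReal |averagePeak hash r.2 i - min (x i * (ε / 2) / α) (t * (ε / 2) / α)| :=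
    (Measurable.of_discrete (f := fun o : ALPOutput N s (columns α ε δ) =>
      ENNReal.ofReal |averagePeak hash o i -
        min (x i * (ε / 2) / α) (t * (ε / 2) / α)|)).comp measurable_snd
  calc _ ≤ ∫⁻ r, (ENNReal.ofReal (max (thresholdError t (x i) (r.1 i) - 0) 0) +
        ENNReal.ofReal (α / (ε / 2)) * ENNReal.ofReal |averagePeak hash r.2 i -
          min (x i * (ε / 2) / α) (t * (ε / 2) / α)|) ∂thresholdALP α ε δ hash x := by
        refine lintegral_mono fun r => ?_
        rw [sub_zero, max_eq_left (thresholdError_nonneg _ _ _), ← ENNReal.ofReal_mul hc,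
          ← ENNReal.ofReal_add (thresholdError_nonneg _ _ _) (by positivity)]
        exact ENNReal.ofReal_le_ofReal
          (abs_sub_thresholdALPEstimate_le hα hε hash r (hx i) (hxu i))
    _ = ∫⁻ r, ENNReal.ofReal (max (thresholdError t (x i) (r.1 i) - 0) 0)
          ∂thresholdALP α ε δ hash x + ENNReal.ofReal (α / (ε / 2)) *
        ∫⁻ o, ENNReal.ofReal |averagePeak hash o i -
          min (x i * (ε / 2) / α) (t * (ε / 2) / α)|
            ∂alpProjection α (ε / 2) (columns α ε δ) hash x := by
        rw [← h2, lintegral_add_right _ (hm.const_mul _), lintegral_const_mul _ hm]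
        rfl
    _ ≤ ENNReal.ofReal (8 / ε + δ * Real.exp (-(ε / 2)) / 2) +
        ENNReal.ofReal (α / (ε / 2)) * ENNReal.ofReal (1 / γ ^ 4 + 1) := by
        gcongr
        · simpa using h1
        · exact h3
    _ = _ := by
        rw [← ENNReal.ofReal_mul hc, ← ENNReal.ofReal_add (by positivity) (by positivity)]

/-- Zero entries are never stored, so at most `k` entries carry Laplace noise. Both the maximum
error and the size of the dictionary rely on this. -/
theorem ae_thresholdALP_eq_zero (hN : 0 < N) (hα : 0 < α) (hε : 0 < ε)
    (hx : ∀ i, 0 ≤ x i) :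
    ∀ᵐ r ∂thresholdALP α ε δ hash x, ∀ i, x i = 0 → r.1 i = 0 := by
  have := fun i => isProbabilityMeasure_thresholdEntry
    (t := thresholdValue (ε / 2) δ) (half_pos hε) (hx i)
  have := isProbabilityMeasure_thresholdMechanism (δ := δ) (half_pos hε) hx
  have := isProbabilityMeasure_alpProjection (ε := ε / 2) (m := columns α ε δ) hN hα.le hash x
  have h1 : ∀ᵐ v ∂thresholdMechanism (ε / 2) δ x, ∀ i, x i = 0 → v i = 0 := by
    rw [ae_all_iff]
    intro i
    have hi : ∀ᵐ v ∂thresholdEntry (ε / 2) (thresholdValue (ε / 2) δ) (x i),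
        x i = 0 → v = 0 := by
      by_cases h : x i = 0
      · rw [h, thresholdEntry_zero (half_pos hε), ae_dirac_eq]
        simp
      · simp [h]
    exact (Measure.quasiMeasurePreserving_eval
      (fun i => thresholdEntry (ε / 2) (thresholdValue (ε / 2) δ) (x i)) i).ae hi
  exact (measurePreserving_fst (μ := thresholdMechanism (ε / 2) δ x)
    (ν := alpProjection α (ε / 2) (columns α ε δ) hash x)).quasiMeasurePreserving.ae h1

/-- The ALP error is bounded surely by the number of columns. Every thresholding error is at most
`T` plus the sum of the excesses over the non-zero entries, and `T` is chosen so that `k * exp (-T *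
(ε / 4)) = 1`. -/
theorem lintegral_iSup_error_le (hN : 0 < N) (hα : 0 < α)
    (hε : 0 < ε) (hδ : 0 < δ) (hδ1 : δ ≤ 1) (hk1 : 1 ≤ k) (hd : 0 < d)
    (hx : ∀ i, 0 ≤ x i) (hxu : ∀ i, x i ≤ u) (hk : IsSparse k x) :
    ∫⁻ r, ENNReal.ofReal (⨆ i, |x i - thresholdALPEstimate α ε u hash r i|)
        ∂thresholdALP α ε δ hash x ≤
      ENNReal.ofReal (4 * Real.log k / ε + α / (ε / 2) * columns α ε δ +
        (8 / ε + k * (δ * Real.exp (-(ε / 2)) / 2))) := by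
  classical
  have : Nonempty (Fin d) := ⟨⟨0, hd⟩⟩
  have := isProbabilityMeasure_thresholdALP (δ := δ) hN hα hε hash hx
  set t := thresholdValue (ε / 2) δ with ht
  have ht1 : 1 ≤ t := one_le_thresholdValue (half_pos hε) hδ hδ1
  set T := 4 * Real.log k / ε with hT
  have hk1' : (1 : ℝ) ≤ k := by exact_mod_cast hk1
  have hT0 : 0 ≤ T := div_nonneg (mul_nonneg (by norm_num) (Real.log_nonneg hk1')) hε.le
  have hc : 0 ≤ α / (ε / 2) := by positivity
  set J : Finset (Fin d) := Finset.univ.filter fun i => x i ≠ 0 with hJ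
  have hJk : J.card ≤ k := by
    refine le_trans (le_of_eq ?_) hk
    rw [← Set.ncard_coe_finset]
    congr 1; ext i; simp [hJ]
  have hpt : ∀ᵐ r ∂thresholdALP α ε δ hash x,
      ENNReal.ofReal (⨆ i, |x i - thresholdALPEstimate α ε u hash r i|) ≤
        ENNReal.ofReal (T + α / (ε / 2) * columns α ε δ) +
          ∑ i ∈ J, ENNReal.ofReal (max (thresholdError t (x i) (r.1 i) - T) 0) := by
    filter_upwards [ae_thresholdALP_eq_zero (δ := δ) (hash := hash) hN hα hε hx] with r hr
    have hS : 0 ≤ ∑ i ∈ J, max (thresholdError t (x i) (r.1 i) - T) 0 :=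
      Finset.sum_nonneg fun i _ => le_max_right _ _
    rw [← ENNReal.ofReal_sum_of_nonneg fun i _ => le_max_right _ _,
      ← ENNReal.ofReal_add (by positivity) hS]
    refine ENNReal.ofReal_le_ofReal (ciSup_le fun i => ?_)
    refine (abs_sub_thresholdALPEstimate_le (t := t) hα hε hash r (hx i) (hxu i)).trans ?_
    have h1 : |averagePeak hash r.2 i - min (x i * (ε / 2) / α) (t * (ε / 2) / α)| ≤
        columns α ε δ := by
      have h2 := averagePeak_mem hash r.2 i
      have h3 : 0 ≤ min (x i * (ε / 2) / α) (t * (ε / 2) / α) := by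
        have := hx i
        exact le_min (by positivity) (by positivity)
      have h4 : min (x i * (ε / 2) / α) (t * (ε / 2) / α) ≤ columns α ε δ :=
        (min_le_right _ _).trans (Nat.le_ceil _)
      rw [abs_le]; constructor <;> linarith
    have h5 : thresholdError t (x i) (r.1 i) ≤
        T + ∑ i ∈ J, max (thresholdError t (x i) (r.1 i) - T) 0 := by
      by_cases hi : x i = 0
      · rw [hi, hr i hi, thresholdError, if_neg (by simp), max_eq_right (by linarith)]
        positivity
      · have hiJ : i ∈ J := by simp [hJ, hi]
        have := Finset.single_le_sum
          (f := fun i => max (thresholdError t (x i) (r.1 i) - T) 0)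
          (fun i _ => le_max_right _ _) hiJ
        have h6 := le_max_left (thresholdError t (x i) (r.1 i) - T) 0
        linarith
    have h7 := mul_le_mul_of_nonneg_left h1 hc
    linarith
  have hmeas : ∀ i ∈ J, Measurable fun r : (Fin d → ℝ) × ALPOutput N s (columns α ε δ) =>
      ENNReal.ofReal (max (thresholdError t (x i) (r.1 i) - T) 0) := fun i _ =>
    ((((measurable_thresholdError t (x i)).comp
      ((measurable_pi_apply i).comp measurable_fst)).sub_const _).max
        measurable_const).ennreal_ofReal
  have hexp : (k : ℝ) * Real.exp (-T * (ε / 4)) = 1 := by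
    have : -T * (ε / 4) = -Real.log k := by rw [hT]; field_simp
    rw [this, Real.exp_neg, Real.exp_log (by linarith)]
    exact mul_inv_cancel₀ (by linarith)
  calc _ ≤ _ := lintegral_mono_ae hpt
    _ = ENNReal.ofReal (T + α / (ε / 2) * columns α ε δ) + ∑ i ∈ J,
        ∫⁻ r, ENNReal.ofReal (max (thresholdError t (x i) (r.1 i) - T) 0)
          ∂thresholdALP α ε δ hash x := by
        rw [lintegral_add_left measurable_const, lintegral_finsetSum _ hmeas]
        simp
    _ ≤ ENNReal.ofReal (T + α / (ε / 2) * columns α ε δ) + ∑ i ∈ J,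
        ENNReal.ofReal (8 / ε * Real.exp (-T * (ε / 4)) + δ * Real.exp (-(ε / 2)) / 2) := by
        gcongr with i hi
        exact lintegral_thresholdALP_thresholdError_le hN hα hε hδ hδ1 hx i hT0
    _ ≤ ENNReal.ofReal (T + α / (ε / 2) * columns α ε δ) +
        ENNReal.ofReal (8 / ε + k * (δ * Real.exp (-(ε / 2)) / 2)) := by
        gcongr
        rw [Finset.sum_const, nsmul_eq_mul, ← ENNReal.ofReal_natCast,
          ← ENNReal.ofReal_mul (Nat.cast_nonneg _)]
        refine ENNReal.ofReal_le_ofReal ?_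
        have h8 : (J.card : ℝ) ≤ k := by exact_mod_cast hJk
        calc _ ≤ (k : ℝ) * (8 / ε * Real.exp (-T * (ε / 4)) + δ * Real.exp (-(ε / 2)) / 2) := by
              gcongr
          _ = 8 / ε * (k * Real.exp (-T * (ε / 4))) + k * (δ * Real.exp (-(ε / 2)) / 2) := by ring
          _ = _ := by rw [hexp, mul_one]
    _ = _ := by
        rw [← ENNReal.ofReal_add (by positivity) (by positivity)]

end Expected

/-! # A universal family of hash functions -/

/-- The affine hash function with code `g` modulo `p`, reduced modulo `s`. -/
def affineHash (p s g x : ℕ) : ℕ := ((g / p + 1) * x + g % p) % p % s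

/-- The Carter–Wegman family of affine functions modulo `p`, reduced modulo `s`. -/
def affineFamily (d p s : ℕ) (hs : 0 < s) (g : Fin (p * (p - 1))) (x : Fin d) : Fin s :=
  ⟨affineHash p s g x, Nat.mod_lt _ hs⟩

/-- A residue class modulo `s` has at most `⌈p / s⌉` members below `p`, and `r` itself is removed.
-/
theorem card_modEq_mul_le {p s r : ℕ} (hs : 0 < s) (hr : r < p) :
    ((Finset.range p).filter fun t => t ≠ r ∧ t % s = r % s).card * s ≤ p - 1 := by
  have h1 : ((Finset.range p).filter fun t => t ≠ r ∧ t % s = r % s) =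
      ((Finset.range p).filter fun t => t ≡ r [MOD s]).erase r := by
    ext t
    rw [Finset.mem_erase, Finset.mem_filter, Finset.mem_filter]
    unfold Nat.ModEq
    tauto
  have h2 : r ∈ (Finset.range p).filter fun t => t ≡ r [MOD s] := by
    exact Finset.mem_filter.2 ⟨Finset.mem_range.2 hr, rfl⟩
  rw [h1, Finset.card_erase_of_mem h2, ← Nat.count_eq_card_filter_range,
    Nat.count_modEq_card p hs]
  have h3 := Nat.div_add_mod p s
  have h5 : (p / s) * s = s * (p / s) := mul_comm _ _
  split_ifs with h
  · rw [Nat.add_sub_cancel]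
    omega
  · rw [Nat.add_zero, Nat.sub_mul, one_mul]
    omega

/-- The values at `i` and `j` before reduction modulo `s` determine the multiplier and the shift,
and they are distinct. Colliding codes therefore inject into pairs of distinct residues modulo `p`
that agree modulo `s`. -/
theorem affineFamily_isUniversal {d p s : ℕ} (hp : p.Prime) (hd : d ≤ p) (hs : 0 < s) :
    IsUniversal (affineFamily d p s hs) := by
  intro i j hij
  have := Fact.mk hp
  have hp0 : 0 < p := hp.pos
  set val : Fin (p * (p - 1)) → ℕ → ℕ := fun g x => ((g / p + 1) * x + g % p) % p with hval
  set T : Finset (Σ _ : ℕ, ℕ) := (Finset.range p).sigma fun r =>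
    (Finset.range p).filter fun t => t ≠ r ∧ t % s = r % s with hT
  have hcast : ∀ g x, ((val g x : ℕ) : ZMod p) =
      (((g : ℕ) / p + 1 : ℕ) : ZMod p) * x + ((g : ℕ) % p : ℕ) := by
    intro g x
    simp only [hval, ZMod.natCast_mod, Nat.cast_add, Nat.cast_mul]
  have hij0 : ((i : ℕ) : ZMod p) - (j : ℕ) ≠ 0 := by
    intro h
    have := (ZMod.natCast_eq_natCast_iff' _ _ _).1 (sub_eq_zero.1 h)
    rw [Nat.mod_eq_of_lt (i.2.trans_le hd), Nat.mod_eq_of_lt (j.2.trans_le hd)] at this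
    exact hij (Fin.ext this)
  -- The multipliers run over `1, …, p - 1`, hence are invertible modulo `p`.
  have ha : ∀ g : Fin (p * (p - 1)), (g : ℕ) / p + 1 < p := by
    intro g
    have := Nat.div_lt_of_lt_mul g.2
    omega
  have hdiff : ∀ g, ((val g i : ℕ) : ZMod p) - (val g j : ℕ) =
      (((g : ℕ) / p + 1 : ℕ) : ZMod p) * ((i : ℕ) - (j : ℕ)) := by
    intro g; rw [hcast, hcast]; ring
  have hcard : ({g | affineFamily d p s hs g i = affineFamily d p s hs g j} :
      Set (Fin (p * (p - 1)))).ncard ≤ T.card := by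
    rw [← Set.ncard_coe_finset]
    refine Set.ncard_le_ncard_of_injOn (fun g => ⟨val g i, val g j⟩) ?_ ?_ (Finset.finite_toSet _)
    · intro g hg
      have hg' : val g i % s = val g j % s := Fin.ext_iff.1 hg
      simp only [hT, Finset.coe_sigma, Set.mem_sigma_iff, Finset.coe_range, Set.mem_Iio,
        Finset.coe_filter, Finset.mem_range, Set.mem_ofPred_eq]
      refine ⟨Nat.mod_lt _ hp0, Nat.mod_lt _ hp0, fun h => ?_, hg'.symm⟩
      have h2 := hdiff g
      rw [h, sub_self] at h2
      rcases mul_eq_zero.1 h2.symm with h3 | h3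
      · rw [ZMod.natCast_eq_zero_iff] at h3
        exact absurd (Nat.le_of_dvd (Nat.succ_pos _) h3) (not_le.2 (ha g))
      · exact hij0 h3
    · intro g _ g' _ hgg
      simp only [Sigma.mk.injEq, heq_eq_eq] at hgg
      have h2 := hdiff g
      rw [hgg.1, hgg.2, hdiff g'] at h2
      have h3 := mul_right_cancel₀ hij0 h2
      have h4 := (ZMod.natCast_eq_natCast_iff' _ _ _).1 h3
      rw [Nat.mod_eq_of_lt (ha g), Nat.mod_eq_of_lt (ha g')] at h4
      have h5 := hcast g i
      rw [hgg.1, hcast g', h3] at h5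
      have h6 := (ZMod.natCast_eq_natCast_iff' _ _ _).1 (add_left_cancel h5)
      rw [Nat.mod_mod, Nat.mod_mod] at h6
      have h7 : (g : ℕ) / p = (g' : ℕ) / p := by omega
      refine Fin.ext ?_
      rw [← Nat.div_add_mod (g : ℕ) p, ← Nat.div_add_mod (g' : ℕ) p, h6, h7]
  calc _ ≤ T.card * s := Nat.mul_le_mul_right _ hcard
    _ = ∑ r ∈ Finset.range p,
          ((Finset.range p).filter fun t => t ≠ r ∧ t % s = r % s).card * s := by
        rw [hT, Finset.card_sigma, Finset.sum_mul]
    _ ≤ ∑ _r ∈ Finset.range p, (p - 1) :=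
        Finset.sum_le_sum fun r hr => card_modEq_mul_le hs (Finset.mem_range.1 hr)
    _ = p * (p - 1) := by simp

/-! # Reasoning about word RAM programs -/

namespace WordRAM

/-- The operations on natural numbers. -/
def BinOp.natEval : BinOp → ℕ → ℕ → ℕ
  | .add, a, b => a + b
  | .sub, a, b => a - b
  | .mul, a, b => a * b
  | .div, a, b => a / b
  | .mod, a, b => a % b
  | .shr, a, b => a / 2 ^ b
  | _, _, _ => 0

/-- No overflow occurs when the operation is applied to `w`-bit words. -/
def BinOp.NoOverflow (w : ℕ) : BinOp → ℕ → ℕ → Prop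
  | .add, a, b => a + b < 2 ^ w
  | .sub, a, b => b ≤ a
  | .mul, a, b => a * b < 2 ^ w
  | .div, _, _ => True
  | .mod, _, _ => True
  | .shr, _, _ => True
  | _, _, _ => False

theorem BinOp.toNat_eval {w : ℕ} {o : BinOp} {a b : BitVec w}
    (h : o.NoOverflow w a.toNat b.toNat) : (o.eval a b).toNat = o.natEval a.toNat b.toNat := by
  cases o <;> simp only [NoOverflow] at h <;> simp only [eval, natEval]
  · rw [BitVec.toNat_add, Nat.mod_eq_of_lt h]
  · exact BitVec.toNat_sub_of_le (BitVec.le_def.2 h)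
  · rw [BitVec.toNat_mul, Nat.mod_eq_of_lt h]
  · exact BitVec.toNat_udiv
  · exact BitVec.toNat_umod
  · rw [BitVec.toNat_ushiftRight, Nat.shiftRight_eq_div_pow]

/-- The effect of an instruction that is not a jump on registers that hold natural numbers. -/
def Instr.run (M : ℕ → ℕ) : Instr → (ℕ → ℕ) → ℕ → ℕ
  | .const dst c, ρ => Function.update ρ dst c
  | .op o dst a b, ρ => Function.update ρ dst (o.natEval (ρ a) (ρ b))
  | .load dst addr, ρ => Function.update ρ dst (M (ρ addr))
  | _, ρ => ρ

/-- The instruction is not a jump, and does not overflow. -/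
def Instr.Safe (w : ℕ) : Instr → (ℕ → ℕ) → Prop
  | .const _ c, _ => c < 2 ^ w
  | .op o _ a b, ρ => o.NoOverflow w (ρ a) (ρ b)
  | .load _ _, _ => True
  | _, _ => False

/-- The instruction does not change register `r`. -/
def Instr.Keeps (r : ℕ) : Instr → Prop
  | .const dst _ => r ≠ dst
  | .op _ dst _ _ => r ≠ dst
  | .load dst _ => r ≠ dst
  | _ => True

/-- The effect of a block of instructions without jumps. -/
def runBlock (M : ℕ → ℕ) : List Instr → (ℕ → ℕ) → ℕ → ℕ
  | [], ρ => ρ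
  | c :: L, ρ => runBlock M L (c.run M ρ)

/-- The block has no jumps, and does not overflow. -/
def SafeBlock (w : ℕ) (M : ℕ → ℕ) : List Instr → (ℕ → ℕ) → Prop
  | [], _ => True
  | c :: L, ρ => c.Safe w ρ ∧ SafeBlock w M L (c.run M ρ)

theorem runBlock_of_keeps {M : ℕ → ℕ} {r : ℕ} {L : List Instr} {ρ : ℕ → ℕ}
    (h : ∀ c ∈ L, c.Keeps r) : runBlock M L ρ r = ρ r := by
  induction L generalizing ρ with
  | nil => rfl
  | cons c L ih =>
    rw [runBlock, ih fun c' hc' => h c' (List.mem_cons_of_mem _ hc')]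
    have hc := h c List.mem_cons_self
    cases c <;> simp only [Instr.Keeps] at hc <;> simp [Instr.run, hc]

/-- From program counter `pc` and registers `ρ`, the program halts within `T` steps with the
numbers `a` and `b` in registers `0` and `1`. -/
def Halts {w : ℕ} (P : Program) (mem : BitVec w → BitVec w) (a b pc : ℕ) (ρ : ℕ → ℕ) (T : ℕ) :
    Prop :=
  ∀ reg : ℕ → BitVec w, (∀ r, (reg r).toNat = ρ r) →
    ∃ σ, exec P T ⟨pc, reg, mem⟩ = some σ ∧ (σ.reg 0).toNat = a ∧ (σ.reg 1).toNat = b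

/-! ### Execution rules, read backwards from the halting point. -/

section Halts

variable {w : ℕ} {P : Program} {mem : BitVec w → BitVec w} {M : ℕ → ℕ} {a b pc T : ℕ} {ρ : ℕ → ℕ}

theorem exec_zero {σ : Config w} :
    exec P 0 σ = match step P σ with
      | none => some σ
      | some _ => none := rfl

theorem exec_succ {σ : Config w} :
    exec P (T + 1) σ = match step P σ with
      | none => some σ
      | some σ' => exec P T σ' := rfl

theorem exec_mono {T T' : ℕ} {σ τ : Config w} (h : T ≤ T') (he : exec P T σ = some τ) :
    exec P T' σ = some τ := by
  induction T generalizing T' σ with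
  | zero =>
    cases T' with
    | zero => exact he
    | succ T' =>
      rw [exec_zero] at he
      rw [exec_succ]
      cases hs : step P σ with
      | none => simpa [hs] using he
      | some σ' => simp [hs] at he
  | succ T ih =>
    obtain ⟨T', rfl⟩ : ∃ n, T' = n + 1 := ⟨T' - 1, by omega⟩
    rw [exec_succ] at he ⊢
    cases hs : step P σ with
    | none => simpa [hs] using he
    | some σ' =>
      simp only [hs] at he ⊢
      exact ih (by omega) he

theorem Halts.mono {T' : ℕ} (h : Halts P mem a b pc ρ T) (hT : T ≤ T') :
    Halts P mem a b pc ρ T' := by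
  intro reg hr
  obtain ⟨σ, h1, h2⟩ := h reg hr
  exact ⟨σ, exec_mono hT h1, h2⟩

theorem exec_succ_of_step {σ σ' : Config w} (h : step P σ = some σ') :
    exec P (T + 1) σ = exec P T σ' := by
  rw [exec_succ, h]

theorem Halts.halt (hP : P[pc]? = some .halt) : Halts P mem (ρ 0) (ρ 1) pc ρ 0 := by
  intro reg hr
  exact ⟨⟨pc, reg, mem⟩, by simp [exec_zero, step, hP], hr 0, hr 1⟩

theorem Halts.jump {target : ℕ} (hP : P[pc]? = some (.jump target))
    (h : Halts P mem a b target ρ T) : Halts P mem a b pc ρ (T + 1) := by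
  intro reg hr
  rw [exec_succ_of_step (σ' := ⟨target, reg, mem⟩) (by simp [step, hP])]
  exact h reg hr

theorem Halts.jumpLt {r r' target : ℕ} (hP : P[pc]? = some (.jumpLt r r' target))
    (h : ρ r < ρ r' → Halts P mem a b target ρ T)
    (h' : ¬ ρ r < ρ r' → Halts P mem a b (pc + 1) ρ T) : Halts P mem a b pc ρ (T + 1) := by
  intro reg hr
  rw [exec_succ_of_step (σ' := ⟨if (reg r).toNat < (reg r').toNat then target else pc + 1, reg,
    mem⟩) (by simp [step, hP])]
  rw [hr, hr]
  split_ifs with hlt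
  · exact h hlt reg hr
  · exact h' hlt reg hr

theorem Halts.jumpEq {r r' target : ℕ} (hP : P[pc]? = some (.jumpEq r r' target))
    (h : ρ r = ρ r' → Halts P mem a b target ρ T)
    (h' : ρ r ≠ ρ r' → Halts P mem a b (pc + 1) ρ T) : Halts P mem a b pc ρ (T + 1) := by
  intro reg hr
  rw [exec_succ_of_step (σ' := ⟨if reg r = reg r' then target else pc + 1, reg,
    mem⟩) (by simp [step, hP])]
  have : reg r = reg r' ↔ ρ r = ρ r' := by rw [← hr, ← hr, BitVec.toNat_inj]
  simp only [this]
  split_ifs with heq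
  · exact h heq reg hr
  · exact h' heq reg hr

theorem Halts.instr (hM : ∀ a, (mem a).toNat = M a.toNat) {c : Instr} (hP : P[pc]? = some c)
    (hc : c.Safe w ρ) (h : Halts P mem a b (pc + 1) (c.run M ρ) T) :
    Halts P mem a b pc ρ (T + 1) := by
  intro reg hr
  have upd : ∀ (dst v : ℕ) (v' : BitVec w), v'.toNat = v → ∀ r,
      (Function.update reg dst v' r).toNat = Function.update ρ dst v r := by
    intro dst v v' hv r
    by_cases h : r = dst
    · subst h; simpa using hv
    · simpa [h] using hr r
  cases c with
  | const dst v =>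
    rw [exec_succ_of_step (σ' := ⟨pc + 1, Function.update reg dst (BitVec.ofNat w v), mem⟩)
      (by simp [step, hP])]
    exact h _ (upd _ _ _ (by rw [BitVec.toNat_ofNat, Nat.mod_eq_of_lt hc]))
  | op o dst r r' =>
    rw [exec_succ_of_step (σ' := ⟨pc + 1, Function.update reg dst (o.eval (reg r) (reg r')), mem⟩)
      (by simp [step, hP])]
    refine h _ (upd _ _ _ ?_)
    have hc' : o.NoOverflow w (reg r).toNat (reg r').toNat := by rw [hr, hr]; exact hc
    rw [BinOp.toNat_eval hc', hr, hr]
  | load dst addr =>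
    rw [exec_succ_of_step (σ' := ⟨pc + 1, Function.update reg dst (mem (reg addr)), mem⟩)
      (by simp [step, hP])]
    exact h _ (upd _ _ _ (by rw [hM, hr]))
  | store _ _ => exact hc.elim
  | jump _ => exact hc.elim
  | jumpLt _ _ _ => exact hc.elim
  | jumpEq _ _ _ => exact hc.elim
  | halt => exact hc.elim

/-- The block is cut out of the program by `drop` and `take`, so for a concrete program the
hypothesis holds by computation. -/
theorem Halts.block (hM : ∀ a, (mem a).toNat = M a.toNat) {L : List Instr} {n : ℕ}
    (hP : (P.drop pc).take n = L) (hn : L.length = n) (hL : SafeBlock w M L ρ)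
    (h : Halts P mem a b (pc + n) (runBlock M L ρ) T) : Halts P mem a b pc ρ (T + n) := by
  induction L generalizing pc n ρ with
  | nil => subst hn; exact h
  | cons c L ih =>
    subst hn
    have hlen : pc < P.length := by
      by_contra hge
      rw [List.drop_eq_nil_of_le (not_lt.1 hge)] at hP
      simp at hP
    rw [List.drop_eq_getElem_cons hlen, List.length_cons, List.take_succ_cons] at hP
    injection hP with h1 h2
    rw [List.length_cons, ← add_assoc]
    refine Halts.instr hM (c := c) (by rw [List.getElem?_eq_getElem hlen, h1]) hL.1 ?_
    refine ih h2 rfl hL.2 ?_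
    rw [List.length_cons] at h
    rwa [add_assoc, add_comm 1]

end Halts

end WordRAM

namespace WordRAM

/-! # The access program -/

/-- Loads the header of the image and some constants. -/
def preludeCode : Program :=
  [.const 20 0, .load 20 20, .const 21 1, .load 21 21, .const 22 2, .load 22 22,
   .const 23 3, .load 23 23, .const 24 4, .load 24 24, .const 25 5, .load 25 25,
   .const 26 6, .load 26 26, .const 27 7, .load 27 27, .const 28 8, .load 28 28,
   .const 29 9, .load 29 29, .const 30 10, .load 30 30, .const 31 11, .load 31 31,
   .const 32 12, .load 32 32, .const 33 1, .const 34 2, .const 35 16, .const 36 15,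
   .const 37 0, .const 2 0, .op .add 3 20 37]

/-- Searches the sorted keys for the queried index; from position 33. -/
def searchCode : Program :=
  [.jumpEq 3 33 42, .op .shr 3 3 33, .op .add 4 2 3, .op .add 5 4 36, .load 5 5,
   .jumpLt 5 0 40, .jump 33, .op .add 2 4 37, .jump 33,
   .op .add 4 2 35, .load 5 4, .jumpEq 5 0 46, .jump 50,
   .op .add 4 4 20, .load 0 4, .op .add 1 21 37, .halt]

/-- Computes the peaks of the partial sums; from position 50. -/
def columnsCode : Program :=
  [.op .add 10 37 37, .op .add 11 22 37, .op .add 12 22 37, .op .add 13 37 37, .op .add 14 33 37,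
   .jumpEq 10 22 93,
   .op .div 4 10 26, .op .add 4 4 25, .load 4 4, .op .mod 5 10 26, .op .mul 5 5 27,
   .op .shr 4 4 5, .op .mod 4 4 28,
   .op .div 5 4 23, .op .add 5 5 33, .op .mul 5 5 0, .op .mod 4 4 23, .op .add 5 5 4,
   .op .mod 5 5 23, .op .mod 5 5 24,
   .op .mul 5 5 22, .op .add 5 5 10, .op .div 4 5 30, .op .add 4 4 29, .load 4 4,
   .op .mod 5 5 30, .op .shr 4 4 5, .op .mod 4 4 34, .op .add 10 10 33,
   .jumpEq 4 33 82, .op .sub 11 11 33, .jump 55,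
   .op .add 11 11 33, .jumpLt 12 11 86, .jumpEq 12 11 90, .jump 55,
   .op .add 12 11 37, .op .add 13 10 37, .op .add 14 33 37, .jump 55,
   .op .add 13 13 10, .op .add 14 14 33, .jump 55]

/-- Computes the answer from the peaks; from position 93. -/
def averageCode : Program :=
  [.op .mul 13 13 31, .op .div 0 13 14, .op .add 1 21 37, .jumpLt 32 0 98, .halt,
   .op .add 0 32 37, .halt]

/-- The program that answers queries. -/
def accessProgram : Program := preludeCode ++ searchCode ++ columnsCode ++ averageCode

/-- The header of an image. -/
structure Header where
  /-- the size of the dictionary -/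
  size : ℕ
  /-- the common denominator of the answers -/
  den : ℕ
  /-- the number of columns -/
  cols : ℕ
  /-- the modulus of the hash functions -/
  prime : ℕ
  /-- the number of rows -/
  rows : ℕ
  /-- the address of the hash functions -/
  hashBase : ℕ
  /-- the number of hash functions in a word -/
  perWord : ℕ
  /-- the number of bits of a hash function -/
  width : ℕ
  /-- the address of the bit array -/
  bitBase : ℕ
  /-- the word length -/
  wordLength : ℕ
  /-- the scaled weight of a column -/
  weight : ℕ
  /-- the scaled upper bound -/
  bound : ℕ

/-- The registers that stay constant after the prelude. -/
structure Header.Loaded (c : Header) (i : ℕ) (ρ : ℕ → ℕ) : Prop where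
  r0 : ρ 0 = i
  r20 : ρ 20 = c.size
  r21 : ρ 21 = c.den
  r22 : ρ 22 = c.cols
  r23 : ρ 23 = c.prime
  r24 : ρ 24 = c.rows
  r25 : ρ 25 = c.hashBase
  r26 : ρ 26 = c.perWord
  r27 : ρ 27 = c.width
  r28 : ρ 28 = 2 ^ c.width
  r29 : ρ 29 = c.bitBase
  r30 : ρ 30 = c.wordLength
  r31 : ρ 31 = c.weight
  r32 : ρ 32 = c.bound
  r33 : ρ 33 = 1
  r34 : ρ 34 = 2
  r35 : ρ 35 = 16
  r36 : ρ 36 = 15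
  r37 : ρ 37 = 0

/-- The header occupies the first words of the memory `M`. -/
structure Header.Stored (c : Header) (M : ℕ → ℕ) : Prop where
  m0 : M 0 = c.size
  m1 : M 1 = c.den
  m2 : M 2 = c.cols
  m3 : M 3 = c.prime
  m4 : M 4 = c.rows
  m5 : M 5 = c.hashBase
  m6 : M 6 = c.perWord
  m7 : M 7 = c.width
  m8 : M 8 = 2 ^ c.width
  m9 : M 9 = c.bitBase
  m10 : M 10 = c.wordLength
  m11 : M 11 = c.weight
  m12 : M 12 = c.bound

/-- All numbers that occur in a query fit into words. -/
structure Header.Fits (c : Header) (w : ℕ) : Prop where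
  search : 2 * c.size + 16 < 2 ^ w
  den : c.den < 2 ^ w
  hash : c.hashBase + c.cols < 2 ^ w
  field : c.perWord * c.width < 2 ^ w
  prime : c.prime * c.prime + c.prime < 2 ^ w
  bits : c.bitBase + c.rows * c.cols + c.cols < 2 ^ w
  cols : 2 * c.cols + 2 < 2 ^ w
  sum : (c.cols + 1) * (c.cols + 1) * (c.weight + 1) < 2 ^ w
  bound : c.bound < 2 ^ w

theorem Header.Loaded.runBlock {c : Header} {i : ℕ} {ρ : ℕ → ℕ} {M : ℕ → ℕ} {L : Program}
    (h : c.Loaded i ρ) (hL : ∀ r, r = 0 ∨ 20 ≤ r → ∀ ins ∈ L, ins.Keeps r) :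
    c.Loaded i (runBlock M L ρ) := by
  have key : ∀ r, r = 0 ∨ 20 ≤ r → WordRAM.runBlock M L ρ r = ρ r :=
    fun r hr => runBlock_of_keeps (hL r hr)
  constructor <;> rw [key _ (by norm_num)]
  exacts [h.r0, h.r20, h.r21, h.r22, h.r23, h.r24, h.r25, h.r26, h.r27, h.r28, h.r29, h.r30,
    h.r31, h.r32, h.r33, h.r34, h.r35, h.r36, h.r37]

/-! ### Prelude, binary search, dictionary lookup and bookkeeping of maximizers. -/

section

variable {w : ℕ} {mem : BitVec w → BitVec w} {M : ℕ → ℕ} {c : Header} {i num den T : ℕ}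

theorem halts_prelude (hM : ∀ a, (mem a).toNat = M a.toNat) (hc : c.Stored M) (hw : 4 < w)
    (hf : c.Fits w)
    (h : ∀ ρ, c.Loaded i ρ → ρ 2 = 0 → ρ 3 = c.size →
      Halts accessProgram mem num den 33 ρ T) {ρ : ℕ → ℕ} (h0 : ρ 0 = i) :
    Halts accessProgram mem num den 0 ρ (T + 33) := by
  -- The largest constant in the program text is `16`, which needs five bits.
  have h16 : 2 ^ 5 ≤ 2 ^ w := Nat.pow_le_pow_right (by norm_num) hw
  refine Halts.block hM (L := preludeCode) rfl rfl ?_ (h _ ?_ ?_ ?_)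
  · have := hf.search
    simp only [preludeCode, SafeBlock, Instr.Safe, Instr.run, BinOp.NoOverflow, Function.update]
    simp [hc.m0]
    omega
  · constructor <;> simp [preludeCode, runBlock, Instr.run, BinOp.natEval, h0, hc.m0, hc.m1, hc.m2,
      hc.m3, hc.m4, hc.m5, hc.m6, hc.m7, hc.m8, hc.m9, hc.m10, hc.m11, hc.m12]
  · simp [preludeCode, runBlock, Instr.run]
  · simp [preludeCode, runBlock, Instr.run, BinOp.natEval, hc.m0]

/-- Invariant of the binary search: register `2` is a lower bound for the rank `cnt`, and `cnt` lies
in the window of length register `3`, a power of two. The probe reads the last key of the lower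
half, hence the offset `15` instead of `16`. A round costs at most `8` steps. -/
theorem halts_search (hM : ∀ a, (mem a).toNat = M a.toNat) (hf : c.Fits w) {key : ℕ → ℕ}
    {cnt : ℕ} (hkey : ∀ n < c.size, M (16 + n) = key n) (hcnt : ∀ n, key n < i ↔ n < cnt)
    (h : ∀ ρ, c.Loaded i ρ → ρ 2 = cnt → Halts accessProgram mem num den 42 ρ T) :
    ∀ (j : ℕ) (ρ : ℕ → ℕ), c.Loaded i ρ → ρ 3 = 2 ^ j → ρ 2 ≤ cnt → cnt < ρ 2 + 2 ^ j →
      ρ 2 + 2 ^ j ≤ c.size → Halts accessProgram mem num den 33 ρ (T + 8 * j + 1) := by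
  intro j
  induction j with
  | zero =>
    intro ρ hρ h3 h2 h2' _
    refine Halts.jumpEq (r := 3) (r' := 33) (target := 42) rfl (fun _ => ?_) fun hne => ?_
    · exact h ρ hρ (by rw [pow_zero] at h2'; omega)
    · exact absurd (by rw [h3, hρ.r33, pow_zero]) hne
  | succ j ih =>
    intro ρ hρ h3 h2 h2' hS
    have hs := hf.search
    have hpos : 0 < 2 ^ j := by positivity
    have hpow : 2 ^ (j + 1) = 2 * 2 ^ j := by rw [pow_succ, mul_comm]
    have hstep : T + 8 * (j + 1) + 1 = (T + 8 * j + 1 + 3 + 4) + 1 := by ring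
    rw [hstep]
    refine Halts.jumpEq (r := 3) (r' := 33) (target := 42) rfl (fun heq => ?_) fun _ => ?_
    · rw [h3, hρ.r33] at heq; omega
    set L : Program := [.op .shr 3 3 33, .op .add 4 2 3, .op .add 5 4 36, .load 5 5] with hL
    have hdiv : 2 ^ (j + 1) / 2 = 2 ^ j := by omega
    have hρ' : c.Loaded i (runBlock M L ρ) := hρ.runBlock (by
      intro r hr; simp only [hL, List.forall_mem_cons, Instr.Keeps]; simp; omega)
    have e2 : runBlock M L ρ 2 = ρ 2 := by simp [hL, runBlock, Instr.run]
    have e3 : runBlock M L ρ 3 = 2 ^ j := by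
      simp [hL, runBlock, Instr.run, BinOp.natEval, h3, hρ.r33, hdiv]
    have e4 : runBlock M L ρ 4 = ρ 2 + 2 ^ j := by
      simp [hL, runBlock, Instr.run, BinOp.natEval, h3, hρ.r33, hdiv]
    have e5 : runBlock M L ρ 5 = key (ρ 2 + 2 ^ j - 1) := by
      rw [← hkey _ (by omega)]
      simp only [hL, runBlock, Instr.run, BinOp.natEval, Function.update]
      simp only [h3, hρ.r33, hρ.r36]
      simp [hdiv]
      congr 1
      omega
    refine Halts.block (T := T + 8 * j + 1 + 3) (n := 4) hM (L := L) rfl rfl ?_ ?_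
    · simp only [hL, SafeBlock, Instr.Safe, Instr.run, BinOp.natEval, BinOp.NoOverflow,
        Function.update]
      simp [h3, hρ.r33, hρ.r36, hdiv]
      omega
    generalize runBlock M L ρ = ρ' at hρ' e2 e3 e4 e5
    refine Halts.jumpLt (T := T + 8 * j + 1 + 2) (r := 5) (r' := 0) (target := 40) rfl
      (fun hlt => ?_) fun hlt => ?_
    · rw [e5, hρ'.r0, hcnt] at hlt
      refine Halts.block (T := T + 8 * j + 1 + 1) hM (L := [.op .add 2 4 37]) (n := 1) rfl rfl
        ?_ ?_
      · simp [SafeBlock, Instr.Safe, BinOp.NoOverflow, e4, hρ'.r37]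
        omega
      · refine Halts.jump (target := 33) rfl (ih _ ?_ ?_ ?_ ?_ ?_)
        · exact hρ'.runBlock (by intro r hr; simp [Instr.Keeps]; omega)
        all_goals simp [runBlock, Instr.run, BinOp.natEval, e3, e4, hρ'.r37]
        all_goals omega
    · rw [e5, hρ'.r0, hcnt] at hlt
      refine (Halts.jump (T := T + 8 * j + 1) (target := 33) rfl (ih _ hρ' ?_ ?_ ?_ ?_)).mono
        (by omega)
      all_goals omega

theorem halts_lookup (hM : ∀ a, (mem a).toNat = M a.toNat) (hf : c.Fits w) {key : ℕ → ℕ}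
    {cnt : ℕ} (hkey : ∀ n < c.size, M (16 + n) = key n) (hcnt : cnt < c.size) {num' : ℕ}
    (hfound : key cnt = i → M (16 + c.size + cnt) = num)
    (hnot : key cnt ≠ i → num' = num)
    (h : ∀ ρ, c.Loaded i ρ → Halts accessProgram mem num' c.den 50 ρ T)
    {ρ : ℕ → ℕ} (hρ : c.Loaded i ρ) (h2 : ρ 2 = cnt) :
    Halts accessProgram mem num c.den 42 ρ (T + 7) := by
  have hs := hf.search
  have hd := hf.den
  set L : Program := [.op .add 4 2 35, .load 5 4] with hL
  have hρ' : c.Loaded i (runBlock M L ρ) := hρ.runBlock (by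
    intro r hr; simp [hL, Instr.Keeps]; omega)
  have e4 : runBlock M L ρ 4 = 16 + cnt := by
    simp [hL, runBlock, Instr.run, BinOp.natEval, h2, hρ.r35, add_comm]
  have e5 : runBlock M L ρ 5 = key cnt := by
    rw [← hkey _ hcnt]
    simp [hL, runBlock, Instr.run, BinOp.natEval, h2, hρ.r35, add_comm]
  refine Halts.block (T := T + 5) hM (L := L) (n := 2) rfl rfl ?_ ?_
  · simp [hL, SafeBlock, Instr.Safe, BinOp.NoOverflow, h2, hρ.r35]
    omega
  generalize runBlock M L ρ = ρ' at hρ' e4 e5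
  refine Halts.jumpEq (T := T + 4) (r := 5) (r' := 0) (target := 46) rfl (fun heq => ?_)
    fun hne => ?_
  · rw [e5, hρ'.r0] at heq
    set L' : Program := [.op .add 4 4 20, .load 0 4, .op .add 1 21 37] with hL'
    refine (Halts.block (T := 0) hM (L := L') (n := 3) rfl rfl ?_ ?_).mono (by omega)
    · simp [hL', SafeBlock, Instr.Safe, Instr.run, BinOp.NoOverflow, BinOp.natEval, e4, hρ'.r20,
        hρ'.r21, hρ'.r37]
      omega
    · have a0 : num = runBlock M L' ρ' 0 := by
        rw [← hfound heq]
        simp [hL', runBlock, Instr.run, BinOp.natEval, e4, hρ'.r20]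
        congr 1; omega
      have a1 : c.den = runBlock M L' ρ' 1 := by
        simp [hL', runBlock, Instr.run, BinOp.natEval, hρ'.r21, hρ'.r37]
      rw [a0, a1]
      exact Halts.halt rfl
  · rw [e5, hρ'.r0] at hne
    rw [← hnot hne]
    exact (Halts.jump (target := 50) rfl (h _ hρ')).mono (by omega)

/-- The partial sums, shifted by the number `m` of columns. -/
def walk (m : ℕ) (bit : ℕ → Bool) : ℕ → ℕ
  | 0 => m
  | b + 1 => if bit b then walk m bit b + 1 else walk m bit b - 1

theorem walk_bounds (m : ℕ) (bit : ℕ → Bool) (b : ℕ) :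
    m ≤ walk m bit b + b ∧ walk m bit b ≤ m + b := by
  induction b with
  | zero => simp [walk]
  | succ b ih => rw [walk]; split_ifs <;> omega

/-- The maximizers of the first `b` partial sums have the maximum `v`, the sum `t` and number
`n`. -/
structure PeakData (f : ℕ → ℕ) (b v t n : ℕ) : Prop where
  le : ∀ a ≤ b, f a ≤ v
  mem : ∃ a ≤ b, f a = v
  sum : t = ∑ a ∈ (Finset.range (b + 1)).filter (fun a => f a = v), a
  card : n = ((Finset.range (b + 1)).filter fun a => f a = v).card

theorem PeakData.zero (f : ℕ → ℕ) : PeakData f 0 (f 0) 0 1 := by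
  refine ⟨fun a ha => ?_, ⟨0, le_rfl, rfl⟩, ?_, ?_⟩
  · rw [Nat.le_zero.1 ha]
  · simp [Finset.sum_filter]
  · simp [Finset.filter_singleton]

theorem PeakData.succ_of_lt {f : ℕ → ℕ} {b v t n : ℕ} (h : PeakData f b v t n)
    (hlt : f (b + 1) < v) : PeakData f (b + 1) v t n := by
  refine ⟨fun a ha => ?_, ?_, ?_, ?_⟩
  · rcases Nat.le_succ_iff.1 ha with h' | rfl
    exacts [h.le a h', hlt.le]
  · obtain ⟨a, ha, h'⟩ := h.mem
    exact ⟨a, by omega, h'⟩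
  · rw [Finset.range_add_one, Finset.filter_insert, if_neg hlt.ne, h.sum]
  · rw [Finset.range_add_one, Finset.filter_insert, if_neg hlt.ne, h.card]

theorem PeakData.succ_of_eq {f : ℕ → ℕ} {b v t n : ℕ} (h : PeakData f b v t n)
    (heq : f (b + 1) = v) : PeakData f (b + 1) v (t + (b + 1)) (n + 1) := by
  have hnm : b + 1 ∉ (Finset.range (b + 1)).filter fun a => f a = v := by simp
  refine ⟨fun a ha => ?_, ⟨b + 1, le_rfl, heq⟩, ?_, ?_⟩
  · rcases Nat.le_succ_iff.1 ha with h' | rfl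
    exacts [h.le a h', heq.le]
  · rw [Finset.range_add_one, Finset.filter_insert, if_pos heq, Finset.sum_insert hnm, h.sum,
      add_comm]
  · rw [Finset.range_add_one, Finset.filter_insert, if_pos heq, Finset.card_insert_of_notMem hnm,
      h.card]

theorem PeakData.succ_of_gt {f : ℕ → ℕ} {b v t n : ℕ} (h : PeakData f b v t n)
    (hgt : v < f (b + 1)) : PeakData f (b + 1) (f (b + 1)) (b + 1) 1 := by
  have he : ((Finset.range (b + 1 + 1)).filter fun a => f a = f (b + 1)) = {b + 1} := by
    ext a
    simp only [Finset.mem_filter, Finset.mem_range, Finset.mem_singleton]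
    constructor
    · rintro ⟨ha, ha'⟩
      by_contra hne
      have := h.le a (by omega)
      omega
    · rintro rfl
      exact ⟨by omega, rfl⟩
  refine ⟨fun a ha => ?_, ⟨b + 1, le_rfl, rfl⟩, ?_, ?_⟩
  · rcases Nat.le_succ_iff.1 ha with h' | rfl
    exacts [(h.le a h').trans hgt.le, le_rfl]
  · rw [he, Finset.sum_singleton]
  · rw [he, Finset.card_singleton]

theorem PeakData.filter_eq {f : ℕ → ℕ} {b v t n : ℕ} (h : PeakData f b v t n) :
    ((Finset.range (b + 1)).filter fun a => f a = v) =
      (Finset.range (b + 1)).filter fun a => ∀ a' ≤ b, f a' ≤ f a := by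
  refine Finset.filter_congr fun a ha => ?_
  rw [Finset.mem_range] at ha
  constructor
  · rintro rfl; exact h.le
  · intro h'
    obtain ⟨a', ha', e⟩ := h.mem
    have h1 := h' a' ha'
    have h2 := h.le a (by omega)
    omega

theorem PeakData.bounds {f : ℕ → ℕ} {b v t n : ℕ} (h : PeakData f b v t n) :
    t ≤ (b + 1) * b ∧ n ≤ b + 1 := by
  have h2 : n ≤ b + 1 := by
    rw [h.card]
    exact (Finset.card_filter_le _ _).trans (by simp)
  refine ⟨?_, h2⟩
  rw [h.sum]
  refine (Finset.sum_le_card_nsmul _ _ b fun a ha => ?_).trans ?_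
  · have := Finset.mem_range.1 (Finset.mem_filter.1 ha).1
    omega
  · rw [← h.card, smul_eq_mul]
    exact Nat.mul_le_mul_right _ h2

end

end WordRAM

namespace WordRAM

/-! ### The pass over the columns and the complete query. -/

section

variable {w : ℕ} {mem : BitVec w → BitVec w} {M : ℕ → ℕ} {c : Header} {i num T : ℕ}

theorem Header.Fits.length_ne_zero (hf : c.Fits w) : w ≠ 0 := by
  rintro rfl
  have := hf.cols
  omega

/-- The hash functions and the bit array occupy the memory `M`: `code b` is the code of the hash
function of column `b`, and `bit b` is the bit that the query for `i` reads in column `b`. -/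
structure Header.Columns (c : Header) (M : ℕ → ℕ) (i : ℕ) (code : ℕ → ℕ) (bit : ℕ → Bool) :
    Prop where
  code_eq : ∀ b < c.cols, M (c.hashBase + b / c.perWord) /
    2 ^ (b % c.perWord * c.width) % 2 ^ c.width = code b
  code_lt : ∀ b < c.cols, code b / c.prime + 1 ≤ c.prime
  bit_eq : ∀ b < c.cols,
    M (c.bitBase + (affineHash c.prime c.rows (code b) i * c.cols + b) / c.wordLength) /
      2 ^ ((affineHash c.prime c.rows (code b) i * c.cols + b) % c.wordLength) % 2 =
        if bit b then 1 else 0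

theorem halts_row (hM : ∀ a, (mem a).toNat = M a.toNat) (hf : c.Fits w) {code : ℕ → ℕ}
    {bit : ℕ → Bool} (hcol : c.Columns M i code bit) (hi : i < c.prime) (hg : 0 < c.perWord)
    {den : ℕ} {ρ : ℕ → ℕ} {b : ℕ} (hb : b < c.cols) (hρ : c.Loaded i ρ) (h10 : ρ 10 = b)
    (h : ∀ ρ', c.Loaded i ρ' → (∀ r, 10 ≤ r → r ≤ 14 → ρ' r = ρ r) →
      ρ' 5 = affineHash c.prime c.rows (code b) i →
      Halts accessProgram mem num den 70 ρ' T) :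
    Halts accessProgram mem num den 56 ρ (T + 14) := by
  set L₁ : Program := [.op .div 4 10 26, .op .add 4 4 25, .load 4 4, .op .mod 5 10 26,
    .op .mul 5 5 27, .op .shr 4 4 5, .op .mod 4 4 28] with hL₁
  set L₂ : Program := [.op .div 5 4 23, .op .add 5 5 33, .op .mul 5 5 0, .op .mod 4 4 23,
    .op .add 5 5 4, .op .mod 5 5 23, .op .mod 5 5 24] with hL₂
  have hh := hf.hash
  have hfi := hf.field
  have hpr := hf.prime
  have hdiv : b / c.perWord ≤ b := Nat.div_le_self _ _
  have hmod : b % c.perWord * c.width ≤ c.perWord * c.width :=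
    Nat.mul_le_mul_right _ (Nat.mod_lt _ hg).le
  have hk : ∀ r, r = 0 ∨ 6 ≤ r → ∀ ins ∈ L₁, ins.Keeps r := by
    intro r hr; simp only [hL₁, List.forall_mem_cons, Instr.Keeps]; simp; omega
  have hk₂ : ∀ r, r = 0 ∨ 6 ≤ r → ∀ ins ∈ L₂, ins.Keeps r := by
    intro r hr; simp only [hL₂, List.forall_mem_cons, Instr.Keeps]; simp; omega
  have hρ₁ : c.Loaded i (runBlock M L₁ ρ) := hρ.runBlock fun r hr => hk r (by omega)
  have k₁ : ∀ r, 10 ≤ r → r ≤ 14 → runBlock M L₁ ρ r = ρ r :=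
    fun r hr _ => runBlock_of_keeps (hk r (by omega))
  have e4 : runBlock M L₁ ρ 4 = code b := by
    rw [← hcol.code_eq b hb]
    simp [hL₁, runBlock, Instr.run, BinOp.natEval, h10, hρ.r25, hρ.r26, hρ.r27, hρ.r28, add_comm]
  refine Halts.block (T := T + 7) (n := 7) hM (L := L₁) rfl rfl ?_ ?_
  · simp [hL₁, SafeBlock, Instr.Safe, Instr.run, BinOp.NoOverflow, BinOp.natEval, h10, hρ.r25,
      hρ.r26, hρ.r27]
    omega
  generalize runBlock M L₁ ρ = ρ₁ at hρ₁ e4 k₁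
  have hp0 : 0 < c.prime := by omega
  have ha : (code b / c.prime + 1) * i ≤ c.prime * c.prime :=
    Nat.mul_le_mul (hcol.code_lt b hb) hi.le
  have hm : code b % c.prime < c.prime := Nat.mod_lt _ hp0
  have h1 : code b / c.prime + 1 ≤ c.prime := hcol.code_lt b hb
  refine Halts.block (n := 7) hM (L := L₂) rfl rfl ?_ (h _ ?_ ?_ ?_)
  · simp [hL₂, SafeBlock, Instr.Safe, Instr.run, BinOp.NoOverflow, BinOp.natEval, e4, hρ₁.r0,
      hρ₁.r23, hρ₁.r33]
    omega
  · exact hρ₁.runBlock fun r hr => hk₂ r (by omega)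
  · exact fun r hr hr' => (runBlock_of_keeps (hk₂ r (by omega))).trans (k₁ r hr hr')
  · simp [hL₂, runBlock, Instr.run, BinOp.natEval, e4, hρ₁.r0, hρ₁.r23, hρ₁.r24, hρ₁.r33,
      affineHash]

/-- The array is stored row by row. The same block advances the column counter, because the partial
sum that includes column `b` has number `b + 1`. -/
theorem halts_bit (hM : ∀ a, (mem a).toNat = M a.toNat) (hf : c.Fits w) {code : ℕ → ℕ}
    {bit : ℕ → Bool} (hcol : c.Columns M i code bit) (hs : 0 < c.rows)
    {den : ℕ} {ρ : ℕ → ℕ} {b : ℕ} (hb : b < c.cols) (hρ : c.Loaded i ρ) (h10 : ρ 10 = b)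
    (h5 : ρ 5 = affineHash c.prime c.rows (code b) i)
    (h : ∀ ρ', c.Loaded i ρ' → (∀ r, 11 ≤ r → r ≤ 14 → ρ' r = ρ r) → ρ' 10 = b + 1 →
      (ρ' 4 = if bit b then 1 else 0) → Halts accessProgram mem num den 79 ρ' T) :
    Halts accessProgram mem num den 70 ρ (T + 9) := by
  set L : Program := [.op .mul 5 5 22, .op .add 5 5 10, .op .div 4 5 30, .op .add 4 4 29,
    .load 4 4, .op .mod 5 5 30, .op .shr 4 4 5, .op .mod 4 4 34, .op .add 10 10 33] with hL
  have hk : ∀ r, r = 0 ∨ 11 ≤ r → ∀ ins ∈ L, ins.Keeps r := by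
    intro r hr; simp only [hL, List.forall_mem_cons, Instr.Keeps]; simp; omega
  have hbi := hf.bits
  have hco := hf.cols
  set row := affineHash c.prime c.rows (code b) i with hrow
  have hr : row * c.cols ≤ c.rows * c.cols := Nat.mul_le_mul_right _ (Nat.mod_lt _ hs).le
  have hd : (row * c.cols + b) / c.wordLength ≤ row * c.cols + b := Nat.div_le_self _ _
  refine Halts.block (n := 9) hM (L := L) rfl rfl ?_ (h _ ?_ ?_ ?_ ?_)
  · simp [hL, SafeBlock, Instr.Safe, Instr.run, BinOp.NoOverflow, BinOp.natEval, h5, h10, hρ.r22,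
      hρ.r30, hρ.r29, hρ.r33]
    omega
  · exact hρ.runBlock fun r hr => hk r (by omega)
  · exact fun r hr _ => runBlock_of_keeps (hk r (by omega))
  · simp [hL, runBlock, Instr.run, BinOp.natEval, h10, hρ.r33]
  · rw [← hcol.bit_eq b hb]
    simp [hL, runBlock, Instr.run, BinOp.natEval, h5, h10, hρ.r22, hρ.r29, hρ.r30, hρ.r34, hrow,
      add_comm]

/-- The numerator of the estimate that is computed from the peaks of a walk. -/
def walkEstimate (c : Header) (bit : ℕ → Bool) : ℕ :=
  min c.bound ((∑ a ∈ (Finset.range (c.cols + 1)).filter (fun a => ∀ a' ≤ c.cols,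
      walk c.cols bit a' ≤ walk c.cols bit a), a) * c.weight /
    ((Finset.range (c.cols + 1)).filter fun a => ∀ a' ≤ c.cols,
      walk c.cols bit a' ≤ walk c.cols bit a).card)

theorem halts_average (hM : ∀ a, (mem a).toNat = M a.toNat) (hf : c.Fits w) {bit : ℕ → Bool}
    {ρ : ℕ → ℕ} (hρ : c.Loaded i ρ)
    (hpk : PeakData (walk c.cols bit) c.cols (ρ 12) (ρ 13) (ρ 14)) :
    Halts accessProgram mem (walkEstimate c bit) c.den 93 ρ 5 := by
  set L : Program := [.op .mul 13 13 31, .op .div 0 13 14, .op .add 1 21 37] with hL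
  have hb := hpk.bounds.1
  have hsum := hf.sum
  have hden := hf.den
  have hbound := hf.bound
  have h1 : ρ 13 * c.weight ≤ (c.cols + 1) * (c.cols + 1) * (c.weight + 1) :=
    Nat.mul_le_mul (hb.trans (Nat.mul_le_mul_left _ (by omega))) (by omega)
  have hest : walkEstimate c bit = min c.bound (ρ 13 * c.weight / ρ 14) := by
    rw [walkEstimate, ← hpk.filter_eq, ← hpk.sum, ← hpk.card]
  have e0 : runBlock M L ρ 0 = ρ 13 * c.weight / ρ 14 := by
    simp [hL, runBlock, Instr.run, BinOp.natEval, hρ.r31]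
  have e1 : runBlock M L ρ 1 = c.den := by
    simp [hL, runBlock, Instr.run, BinOp.natEval, hρ.r21, hρ.r37]
  have e32 : runBlock M L ρ 32 = c.bound := by
    simp [hL, runBlock, Instr.run, hρ.r32]
  have e37 : runBlock M L ρ 37 = 0 := by
    simp [hL, runBlock, Instr.run, hρ.r37]
  refine Halts.block (T := 2) (n := 3) hM (L := L) rfl rfl ?_ ?_
  · simp [hL, SafeBlock, Instr.Safe, Instr.run, BinOp.NoOverflow, BinOp.natEval, hρ.r21, hρ.r31,
      hρ.r37]
    omega
  generalize runBlock M L ρ = ρ' at e0 e1 e32 e37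
  rw [hest, ← e0, ← e1, ← e32]
  refine Halts.jumpLt (r := 32) (r' := 0) (target := 98) rfl (fun hlt => ?_) fun hlt => ?_
  · rw [min_eq_left hlt.le]
    refine Halts.block (T := 0) (n := 1) hM (L := [.op .add 0 32 37]) rfl rfl ?_ ?_
    · simp [SafeBlock, Instr.Safe, BinOp.NoOverflow, e32, e37, hbound]
    · have a0 : ρ' 32 = runBlock M [.op .add 0 32 37] ρ' 0 := by
        simp [runBlock, Instr.run, BinOp.natEval, e37]
      have a1 : ρ' 1 = runBlock M [.op .add 0 32 37] ρ' 1 := by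
        simp [runBlock, Instr.run]
      rw [a0, a1]
      exact Halts.halt rfl
  · rw [min_eq_right (not_lt.1 hlt)]
    exact (Halts.halt rfl).mono (by omega)

/-- The registers of the loop over the columns before column `b`. -/
structure Header.AtColumn (c : Header) (i : ℕ) (bit : ℕ → Bool) (b : ℕ) (ρ : ℕ → ℕ) : Prop where
  loaded : c.Loaded i ρ
  r10 : ρ 10 = b
  r11 : ρ 11 = walk c.cols bit b
  peaks : PeakData (walk c.cols bit) b (ρ 12) (ρ 13) (ρ 14)

/-- A step down stays below the current maximum and needs no comparison. After a step up there are
three cases: a new maximum restarts the sum and the count, a tie extends them, and a smaller value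
changes nothing. -/
theorem halts_update (hM : ∀ a, (mem a).toNat = M a.toNat) (hf : c.Fits w) {bit : ℕ → Bool}
    {den : ℕ} {ρ : ℕ → ℕ} {b : ℕ} (hb : b < c.cols) (hρ : c.Loaded i ρ) (h10 : ρ 10 = b + 1)
    (h11 : ρ 11 = walk c.cols bit b) (hpk : PeakData (walk c.cols bit) b (ρ 12) (ρ 13) (ρ 14))
    (h4 : ρ 4 = if bit b then 1 else 0)
    (h : ∀ ρ', c.AtColumn i bit (b + 1) ρ' → Halts accessProgram mem num den 55 ρ' T) :
    Halts accessProgram mem num den 79 ρ (T + 8) := by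
  have hco := hf.cols
  have hwb := walk_bounds c.cols bit b
  have hbd := hpk.bounds
  refine Halts.jumpEq (T := T + 7) (r := 4) (r' := 33) (target := 82) rfl (fun heq => ?_)
    fun hne => ?_
  · have hbit : bit b = true := by
      by_contra hn
      rw [h4, hρ.r33, if_neg hn] at heq
      omega
    have hwk : walk c.cols bit (b + 1) = walk c.cols bit b + 1 := by rw [walk, if_pos hbit]
    set L : Program := [.op .add 11 11 33] with hL
    have hk : ∀ r, r ≠ 11 → ∀ ins ∈ L, ins.Keeps r := by
      intro r hr; simp [hL, Instr.Keeps, hr]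
    have hρ' : c.Loaded i (runBlock M L ρ) := hρ.runBlock fun r hr => hk r (by omega)
    have e11 : runBlock M L ρ 11 = walk c.cols bit (b + 1) := by
      simp [hL, runBlock, Instr.run, BinOp.natEval, h11, hρ.r33, hwk]
    have e10 := (runBlock_of_keeps (M := M) (ρ := ρ) (hk 10 (by omega))).trans h10
    rw [← runBlock_of_keeps (M := M) (ρ := ρ) (hk 12 (by omega)),
      ← runBlock_of_keeps (M := M) (ρ := ρ) (hk 13 (by omega)),
      ← runBlock_of_keeps (M := M) (ρ := ρ) (hk 14 (by omega))] at hpk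
    rw [← runBlock_of_keeps (M := M) (ρ := ρ) (hk 13 (by omega)),
      ← runBlock_of_keeps (M := M) (ρ := ρ) (hk 14 (by omega))] at hbd
    refine Halts.block (T := T + 6) (n := 1) hM (L := L) rfl rfl ?_ ?_
    · simp [hL, SafeBlock, Instr.Safe, BinOp.NoOverflow, h11, hρ.r33]
      omega
    generalize runBlock M L ρ = ρ' at hρ' e11 e10 hpk hbd
    refine Halts.jumpLt (T := T + 5) (r := 12) (r' := 11) (target := 86) rfl (fun hlt => ?_)
      fun hnlt => ?_
    · set L' : Program := [.op .add 12 11 37, .op .add 13 10 37, .op .add 14 33 37] with hL'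
      refine (Halts.block (T := T + 1) (n := 3) hM (L := L') rfl rfl ?_
        (Halts.jump (target := 55) rfl (h _ ⟨?_, ?_, ?_, ?_⟩))).mono (by omega)
      · simp [hL', SafeBlock, Instr.Safe, Instr.run, BinOp.NoOverflow, e11, e10, hρ'.r33, hρ'.r37]
        rw [hwk]
        exact ⟨by omega, by omega, hf.length_ne_zero⟩
      · exact hρ'.runBlock fun r hr => by simp [hL', Instr.Keeps]; omega
      · simp [hL', runBlock, Instr.run, e10]
      · simp [hL', runBlock, Instr.run, e11]
      · rw [e11] at hlt
        simpa [hL', runBlock, Instr.run, BinOp.natEval, e11, e10, hρ'.r33, hρ'.r37] using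
          hpk.succ_of_gt hlt
    · refine Halts.jumpEq (T := T + 4) (r := 12) (r' := 11) (target := 90) rfl (fun heq => ?_)
        fun hne => ?_
      · set L' : Program := [.op .add 13 13 10, .op .add 14 14 33] with hL'
        have hsum := hf.sum
        have hsq : (b + 1) * b + (b + 1) ≤ (c.cols + 1) * (c.cols + 1) * (c.weight + 1) := by
          calc (b + 1) * b + (b + 1) = (b + 1) * (b + 1) := by ring
            _ ≤ (c.cols + 1) * (c.cols + 1) := Nat.mul_le_mul (by omega) (by omega)
            _ ≤ _ := Nat.le_mul_of_pos_right _ (by omega)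
        refine (Halts.block (T := T + 1) (n := 2) hM (L := L') rfl rfl ?_
          (Halts.jump (target := 55) rfl (h _ ⟨?_, ?_, ?_, ?_⟩))).mono (by omega)
        · simp [hL', SafeBlock, Instr.Safe, Instr.run, BinOp.NoOverflow, e10, hρ'.r33]
          omega
        · exact hρ'.runBlock fun r hr => by simp [hL', Instr.Keeps]; omega
        · simp [hL', runBlock, Instr.run, e10]
        · simp [hL', runBlock, Instr.run, e11]
        · rw [e11] at heq
          simpa [hL', runBlock, Instr.run, BinOp.natEval, e10, hρ'.r33] using
            hpk.succ_of_eq heq.symm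
      · rw [e11] at hnlt hne
        exact (Halts.jump (target := 55) rfl
          (h _ ⟨hρ', e10, e11, hpk.succ_of_lt (by omega)⟩)).mono (by omega)
  · have hbit : bit b = false := by
      by_contra hn
      rw [Bool.not_eq_false] at hn
      rw [h4, hρ.r33, if_pos hn] at hne
      exact hne rfl
    have hwk : walk c.cols bit (b + 1) = walk c.cols bit b - 1 := by
      rw [walk, if_neg (by simp [hbit])]
    set L : Program := [.op .sub 11 11 33] with hL
    refine (Halts.block (T := T + 1) (n := 1) hM (L := L) rfl rfl ?_
      (Halts.jump (target := 55) rfl (h _ ⟨?_, ?_, ?_, ?_⟩))).mono (by omega)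
    · simp [hL, SafeBlock, Instr.Safe, BinOp.NoOverflow, h11, hρ.r33]
      omega
    · exact hρ.runBlock fun r hr => by simp [hL, Instr.Keeps]; omega
    · simp [hL, runBlock, Instr.run, h10]
    · simp [hL, runBlock, Instr.run, BinOp.natEval, h11, hρ.r33, hwk]
    · have := hpk.le b le_rfl
      simpa [hL, runBlock, Instr.run] using hpk.succ_of_lt (by omega)

theorem halts_loop (hM : ∀ a, (mem a).toNat = M a.toNat) (hf : c.Fits w) {code : ℕ → ℕ}
    {bit : ℕ → Bool} (hcol : c.Columns M i code bit) (hi : i < c.prime) (hg : 0 < c.perWord)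
    (hs : 0 < c.rows) :
    ∀ (n b : ℕ) (ρ : ℕ → ℕ), b + n = c.cols → c.AtColumn i bit b ρ →
      Halts accessProgram mem (walkEstimate c bit) c.den 55 ρ (6 + 32 * n) := by
  intro n
  induction n with
  | zero =>
    intro b ρ hb h
    refine Halts.jumpEq (T := 5) (r := 10) (r' := 22) (target := 93) rfl (fun _ => ?_)
      fun hne => ?_
    · refine halts_average hM hf h.loaded ?_
      have := h.peaks
      rwa [show b = c.cols by omega] at this
    · rw [h.r10, h.loaded.r22] at hne
      omega
  | succ n ih =>
    intro b ρ hb h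
    have hlt : b < c.cols := by omega
    -- A round consists of one test, `14` steps to find the row, `9` to read the bit and at most `8`
    -- to update the maximizers.
    have hstep : 6 + 32 * (n + 1) = (6 + 32 * n + 8 + 9 + 14) + 1 := by ring
    rw [hstep]
    refine Halts.jumpEq (r := 10) (r' := 22) (target := 93) rfl (fun heq => ?_) fun _ => ?_
    · rw [h.r10, h.loaded.r22] at heq
      omega
    refine halts_row hM hf hcol hi hg hlt h.loaded h.r10 fun ρ₁ hρ₁ k₁ e5 => ?_
    have e10 : ρ₁ 10 = b := (k₁ 10 (by omega) (by omega)).trans h.r10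
    refine halts_bit hM hf hcol hs hlt hρ₁ e10 e5 fun ρ₂ hρ₂ k₂ e10' e4 => ?_
    have k : ∀ r, 11 ≤ r → r ≤ 14 → ρ₂ r = ρ r := fun r hr hr' =>
      (k₂ r hr hr').trans (k₁ r (by omega) hr')
    refine halts_update hM hf hlt hρ₂ e10' ?_ ?_ e4 fun ρ₃ h₃ => ih _ _ (by omega) h₃
    · rw [k 11 (by omega) (by omega), h.r11]
    · rw [k 12 (by omega) (by omega), k 13 (by omega) (by omega), k 14 (by omega) (by omega)]
      exact h.peaks

theorem halts_columns (hM : ∀ a, (mem a).toNat = M a.toNat) (hf : c.Fits w) {code : ℕ → ℕ}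
    {bit : ℕ → Bool} (hcol : c.Columns M i code bit) (hi : i < c.prime) (hg : 0 < c.perWord)
    (hs : 0 < c.rows) {ρ : ℕ → ℕ} (hρ : c.Loaded i ρ) :
    Halts accessProgram mem (walkEstimate c bit) c.den 50 ρ (6 + 32 * c.cols + 5) := by
  set L : Program := [.op .add 10 37 37, .op .add 11 22 37, .op .add 12 22 37, .op .add 13 37 37,
    .op .add 14 33 37] with hL
  have hco := hf.cols
  refine Halts.block (n := 5) hM (L := L) rfl rfl ?_
    (halts_loop hM hf hcol hi hg hs c.cols 0 _ (by omega) ⟨?_, ?_, ?_, ?_⟩)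
  · simp [hL, SafeBlock, Instr.Safe, Instr.run, BinOp.NoOverflow, hρ.r22, hρ.r33, hρ.r37]
    exact ⟨by omega, hf.length_ne_zero⟩
  · exact hρ.runBlock fun r hr => by simp [hL, Instr.Keeps]; omega
  · simp [hL, runBlock, Instr.run, BinOp.natEval, hρ.r37]
  · simp [hL, runBlock, Instr.run, BinOp.natEval, hρ.r37, hρ.r22, walk]
  · simpa [hL, runBlock, Instr.run, BinOp.natEval, hρ.r37, hρ.r22, hρ.r33] using
      (by simpa only [walk] using PeakData.zero (walk c.cols bit) :
        PeakData (walk c.cols bit) 0 c.cols 0 1)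

/-- The access program answers queries on memories that store a sorted dictionary, hash functions
and a bit array. -/
theorem halts_accessProgram (hM : ∀ a, (mem a).toNat = M a.toNat) (hst : c.Stored M)
    (hw : 4 < w) (hf : c.Fits w) {J : ℕ} (hJ : c.size = 2 ^ J) {key : ℕ → ℕ} {cnt : ℕ}
    (hkey : ∀ n < c.size, M (16 + n) = key n) (hcnt : ∀ n, key n < i ↔ n < cnt)
    (hcs : cnt < c.size) {code : ℕ → ℕ} {bit : ℕ → Bool} (hcol : c.Columns M i code bit)
    (hi : i < c.prime) (hg : 0 < c.perWord) (hs : 0 < c.rows)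
    (hfound : key cnt = i → M (16 + c.size + cnt) = num)
    (hnot : key cnt ≠ i → walkEstimate c bit = num) {ρ : ℕ → ℕ} (h0 : ρ 0 = i) :
    Halts accessProgram mem num c.den 0 ρ (8 * J + 32 * c.cols + 52) := by
  -- The search starts with the whole dictionary as its window. The constant `52` collects `33`
  -- steps of the prelude, `1` of the search, `7` of the lookup and `11` around the loop.
  have := halts_prelude hM hst hw hf (fun ρ hρ h2 h3 =>
    halts_search hM hf hkey hcnt (fun ρ hρ h2 => halts_lookup hM hf hkey hcs hfound hnot
      (fun ρ hρ => halts_columns hM hf hcol hi hg hs hρ) hρ h2) J ρ hρ (by rw [h3, hJ])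
      (by rw [h2]; exact Nat.zero_le _) (by rw [h2, ← hJ]; omega) (by rw [h2, hJ]; omega)) h0
  exact this.mono (by omega)

end

end WordRAM

namespace WordRAM

/-! # Packed fields -/

/-- The number with the digits `f 0, …, f (n - 1)` in base `β`, lowest digit first. -/
def pack (β : ℕ) (f : ℕ → ℕ) : ℕ → ℕ
  | 0 => 0
  | n + 1 => f 0 + β * pack β (fun j => f (j + 1)) n

theorem pack_lt {β : ℕ} (n : ℕ) {f : ℕ → ℕ} (hf : ∀ j < n, f j < β) : pack β f n < β ^ n := by
  induction n generalizing f with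
  | zero => simp [pack]
  | succ n ih =>
    have h1 := hf 0 (by omega)
    have h2 : pack β (fun j => f (j + 1)) n + 1 ≤ β ^ n := ih fun j hj => hf _ (by omega)
    calc pack β f (n + 1) = f 0 + β * pack β (fun j => f (j + 1)) n := rfl
      _ < β * (pack β (fun j => f (j + 1)) n + 1) := by rw [mul_add]; omega
      _ ≤ β * β ^ n := Nat.mul_le_mul_left _ h2
      _ = β ^ (n + 1) := by ring

theorem pack_div_mod {β : ℕ} (n : ℕ) {f : ℕ → ℕ} (hf : ∀ j < n, f j < β) {j : ℕ} (hj : j < n) :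
    pack β f n / β ^ j % β = f j := by
  induction n generalizing f j with
  | zero => omega
  | succ n ih =>
    have h1 := hf 0 (by omega)
    cases j with
    | zero => simp [pack, Nat.mod_eq_of_lt h1]
    | succ j =>
      rw [pack, pow_succ', ← Nat.div_div_eq_div_mul, Nat.add_mul_div_left _ _ (by omega),
        Nat.div_eq_of_lt h1, zero_add]
      exact ih (fun j hj => hf _ (by omega)) (by omega)

/-! # Memory images -/

/-- The parts of an image follow each other, for words of `w` bits. -/
structure Header.Regular (c : Header) (w : ℕ) : Prop where
  hashBase : c.hashBase = 16 + 2 * c.size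
  bitBase : c.bitBase = c.hashBase + c.cols / c.perWord + 1
  wordLength : c.wordLength = w
  perWord : 0 < c.perWord
  field : c.perWord * c.width ≤ w
  width_pos : 0 < c.width
  width_lt : c.width < w
  rows : c.rows < 2 ^ w

theorem Header.Regular.lt_bitBase {c : Header} {w : ℕ} (h : c.Regular w) {n : ℕ}
    (hn : n ≤ c.cols / c.perWord) : c.hashBase + n < c.bitBase := by
  rw [h.bitBase]
  omega

/-- The first words of an image. -/
def Header.words (c : Header) : List ℕ :=
  [c.size, c.den, c.cols, c.prime, c.rows, c.hashBase, c.perWord, c.width, 2 ^ c.width,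
    c.bitBase, c.wordLength, c.weight, c.bound]

/-- The word at address `a` of an image. -/
def Header.word (c : Header) (key value code bits : ℕ → ℕ) (a : ℕ) : ℕ :=
  if a < 16 then c.words.getD a 0
  else if a < 16 + c.size then key (a - 16)
  else if a < c.hashBase then value (a - (16 + c.size))
  else if a < c.bitBase then
    pack (2 ^ c.width) (fun j => code (c.perWord * (a - c.hashBase) + j)) c.perWord
  else pack 2 (fun j => bits (c.wordLength * (a - c.bitBase) + j)) c.wordLength

/-- The number of words of an image. -/
def Header.length (c : Header) : ℕ := c.bitBase + c.rows * c.cols / c.wordLength + 1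

theorem Header.lt_length (c : Header) {n : ℕ} (hn : n ≤ c.rows * c.cols / c.wordLength) :
    c.bitBase + n < c.length := by
  rw [Header.length]
  omega

/-- The image with a given header and given contents. -/
def Header.image (c : Header) (w : ℕ) (key value code bits : ℕ → ℕ) : Image w :=
  (List.range c.length).map fun a => BitVec.ofNat w (c.word key value code bits a)

section

variable {w : ℕ} {c : Header} {key value code bits : ℕ → ℕ}

theorem Header.bits_image : (c.image w key value code bits).bits = c.length * w := by
  simp [Image.bits, Header.image]

theorem Header.word_lt (hc : c.Regular w) (hf : c.Fits w) (hw : 4 < w)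
    (hkey : ∀ n < c.size, key n < 2 ^ w)
    (hvalue : ∀ n < c.size, value n < 2 ^ w) (hcode : ∀ n, code n < 2 ^ c.width)
    (hbits : ∀ n, bits n < 2) (a : ℕ) : c.word key value code bits a < 2 ^ w := by
  have h16 : 2 ^ 5 ≤ 2 ^ w := Nat.pow_le_pow_right (by norm_num) hw
  rw [Header.word]
  split_ifs with h1 h2 h3 h4
  · have e1 := hf.search
    have e2 := hf.den
    have e3 := hf.hash
    have e4 := hf.prime
    have e5 := hf.bits
    have e6 := hf.cols
    have e7 := hf.sum
    have e8 := hf.bound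
    have e7' : c.weight + 1 ≤ (c.cols + 1) * (c.cols + 1) * (c.weight + 1) :=
      Nat.le_mul_of_pos_left _ (by positivity)
    have e9 : c.perWord ≤ w :=
      (Nat.le_mul_of_pos_right _ hc.width_pos).trans hc.field
    have e10 : 2 ^ c.width < 2 ^ w := Nat.pow_lt_pow_right (by norm_num) hc.width_lt
    have e11 := hc.rows
    have e12 := hc.wordLength
    have e13 := hc.width_lt
    have hp : c.prime ≤ c.prime * c.prime + c.prime := Nat.le_add_left _ _
    have hww : w < 2 ^ w := Nat.lt_two_pow_self
    have hall : ∀ n ∈ c.words, n < 2 ^ w := by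
      simp only [Header.words, List.forall_mem_cons, List.not_mem_nil, false_imp_iff,
        implies_true, and_true]
      refine ⟨?_, ?_, ?_, ?_, ?_, ?_, ?_, ?_, ?_, ?_, ?_, ?_, ?_⟩ <;> omega
    by_cases ha : a < c.words.length
    · rw [List.getD_eq_getElem _ _ ha]
      exact hall _ (List.getElem_mem ha)
    · rw [List.getD_eq_default _ _ (by omega)]
      positivity
  · exact hkey _ (by omega)
  · exact hvalue _ (by have := hc.hashBase; omega)
  · refine (pack_lt _ fun j _ => hcode _).trans_le ?_
    rw [← pow_mul]
    exact Nat.pow_le_pow_right (by norm_num) (by rw [mul_comm]; exact hc.field)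
  · rw [← hc.wordLength]
    exact pack_lt _ fun j _ => hbits _

/-- The contents of the memory cells before a query. -/
def Image.cell {w : ℕ} (I : Image w) (a : ℕ) : ℕ := (List.getD I a 0).toNat

theorem Header.cell_image (h : ∀ a, c.word key value code bits a < 2 ^ w) {a : ℕ}
    (ha : a < c.length) :
    (c.image w key value code bits).cell a = c.word key value code bits a := by
  rw [Image.cell, Header.image, List.getD_eq_getElem _ _ (by simpa using ha)]
  simp [Nat.mod_eq_of_lt (h a)]

end

/-! # The dictionary -/

section

variable {d : ℕ}

/-- The keys of the dictionary: the support of `v` and all numbers from `d` on. -/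
def IsKey (v : Fin d → ℕ) (n : ℕ) : Prop := (∃ h : n < d, v ⟨n, h⟩ ≠ 0) ∨ d ≤ n

/-- The keys in increasing order. -/
noncomputable def dictKey (v : Fin d → ℕ) (n : ℕ) : ℕ := Nat.nth (IsKey v) n

/-- The values that belong to the keys. -/
noncomputable def dictValue (v : Fin d → ℕ) (n : ℕ) : ℕ :=
  if h : dictKey v n < d then v ⟨dictKey v n, h⟩ - 1 else 0

/-- The extra keys from `d` on make the enumeration total and pad the dictionary to a power of two
without ever matching a query. -/
theorem infinite_isKey (v : Fin d → ℕ) : (Set.ofPred (IsKey v)).Infinite :=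
  (Set.Ici_infinite d).mono fun _ hn => Or.inr hn

-- The rank of `i`, the number of keys below it, is what the binary search finds.
open Classical in
theorem dictKey_lt_iff (v : Fin d → ℕ) (i n : ℕ) : dictKey v n < i ↔ n < Nat.count (IsKey v) i :=
  (Nat.lt_nth_iff_count_lt (infinite_isKey v)).symm

theorem dictKey_le (v : Fin d → ℕ) (n : ℕ) : dictKey v n ≤ d + n := by
  classical
  rw [← Nat.lt_succ_iff, Nat.succ_eq_add_one, add_assoc, dictKey_lt_iff, Nat.count_add]
  have : Nat.count (fun j => IsKey v (d + j)) (n + 1) = n + 1 :=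
    Nat.count_iff_forall.2 fun j _ => Or.inr (Nat.le_add_right d j)
  omega

open Classical in
theorem dictKey_count_eq_iff (v : Fin d → ℕ) (i : Fin d) :
    dictKey v (Nat.count (IsKey v) i) = i ↔ v i ≠ 0 := by
  constructor
  · intro h
    have := Nat.nth_mem_of_infinite (infinite_isKey v) (Nat.count (IsKey v) i)
    rw [← dictKey, h] at this
    obtain ⟨_, h'⟩ | h' := this
    · exact h'
    · exact absurd i.2 (by omega)
  · intro h
    exact Nat.nth_count (p := IsKey v) (Or.inl ⟨i.2, h⟩)

open Classical in
theorem count_isKey_le (v : Fin d → ℕ) (i : Fin d) :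
    Nat.count (IsKey v) i ≤ {j | v j ≠ 0}.ncard := by
  rw [Nat.count_eq_card_filter_range, ← Set.ncard_image_of_injective _ Fin.val_injective,
    ← Set.ncard_coe_finset]
  refine Set.ncard_le_ncard (fun n hn => ?_) (Set.toFinite _)
  simp only [Finset.coe_filter, Finset.mem_range, Set.mem_ofPred_eq] at hn
  obtain ⟨h, h'⟩ | h := hn.2
  · exact ⟨⟨n, h⟩, h', rfl⟩
  · exact absurd i.2 (by omega)

theorem dictValue_count (v : Fin d → ℕ) (i : Fin d) {n : ℕ} (h : dictKey v n = i) :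
    dictValue v n = v i - 1 := by
  rw [dictValue, dif_pos (by rw [h]; exact i.2)]
  simp only [h]

end

/-! # The encoding -/

section

variable {d N s m : ℕ}

/-- The codes of the hash functions. -/
def hashCode (o : ALPOutput N s m) (b : ℕ) : ℕ := if h : b < m then o.1 ⟨b, h⟩ else 0

/-- The bit array, row by row. -/
def arrayBit (o : ALPOutput N s m) (n : ℕ) : ℕ :=
  if h : n / m < s ∧ n % m < m then if o.2 ⟨n / m, h.1⟩ ⟨n % m, h.2⟩ then 1 else 0 else 0

/-- The bit that a query for `i` reads in column `b`. -/
def readBit (hash : Fin N → Fin d → Fin s) (o : ALPOutput N s m) (i : Fin d) (b : ℕ) : Bool :=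
  if h : b < m then o.2 (hash (o.1 ⟨b, h⟩) i) ⟨b, h⟩ else false

theorem hashCode_lt (o : ALPOutput N s m) (hN : 0 < N) (b : ℕ) : hashCode o b < N := by
  rw [hashCode]
  split_ifs
  exacts [Fin.is_lt _, hN]

theorem arrayBit_lt (o : ALPOutput N s m) (n : ℕ) : arrayBit o n < 2 := by
  rw [arrayBit]
  split_ifs <;> norm_num

theorem arrayBit_eq (o : ALPOutput N s m) (a : Fin s) (b : Fin m) :
    arrayBit o (a * m + b) = if o.2 a b then 1 else 0 := by
  have h1 : ((a : ℕ) * m + b) / m = a := by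
    rw [mul_comm, Nat.mul_add_div (by have := b.2; omega), Nat.div_eq_of_lt b.2, add_zero]
  have h2 : ((a : ℕ) * m + b) % m = b := by
    rw [mul_comm, Nat.mul_add_mod, Nat.mod_eq_of_lt b.2]
  rw [arrayBit, dif_pos ⟨by rw [h1]; exact a.2, by rw [h2]; exact b.2⟩]
  simp only [h1, h2]

/-- After at most `m` steps the walk that starts at `m` is still non-negative, so truncated
subtraction agrees with integer subtraction. -/
theorem walk_readBit (hash : Fin N → Fin d → Fin s) (o : ALPOutput N s m) (i : Fin d) {n : ℕ}
    (hn : n ≤ m) : (walk m (readBit hash o i) n : ℤ) = m + partialSum hash o i n := by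
  induction n with
  | zero => simp [walk, partialSum]
  | succ n ih =>
    have hstep : partialSum hash o i (n + 1) =
        partialSum hash o i n + if readBit hash o i n then 1 else -1 := by
      have hn' : n < m := by omega
      rw [partialSum, partialSum, ← sub_eq_iff_eq_add', ← Finset.sum_sub_distrib,
        Finset.sum_eq_single (⟨n, hn'⟩ : Fin m)]
      · simp [readBit, hn']
      · intro b _ hb
        have : (b : ℕ) ≠ n := fun h => hb (Fin.ext h)
        by_cases h : (b : ℕ) < n
        · rw [if_pos h, if_pos (by omega), sub_self]
        · rw [if_neg h, if_neg (by omega), sub_self]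
      · simp
    have hb := walk_bounds m (readBit hash o i) n
    have ih := ih (by omega)
    rw [hstep, walk]
    split_ifs with h
    · push_cast; omega
    · omega

theorem walkEstimate_readBit {c : Header} (hm : c.cols = m) (hash : Fin N → Fin d → Fin s)
    (o : ALPOutput N s m) (i : Fin d) : walkEstimate c (readBit hash o i) =
      min c.bound ((∑ n ∈ peaks hash o i, n) * c.weight / (peaks hash o i).card) := by
  subst hm
  have : (Finset.range (c.cols + 1)).filter (fun a => ∀ a' ≤ c.cols,
      walk c.cols (readBit hash o i) a' ≤ walk c.cols (readBit hash o i) a) = peaks hash o i := by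
    ext a
    rw [mem_peaks, Finset.mem_filter, Finset.mem_range, Nat.lt_succ_iff]
    refine and_congr_right fun ha => forall₂_congr fun a' ha' => ?_
    rw [← Int.ofNat_le, walk_readBit hash o i ha', walk_readBit hash o i ha]
    omega
  rw [walkEstimate, this]

/-- The image that stores a dictionary and an output of the ALP mechanism. -/
noncomputable def Header.encode (c : Header) (w : ℕ) (v : Fin d → ℕ)
    (o : ALPOutput N s m) : Image w :=
  c.image w (dictKey v) (dictValue v) (hashCode o) (arrayBit o)

end

theorem Header.stored_image {w : ℕ} {c : Header} {key value code bits : ℕ → ℕ}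
    (hc : c.Regular w) (h : ∀ a, c.word key value code bits a < 2 ^ w) :
    c.Stored (c.image w key value code bits).cell := by
  have hlen : 16 ≤ c.length := by
    have := hc.hashBase
    have := hc.lt_bitBase (Nat.zero_le _)
    have := c.lt_length (Nat.zero_le _)
    omega
  constructor <;> (rw [Header.cell_image h (by omega)]; rfl)

theorem Header.columns_encode {w d : ℕ} {c : Header} (hs : 0 < c.rows)
    (hc : c.Regular w) (hw : 0 < w) (v : Fin d → ℕ)
    (o : ALPOutput (c.prime * (c.prime - 1)) c.rows c.cols)
    (hN : 0 < c.prime * (c.prime - 1)) (hwidth : c.prime * (c.prime - 1) ≤ 2 ^ c.width)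
    (h : ∀ a, c.word (dictKey v) (dictValue v) (hashCode o) (arrayBit o) a < 2 ^ w) (i : Fin d) :
    c.Columns (c.encode w v o).cell i (hashCode o)
      (readBit (affineFamily d c.prime c.rows hs) o i) := by
  have e1 := hc.hashBase
  have e3 := hc.wordLength
  have e4 := hc.lt_bitBase (Nat.zero_le _)
  constructor
  · intro b hb
    have hle : b / c.perWord ≤ c.cols / c.perWord := Nat.div_le_div_right hb.le
    have h1 := hc.lt_bitBase hle
    have h2 := c.lt_length (Nat.zero_le _)
    have h3 : c.hashBase ≤ c.hashBase + b / c.perWord := Nat.le_add_right _ _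
    rw [Header.encode, Header.cell_image h (by omega), Header.word,
      if_neg (by omega), if_neg (by omega), if_neg (by omega), if_pos (by omega),
      mul_comm (b % c.perWord), pow_mul, pack_div_mod _ (fun j _ => (hashCode_lt o hN _).trans_le hwidth)
        (Nat.mod_lt _ hc.perWord), Nat.add_sub_cancel_left, Nat.div_add_mod]
  · intro b hb
    have := hashCode_lt o hN b
    have hp : 0 < c.prime := Nat.pos_of_mul_pos_right hN
    have := Nat.div_lt_of_lt_mul this
    omega
  · intro b hb
    set row := affineFamily d c.prime c.rows hs (o.1 ⟨b, hb⟩) i with hrow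
    have hcode : affineHash c.prime c.rows (hashCode o b) i = row := by
      rw [hashCode, dif_pos hb, hrow, affineFamily]
    rw [hcode]
    have hlt : (row : ℕ) * c.cols + b < c.rows * c.cols := by
      calc (row : ℕ) * c.cols + b < (row + 1) * c.cols := by rw [add_mul]; omega
        _ ≤ _ := Nat.mul_le_mul_right _ row.2
    have hle : ((row : ℕ) * c.cols + b) / c.wordLength ≤ c.rows * c.cols / c.wordLength :=
      Nat.div_le_div_right hlt.le
    have h1 := c.lt_length hle
    have h3 : c.bitBase ≤ c.bitBase + ((row : ℕ) * c.cols + b) / c.wordLength :=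
      Nat.le_add_right _ _
    rw [Header.encode, Header.cell_image h (by omega), Header.word,
      if_neg (by omega), if_neg (by omega), if_neg (by omega), if_neg (by omega),
      pack_div_mod _ (fun j _ => arrayBit_lt o _) (Nat.mod_lt _ (by omega)),
      Nat.add_sub_cancel_left, Nat.div_add_mod, arrayBit_eq o row ⟨b, hb⟩]
    simp only [readBit, dif_pos hb, hrow]

theorem Halts.answers {w : ℕ} {P : Program} {I : Image w} {i num den T : ℕ} (hi : i < 2 ^ w)
    (hden : den ≠ 0) (h : ∀ ρ : ℕ → ℕ, ρ 0 = i →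
      Halts P (fun a => List.getD I a.toNat 0) num den 0 ρ T) :
    Answers P I i T (num / den) := by
  obtain ⟨σ, hσ, h0, h1⟩ := h (fun r => ((initial I i).reg r).toNat)
    (by simp [initial, Nat.mod_eq_of_lt hi]) _ fun _ => rfl
  refine ⟨σ, hσ, fun h => ?_, by rw [h0, h1]⟩
  rw [h] at h1
  exact hden (by simpa using h1.symm)

/-- The access program answers queries on the encoding of a dictionary and an output of the ALP
mechanism. -/
theorem answers_encode {w d J : ℕ} {c : Header} (hs : 0 < c.rows) (hc : c.Regular w) (hw : 4 < w)
    (hf : c.Fits w) (hJ : c.size = 2 ^ J) (hden : c.den ≠ 0) (hd : d ≤ c.prime)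
    (hdw : d + c.size < 2 ^ w)
    (hN : 0 < c.prime * (c.prime - 1)) (hwidth : c.prime * (c.prime - 1) ≤ 2 ^ c.width)
    {v : Fin d → ℕ} (hv : ∀ i, v i - 1 < 2 ^ w) (hsupp : {i | v i ≠ 0}.ncard < c.size)
    (o : ALPOutput (c.prime * (c.prime - 1)) c.rows c.cols) (i : Fin d) :
    Answers accessProgram (c.encode w v o) i (8 * J + 32 * c.cols + 52)
      ((if v i ≠ 0 then v i - 1
        else walkEstimate c (readBit (affineFamily d c.prime c.rows hs) o i) : ℕ) / c.den) := by
  classical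
  have hword := c.word_lt (key := dictKey v) (value := dictValue v) hc hf hw
    (fun n hn => (dictKey_le v n).trans_lt (by omega))
    (fun n _ => by
      rw [dictValue]
      split_ifs
      exacts [hv _, by positivity])
    (fun n => (hashCode_lt o hN n).trans_le hwidth) (arrayBit_lt o)
  have e1 := hc.hashBase
  have e2 := hc.lt_bitBase (Nat.zero_le _)
  have e3 := c.lt_length (Nat.zero_le _)
  have hcount : Nat.count (IsKey v) i < c.size := (count_isKey_le v i).trans_lt hsupp
  have hi := i.2
  refine Halts.answers (by omega) hden fun ρ hρ =>
    halts_accessProgram (M := (c.encode w v o).cell) (key := dictKey v)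
      (cnt := Nat.count (IsKey v) i) (fun _ => rfl) (c.stored_image hc hword) hw hf hJ ?_
      (fun n => dictKey_lt_iff v i n) hcount
      (c.columns_encode hs hc (by omega) v o hN hwidth hword i) (by omega) hc.perWord hs ?_ ?_ hρ
  · intro n hn
    rw [Header.encode, Header.cell_image hword (by omega), Header.word,
      if_neg (by omega), if_pos (by omega), Nat.add_sub_cancel_left]
  · intro h
    rw [if_pos ((dictKey_count_eq_iff v i).1 h), Header.encode,
      Header.cell_image hword (by omega), Header.word,
      if_neg (by omega), if_neg (by omega), if_pos (by omega), Nat.add_sub_cancel_left,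
      dictValue_count v i h]
  · intro h
    rw [if_neg (fun h' => h ((dictKey_count_eq_iff v i).2 h'))]

end WordRAM

namespace WordRAM

/-! # Fixed-point representation of the estimates -/

/-- The stored form of the value `v` with denominator `q`, where `0` means that no value is
stored. -/
noncomputable def quantize (u : ℝ) (q : ℕ) (v : ℝ) : ℕ :=
  open Classical in
  if v = 0 then 0 else ⌊max 0 (min u v) * q⌋₊ + 1

theorem quantize_ne_zero_iff {u v : ℝ} {q : ℕ} : quantize u q v ≠ 0 ↔ v ≠ 0 := by
  rw [quantize]
  split_ifs with h <;> simp [h]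

theorem measurable_quantize (u : ℝ) (q : ℕ) : Measurable (quantize u q) := by
  unfold quantize
  refine Measurable.ite (measurableSet_singleton 0) measurable_const ?_
  exact (Nat.measurable_floor.comp ((measurable_const.max (measurable_const.min
    measurable_id)).mul measurable_const)).add_const 1

theorem quantize_sub_one_le (u v : ℝ) (q : ℕ) (hu : 0 ≤ u) :
    quantize u q v - 1 ≤ ⌊u * q⌋₊ := by
  rw [quantize]
  split_ifs
  · simp
  · rw [Nat.add_sub_cancel]
    exact Nat.floor_mono (mul_le_mul_of_nonneg_right (max_le hu (min_le_left _ _))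
      (Nat.cast_nonneg _))

theorem abs_quantize_sub_le {u v : ℝ} {q : ℕ} (hq : 0 < q) (hv : v ≠ 0) :
    |((quantize u q v - 1 : ℕ) : ℝ) / q - max 0 (min u v)| ≤ 1 / q := by
  have hq' : (0 : ℝ) < q := Nat.cast_pos.2 hq
  rw [quantize, if_neg hv, Nat.add_sub_cancel]
  set a := max 0 (min u v)
  have h0 : 0 ≤ a * q := mul_nonneg (le_max_left _ _) hq'.le
  have h1 := Nat.floor_le h0
  have h2 := Nat.lt_floor_add_one (a * q)
  rw [div_sub' hq'.ne', abs_div, abs_of_pos hq']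
  gcongr
  rw [abs_le]
  constructor <;> nlinarith

/-- Rounding down the weight, the average and the upper bound changes the clamped average by at
most `(m + 1) / q`. -/
theorem abs_min_div_sub_le {q m t n : ℕ} {u β : ℝ} (hq : 0 < q) (hu : 0 ≤ u) (hβ : 0 ≤ β)
    (ht : t ≤ m * n) (hn : 0 < n) :
    |((min ⌊u * q⌋₊ (t * ⌊β * q⌋₊ / n) : ℕ) : ℝ) / q - max 0 (min u ((t : ℝ) / n * β))| ≤
      (m + 1) / q := by
  have hq' : (0 : ℝ) < q := Nat.cast_pos.2 hq
  have hn' : (0 : ℝ) < n := Nat.cast_pos.2 hn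
  set A : ℝ := (t : ℝ) / n with hA
  have hA0 : 0 ≤ A := by positivity
  have hAm : A ≤ m := by
    rw [hA, div_le_iff₀ hn']
    exact_mod_cast ht
  rw [max_eq_right (le_min hu (by positivity))]
  have b1 := Nat.floor_le (by positivity : 0 ≤ u * q)
  have b2 := Nat.lt_floor_add_one (u * q)
  have w1 := Nat.floor_le (by positivity : 0 ≤ β * q)
  have w2 := Nat.lt_floor_add_one (β * q)
  set W := ⌊β * q⌋₊
  have hdiv : ((t * W / n : ℕ) : ℝ) = ⌊A * W⌋₊ := by
    rw [← Nat.floor_div_eq_div (K := ℝ)]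
    congr 2
    push_cast
    rw [hA]
    ring
  have a1 := Nat.floor_le (by positivity : 0 ≤ A * W)
  have a2 := Nat.lt_floor_add_one (A * W)
  have c1 : A * W ≤ A * β * q := by nlinarith
  -- Rounding the weight down costs at most `A ≤ m` numerator units; rounding the quotient down
  -- accounts for the remaining unit of `m + 1`.
  have c2 : A * β * q - m ≤ A * W := by nlinarith
  have hm : (0 : ℝ) ≤ m := Nat.cast_nonneg m
  rw [div_sub' hq'.ne', abs_div, abs_of_pos hq']
  gcongr
  rw [Nat.cast_min, hdiv, mul_min_of_nonneg _ _ hq'.le]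
  refine (abs_min_sub_min_le_max _ _ _ _).trans (max_le ?_ ?_) <;> rw [abs_le] <;> constructor <;>
    nlinarith

/-- The header of the image of an output of threshold ALP-projection. -/
noncomputable def thresholdHeader (p s m J w : ℕ) (α ε u : ℝ) : Header :=
  open Classical in
  { size := 2 ^ J
    -- Chosen so that the total rounding error `(m + 1) / den` is at most `1 / ε`.
    den := ⌈(m + 1) * ε⌉₊
    cols := m
    prime := p
    rows := s
    hashBase := 16 + 2 * 2 ^ J
    perWord := w / (p * (p - 1)).size
    width := (p * (p - 1)).size
    bitBase := 16 + 2 * 2 ^ J + m / (w / (p * (p - 1)).size) + 1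
    wordLength := w
    -- If `ε * u ≤ 1`, then `0` is within `1 / ε` of every clamped estimate. Otherwise `1 / ε < u`,
    -- which keeps the weight within a word even for small `ε`.
    weight := if ε * u ≤ 1 then 0 else ⌊α / (ε / 2) * ⌈(m + 1) * ε⌉₊⌋₊
    bound := ⌊u * ⌈(m + 1) * ε⌉₊⌋₊ }

theorem regular_thresholdHeader {p s m J w : ℕ} {α ε u : ℝ} (hp : 1 < p)
    (hw : (p * (p - 1)).size < w) (hs : s < 2 ^ w) :
    (thresholdHeader p s m J w α ε u).Regular w := by
  have h0 : 0 < (p * (p - 1)).size := Nat.size_pos.2 (Nat.mul_pos (by omega) (by omega))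
  exact ⟨rfl, rfl, rfl, Nat.div_pos hw.le h0, Nat.div_mul_le_self _ _, h0, hw, hs⟩

/-- The numerator of the answer to a query, with the denominator of the header. -/
noncomputable def answerNum {d N m s : ℕ} (c : Header) (u : ℝ) (hash : Fin N → Fin d → Fin s)
    (r : (Fin d → ℝ) × ALPOutput N s m) (i : Fin d) : ℕ :=
  open Classical in
  if r.1 i ≠ 0 then quantize u c.den (r.1 i) - 1 else
    min c.bound ((∑ n ∈ peaks hash r.2 i, n) * c.weight / (peaks hash r.2 i).card)

theorem abs_answerNum_sub_le {d N m p s J w : ℕ} {α ε u : ℝ} (hα : 0 < α) (hε : 0 < ε)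
    (hu : 0 ≤ u) (hash : Fin N → Fin d → Fin s) (r : (Fin d → ℝ) × ALPOutput N s m) (i : Fin d) :
    |(answerNum (thresholdHeader p s m J w α ε u) u hash r i : ℝ) /
      (thresholdHeader p s m J w α ε u).den - thresholdALPEstimate α ε u hash r i| ≤ 1 / ε := by
  set q := ⌈((m : ℝ) + 1) * ε⌉₊ with hq
  have hden : (thresholdHeader p s m J w α ε u).den = q := rfl
  have hbound : (thresholdHeader p s m J w α ε u).bound = ⌊u * q⌋₊ := rfl
  have hm : (0 : ℝ) ≤ m := Nat.cast_nonneg m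
  have hq0 : 0 < q := Nat.ceil_pos.2 (by positivity)
  have hq' : (0 : ℝ) < q := Nat.cast_pos.2 hq0
  have hmq : ((m : ℝ) + 1) / q ≤ 1 / ε := by
    rw [div_le_div_iff₀ hq' hε, one_mul]
    exact Nat.le_ceil _
  have hq1 : 1 / (q : ℝ) ≤ 1 / ε := le_trans (by gcongr; linarith) hmq
  rw [answerNum, thresholdALPEstimate, hden, hbound]
  split_ifs with hv
  · exact (abs_quantize_sub_le hq0 hv).trans hq1
  have hcard : 0 < (peaks hash r.2 i).card := Finset.card_pos.2 (peaks_nonempty hash r.2 i)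
  have hsum : ∑ n ∈ peaks hash r.2 i, n ≤ m * (peaks hash r.2 i).card := by
    rw [mul_comm, ← smul_eq_mul]
    exact Finset.sum_le_card_nsmul _ _ _ fun n hn => ((mem_peaks).1 hn).1
  have hest : alpEstimate α (ε / 2) hash r.2 i =
      ((∑ n ∈ peaks hash r.2 i, n : ℕ) : ℝ) / (peaks hash r.2 i).card * (α / (ε / 2)) := by
    rw [alpEstimate, mul_div_assoc]
    push_cast
    rfl
  by_cases h : ε * u ≤ 1
  · have hweight : (thresholdHeader p s m J w α ε u).weight = 0 := if_pos h
    rw [hweight, mul_zero, Nat.zero_div, Nat.min_zero, Nat.cast_zero, zero_div, zero_sub, abs_neg,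
      abs_of_nonneg (le_max_left _ _)]
    refine max_le (by positivity) ((min_le_left _ _).trans ?_)
    rw [le_div_iff₀ hε]
    linarith
  · have hweight : (thresholdHeader p s m J w α ε u).weight = ⌊α / (ε / 2) * q⌋₊ := if_neg h
    rw [hweight, hest]
    exact (abs_min_div_sub_le hq0 hu (by positivity) hsum hcard).trans hmq

/-- The encoding of an output of threshold ALP-projection. -/
noncomputable def encodeOutput {d N s m : ℕ} (c : Header) (w : ℕ) (u : ℝ)
    (r : (Fin d → ℝ) × ALPOutput N s m) : Image w :=
  c.encode w (fun i => quantize u c.den (r.1 i)) r.2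

/-- After quantization the data live in a countable discrete space, where measurability is
automatic. -/
theorem measurable_uncurry_encode {d N s m : ℕ} (c : Header) (w : ℕ) :
    Measurable fun r : (Fin d → ℕ) × ALPOutput N s m => c.encode w r.1 r.2 := .of_discrete

theorem measurable_prodMk_quantize {d N s m : ℕ} (q : ℕ) (u : ℝ) :
    Measurable fun r : (Fin d → ℝ) × ALPOutput N s m =>
      ((fun i => quantize u q (r.1 i), r.2) : (Fin d → ℕ) × ALPOutput N s m) := by
  refine Measurable.prodMk ?_ measurable_snd
  exact measurable_pi_lambda _ fun i =>
    (measurable_quantize u q).comp ((measurable_pi_apply i).comp measurable_fst)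

theorem measurable_encodeOutput {d N s m : ℕ} (c : Header) (w : ℕ) (u : ℝ) :
    Measurable (encodeOutput c w u : (Fin d → ℝ) × ALPOutput N s m → Image w) := by
  have h := (measurable_uncurry_encode c w).comp
    (measurable_prodMk_quantize (d := d) (N := N) (s := s) (m := m) c.den u)
  unfold encodeOutput
  exact h

/-- The answer to a query for `i` within `T` steps, if there is one. -/
noncomputable def answer {w : ℕ} (P : Program) (T : ℕ) (I : Image w) (i : ℕ) : ℝ :=
  open Classical in
  if h : ∃ v, Answers P I i T v then h.choose else 0

theorem Answers.unique {w : ℕ} {P : Program} {I : Image w} {i T : ℕ} {v v' : ℝ}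
    (h : Answers P I i T v) (h' : Answers P I i T v') : v = v' := by
  obtain ⟨σ, h1, -, h2⟩ := h
  obtain ⟨σ', h1', -, h2'⟩ := h'
  rw [h1, Option.some_inj] at h1'
  rw [h2, h2', h1']

theorem Answers.answer_eq {w : ℕ} {P : Program} {I : Image w} {i T : ℕ} {v : ℝ}
    (h : Answers P I i T v) : answer P T I i = v := by
  have h' : ∃ v, Answers P I i T v := ⟨v, h⟩
  rw [answer, dif_pos h']
  exact h'.choose_spec.unique h

theorem Answers.mono {w : ℕ} {P : Program} {I : Image w} {i T T' : ℕ} {v : ℝ}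
    (h : Answers P I i T v) (hT : T ≤ T') : Answers P I i T' v := by
  obtain ⟨σ, h1, h2⟩ := h
  exact ⟨σ, exec_mono hT h1, h2⟩

theorem answers_encodeOutput {d p s m J w : ℕ} {α ε u : ℝ} (hs : 0 < s) (hp : 1 < p) (hw : 4 < w)
    (hε : 0 < ε) (hu : 0 ≤ u) (hsize : (p * (p - 1)).size < w) (hsw : s < 2 ^ w) (hd : d ≤ p)
    (hdw : d + 2 ^ J < 2 ^ w) (hf : (thresholdHeader p s m J w α ε u).Fits w)
    (r : (Fin d → ℝ) × ALPOutput (p * (p - 1)) s m) (hr : {i | r.1 i ≠ 0}.ncard < 2 ^ J)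
    (i : Fin d) :
    Answers accessProgram (encodeOutput (thresholdHeader p s m J w α ε u) w u r) i
      (8 * J + 32 * m + 52)
      (answerNum (thresholdHeader p s m J w α ε u) u (affineFamily d p s hs) r i /
        (thresholdHeader p s m J w α ε u).den) := by
  set c := thresholdHeader p s m J w α ε u with hc
  have hm : (0 : ℝ) ≤ m := Nat.cast_nonneg m
  have hden : c.den ≠ 0 := (Nat.ceil_pos.2 (by positivity) : 0 < ⌈((m : ℝ) + 1) * ε⌉₊).ne'
  have hsupp : {i | quantize u c.den (r.1 i) ≠ 0}.ncard < c.size := by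
    simp only [quantize_ne_zero_iff]
    exact hr
  have hN : 0 < p * (p - 1) := Nat.mul_pos (by omega) (by omega)
  have hval : answerNum c u (affineFamily d p s hs) r i =
      if quantize u c.den (r.1 i) ≠ 0 then quantize u c.den (r.1 i) - 1
        else walkEstimate c (readBit (affineFamily d p s hs) (m := m) r.2 i) := by
    rw [answerNum, walkEstimate_readBit (c := c) (m := m) rfl]
    simp only [quantize_ne_zero_iff]
  rw [hval]
  exact answers_encode (c := c) (J := J) hs (regular_thresholdHeader hp hsize hsw) hw hf rfl
    hden hd hdw hN (Nat.lt_size_self _).le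
    (v := fun i => quantize u c.den (r.1 i))
    (fun i => (quantize_sub_one_le u _ _ hu).trans_lt hf.bound) hsupp r.2 i

end WordRAM

/-! # Parameters -/

section

variable {K L : ℝ}

/-- The threshold times `ε / 2` is `log (1 / δ) + ε`, which is of order `log (1 / δ)`. The rounding
up and the extra `1` are absorbed by `1 ≤ K * log (1 / δ)`. -/
theorem columns_add_one_le {α ε δ : ℝ} (hK : 1 ≤ K) (hα : 1 / K ≤ α) (hε : 0 < ε)
    (hL : 1 ≤ K * Real.log (1 / δ)) (hεL : ε ≤ K * Real.log (1 / δ)) :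
    (columns α ε δ : ℝ) + 1 ≤ K * (K + 3) * Real.log (1 / δ) := by
  set L := Real.log (1 / δ)
  have hK0 : 0 < K := by linarith
  have hα0 : 0 < α := lt_of_lt_of_le (by positivity) hα
  have hL0 : 0 < L := by
    by_contra h
    nlinarith
  have h1 : thresholdValue (ε / 2) δ * (ε / 2) / α = (L + ε) / α := by
    rw [thresholdValue]
    field_simp
    rfl
  have h2 : (L + ε) / α ≤ (L + ε) * K := by
    rw [div_eq_mul_inv]
    gcongr
    rw [one_div] at hα
    exact inv_le_of_inv_le₀ hK0 hα
  have h3 := Nat.ceil_lt_add_one (a := (L + ε) / α) (by positivity)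
  rw [columns_eq, h1]
  nlinarith

theorem natCast_le_two_pow (n : ℕ) : (n : ℝ) ≤ 2 ^ n := by
  exact_mod_cast Nat.lt_two_pow_self.le

/-- The surplus `1` in `e + 1` pays for rounding `w / 4` down, since `log 2 ≤ log Z`. -/
theorem pow_le_two_pow_of_log_le {Z : ℝ} {e w : ℕ} (hZ : 2 ≤ Z)
    (hw : 4 * (e + 1) / Real.log 2 * Real.log Z ≤ w) : Z ^ e ≤ 2 ^ (w / 4) := by
  have hl := Real.log_pos (by norm_num : (1 : ℝ) < 2)
  have hZl : Real.log 2 ≤ Real.log Z := Real.log_le_log (by norm_num) hZ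
  have h1 : (w : ℝ) < 4 * ((w / 4 : ℕ) + 1) := by
    have : w < 4 * (w / 4 + 1) := by omega
    exact_mod_cast this
  rw [div_mul_eq_mul_div, div_le_iff₀ hl] at hw
  rw [← Real.log_le_log_iff (by positivity) (by positivity), Real.log_pow, Real.log_pow]
  nlinarith [mul_lt_mul_of_pos_right h1 hl]

/-- Because `δ = O(1 / k)`, the `log k` of the binary search and of the maximum of `k` noises is of
order `log (1 / δ)`. -/
theorem log_natCast_le {k : ℕ} {δ : ℝ} {K : ℕ} (hk : 1 ≤ k) (hK : 0 < K) (hδ : 0 < δ)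
    (hkδ : k * δ ≤ K) : Real.log k ≤ K + Real.log (1 / δ) := by
  have hK' : (0 : ℝ) < K := Nat.cast_pos.2 hK
  have hk' : (0 : ℝ) < k := Nat.cast_pos.2 hk
  calc Real.log k ≤ Real.log (K * (1 / δ)) := by
        refine Real.log_le_log hk' ?_
        rw [mul_one_div, le_div_iff₀ hδ]
        exact hkδ
    _ = Real.log K + Real.log (1 / δ) := Real.log_mul hK'.ne' (by positivity)
    _ ≤ K + Real.log (1 / δ) := by
        have := Real.log_le_sub_one_of_pos hK'
        linarith

theorem size_le_log {n : ℕ} (hn : 1 ≤ n) : (n.size : ℝ) ≤ 1 + 3 / 2 * Real.log n := by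
  have h0 : 0 < n.size := Nat.size_pos.2 hn
  have h1 : 2 ^ (n.size - 1) ≤ n := Nat.lt_size.1 (by omega)
  have h2 : (2 : ℝ) ^ (n.size - 1) ≤ n := by exact_mod_cast h1
  have h3 := Real.log_le_log (by positivity) h2
  rw [Real.log_pow, Nat.cast_sub h0, Nat.cast_one] at h3
  have := Real.log_two_gt_d9
  have h4 : (1 : ℝ) ≤ n.size := by exact_mod_cast h0
  nlinarith

/-- The term `log (d + u)` can vanish, so the loss of at most `log 2 < 1` is charged to `K * L`. -/
theorem log_add_add_one_le {d u : ℝ} (hd : 1 ≤ d) (hu : 0 ≤ u) (hL : 1 ≤ K * L) :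
    Real.log (d + u + 1) ≤ Real.log (d + u) + K * L := by
  have : Real.log (d + u + 1) ≤ Real.log (2 * (d + u)) :=
    Real.log_le_log (by linarith) (by linarith)
  rw [Real.log_mul (by norm_num) (by linarith)] at this
  have := Real.log_two_lt_d9
  linarith

/-- With `p = 1 / (α + 2)` the gap factors as `(1 / 2 - p) (1 - 2 k / s)`. The first factor is
bounded below through `α`, the second because `s / k` stays above `2`. -/
theorem error_margin {K α k s : ℝ} (hK : 1 ≤ K) (hα : 1 / K ≤ α) (hk : 0 < k)
    (hs : (2 + 1 / K) * k ≤ s) :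
    1 / (α + 2) + k / s * (1 - 2 * (1 / (α + 2))) ≤ 1 / 2 - 1 / (2 * (2 * K + 1) ^ 2) := by
  have hK0 : 0 < K := by linarith
  have hα0 : 0 < α := lt_of_lt_of_le (by positivity) hα
  have hs0 : 0 < s := lt_of_lt_of_le (by positivity) hs
  have h1 : 1 / (2 * (2 * K + 1)) ≤ 1 / 2 - 1 / (α + 2) := by
    rw [div_le_iff₀ hK0] at hα
    rw [div_sub_div _ _ (by norm_num) (by positivity), div_le_div_iff₀ (by positivity)
      (by positivity)]
    nlinarith
  have h2 : 1 / (2 * K + 1) ≤ 1 - 2 * (k / s) := by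
    have : k / s ≤ K / (2 * K + 1) := by
      rw [div_le_div_iff₀ hs0 (by positivity)]
      have := mul_le_mul_of_nonneg_left hs hK0.le
      calc k * (2 * K + 1) = K * ((2 + 1 / K) * k) := by field_simp
        _ ≤ K * s := this
    have h3 : K / (2 * K + 1) = (1 - 1 / (2 * K + 1)) / 2 := by field_simp; ring
    linarith
  have h3 := mul_le_mul h1 h2 (by positivity) (le_trans (by positivity) h1)
  have h4 : 1 / (2 * (2 * K + 1)) * (1 / (2 * K + 1)) = 1 / (2 * (2 * K + 1) ^ 2) := by
    field_simp
  rw [h4] at h3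
  linarith

/-- Lets the failure terms be counted in units of `1 / ε` even for large `ε`. -/
theorem exp_neg_half_le {ε : ℝ} (hε : 0 < ε) : Real.exp (-(ε / 2)) ≤ 2 / ε := by
  have h : ε / 2 ≤ Real.exp (ε / 2) := by linarith [Real.add_one_le_exp (ε / 2)]
  rw [Real.exp_neg, show 2 / ε = (ε / 2)⁻¹ from (inv_div _ _).symm]
  exact inv_anti₀ (by positivity) h

end

/-! ### Numbers fit into words, and the length of an image. -/

namespace WordRAM

/-- All parameters are at most `2 ^ b` with `4 * b ≤ w`, while the largest intermediate, the
weighted sum of the peaks, is a product of about three of them. -/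
theorem fits_thresholdHeader {p s m J w b : ℕ} {α ε u : ℝ} (hb : 4 ≤ b) (hw : 4 * b ≤ w)
    (hJ : 2 ^ J ≤ 2 ^ b) (hp : p ≤ 2 ^ b) (hs : s ≤ 2 ^ b) (hm : m + 1 ≤ 2 ^ b)
    (hden : (thresholdHeader p s m J w α ε u).den ≤ 2 ^ b)
    (hweight : (thresholdHeader p s m J w α ε u).weight ≤ 2 ^ b)
    (hbound : (thresholdHeader p s m J w α ε u).bound ≤ 2 ^ b) :
    (thresholdHeader p s m J w α ε u).Fits w := by
  set c := thresholdHeader p s m J w α ε u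
  have h16 : 2 ^ 4 ≤ 2 ^ b := Nat.pow_le_pow_right (by norm_num) hb
  have hpow : 2 ^ b * 2 ^ b * (2 ^ b * 2 ^ b) ≤ 2 ^ w := by
    rw [← pow_add, ← pow_add]
    exact Nat.pow_le_pow_right (by norm_num) (by omega)
  have hww : w < 2 ^ w := Nat.lt_two_pow_self
  have e0 : c.size = 2 ^ J := rfl
  have e1 : c.cols = m := rfl
  have e2 : c.rows = s := rfl
  have e3 : c.prime = p := rfl
  have e4 : c.hashBase = 16 + 2 * 2 ^ J := rfl
  have e5 : c.bitBase = 16 + 2 * 2 ^ J + m / c.perWord + 1 := rfl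
  have e6 : c.perWord * c.width ≤ w := Nat.div_mul_le_self _ _
  have e7 : m / c.perWord ≤ m := Nat.div_le_self _ _
  generalize 2 ^ b = B at *
  have hB : 16 * B ≤ B * B := Nat.mul_le_mul_right _ h16
  have hBB : 256 * (B * B) ≤ B * B * (B * B) := Nat.mul_le_mul_right _ (by omega)
  have hpp : p * p ≤ B * B := Nat.mul_le_mul hp hp
  have hsm : s * m ≤ B * B := Nat.mul_le_mul hs (by omega)
  have hmm : (m + 1) * (m + 1) * (c.weight + 1) < B * B * (B * B) :=
    (Nat.mul_le_mul (Nat.mul_le_mul hm hm) (Nat.succ_le_succ hweight)).trans_lt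
      (Nat.mul_lt_mul_of_pos_left (by omega) (by omega))
  constructor
  · omega
  · omega
  · omega
  · omega
  · rw [e3]; omega
  · rw [e2, e1]; omega
  · omega
  · rw [e1]; omega
  · omega

/-- Each of `K`, `L`, `ε`, `m + 1` and the denominator is at most a power of `Z` depending only on
`K`. The factor `1 / ε` of a non-zero weight is at most `u ≤ Z`, by the case distinction in the
header. -/
theorem thresholdHeader_le {K m p s J w : ℕ} {α ε u L Z : ℝ} (hK : 1 ≤ K) (hZ : 2 ≤ Z)
    (huZ : u ≤ Z) (hu : 0 ≤ u) (hα : 0 < α) (hαK : α ≤ K) (hε : 0 < ε) (hεL : ε ≤ K * L)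
    (hLZ : L ≤ Z ^ K) (hL : 0 < L) (hm : (m : ℝ) + 1 ≤ K * (K + 3) * L) :
    (m : ℝ) + 1 ≤ Z ^ (6 * K + 4) ∧
    ((thresholdHeader p s m J w α ε u).den : ℝ) ≤ Z ^ (6 * K + 4) ∧
    ((thresholdHeader p s m J w α ε u).weight : ℝ) ≤ Z ^ (6 * K + 4) ∧
    ((thresholdHeader p s m J w α ε u).bound : ℝ) ≤ Z ^ (6 * K + 4) := by
  set c := thresholdHeader p s m J w α ε u
  have hZ0 : 0 < Z := by linarith
  have hmono : ∀ {a b : ℕ}, a ≤ b → Z ^ a ≤ Z ^ b := fun h => pow_le_pow_right₀ (by linarith) h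
  have hK0 : (0 : ℝ) ≤ K := Nat.cast_nonneg K
  have hm0 : (0 : ℝ) ≤ m := Nat.cast_nonneg m
  have hKZ : (K : ℝ) ≤ Z ^ K :=
    (natCast_le_two_pow K).trans (pow_le_pow_left₀ (by norm_num) hZ K)
  have hKZ' : (K : ℝ) + 3 ≤ Z ^ (K + 1) := by
    have : K + 3 ≤ 2 ^ (K + 1) := by
      have := Nat.lt_two_pow_self (n := K)
      rw [pow_succ]
      omega
    calc (K : ℝ) + 3 ≤ 2 ^ (K + 1) := by exact_mod_cast this
      _ ≤ _ := pow_le_pow_left₀ (by norm_num) hZ _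
  have hεZ : ε ≤ Z ^ (2 * K) := by
    calc ε ≤ K * L := hεL
      _ ≤ Z ^ K * Z ^ K := by gcongr
      _ = Z ^ (2 * K) := by ring
  have hmZ : (m : ℝ) + 1 ≤ Z ^ (3 * K + 1) := by
    calc (m : ℝ) + 1 ≤ K * (K + 3) * L := hm
      _ ≤ Z ^ K * Z ^ (K + 1) * Z ^ K := by gcongr
      _ = Z ^ (3 * K + 1) := by ring
  have hone : (1 : ℝ) ≤ Z ^ (5 * K + 1) := one_le_pow₀ (by linarith)
  have hdenZ : (c.den : ℝ) ≤ Z ^ (5 * K + 2) := by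
    have h1 : (c.den : ℝ) < (m + 1) * ε + 1 := Nat.ceil_lt_add_one (by positivity)
    have h2 : ((m : ℝ) + 1) * ε ≤ Z ^ (5 * K + 1) := by
      calc ((m : ℝ) + 1) * ε ≤ Z ^ (3 * K + 1) * Z ^ (2 * K) := by gcongr
        _ = _ := by ring
    have h3 : 2 * Z ^ (5 * K + 1) ≤ Z ^ (5 * K + 2) := by
      rw [pow_succ' Z (5 * K + 1)]
      gcongr
    linarith
  refine ⟨hmZ.trans (hmono (by omega)), hdenZ.trans (hmono (by omega)), ?_, ?_⟩
  · by_cases h : ε * u ≤ 1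
    · have : c.weight = 0 := if_pos h
      rw [this, Nat.cast_zero]
      positivity
    · have : c.weight = ⌊α / (ε / 2) * c.den⌋₊ := if_neg h
      rw [this]
      have h1 : 1 / ε ≤ Z := by
        rw [div_le_iff₀ hε]
        push Not at h
        nlinarith
      calc (⌊α / (ε / 2) * c.den⌋₊ : ℝ) ≤ α / (ε / 2) * c.den := Nat.floor_le (by positivity)
        _ = 2 * α * (1 / ε) * c.den := by field_simp
        _ ≤ Z * Z ^ K * Z * Z ^ (5 * K + 2) := by
          have := hαK.trans hKZ
          gcongr
        _ = Z ^ (6 * K + 4) := by ring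
  · calc (c.bound : ℝ) ≤ u * c.den := Nat.floor_le (by positivity)
      _ ≤ Z * Z ^ (5 * K + 2) := by gcongr
      _ = Z ^ (5 * K + 3) := by ring
      _ ≤ _ := hmono (by omega)

theorem size_modulus_lt {p w b : ℕ} (hb : 0 < b) (hw : 4 * b ≤ w) (hp : p ≤ 2 ^ b) :
    (p * (p - 1)).size < w := by
  have h1 : p * (p - 1) < 2 ^ (2 * b) := by
    have h0 : 0 < 2 ^ b := by positivity
    calc p * (p - 1) ≤ 2 ^ b * (p - 1) := Nat.mul_le_mul_right _ hp
      _ < 2 ^ b * 2 ^ b := Nat.mul_lt_mul_of_pos_left (by omega) h0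
      _ = 2 ^ (2 * b) := by rw [two_mul, pow_add]
  have := Nat.size_le.2 h1
  omega

/-- Whole codes are packed into words, and less than half of a word is wasted; hence the factor `2`
before the code length. -/
theorem bits_encodeOutput_le {d N p s m J w : ℕ} {α ε u : ℝ} (hp : 1 < p)
    (hsize : (p * (p - 1)).size < w) (r : (Fin d → ℝ) × ALPOutput N s m) :
    (encodeOutput (thresholdHeader p s m J w α ε u) w u r).bits ≤
      (18 + 2 * 2 ^ J) * w + 2 * (p * (p - 1)).size * m + s * m := by
  rw [encodeOutput, Header.encode, Header.bits_image]
  set ℓ := (p * (p - 1)).size with hℓ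
  have hlen : (thresholdHeader p s m J w α ε u).length =
      16 + 2 * 2 ^ J + m / (w / ℓ) + 1 + s * m / w + 1 := rfl
  have h0 : 0 < ℓ := Nat.size_pos.2 (Nat.mul_pos (by omega) (by omega))
  have hg : 0 < w / ℓ := Nat.div_pos hsize.le h0
  have h1 : w ≤ 2 * ℓ * (w / ℓ) := by
    have := Nat.lt_mul_div_succ w h0
    nlinarith
  have h2 : m / (w / ℓ) * w ≤ 2 * ℓ * m :=
    calc m / (w / ℓ) * w ≤ m / (w / ℓ) * (2 * ℓ * (w / ℓ)) := Nat.mul_le_mul_left _ h1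
      _ = 2 * ℓ * (m / (w / ℓ) * (w / ℓ)) := by ring
      _ ≤ 2 * ℓ * m := Nat.mul_le_mul_left _ (Nat.div_mul_le_self _ _)
  have h3 : s * m / w * w ≤ s * m := Nat.div_mul_le_self _ _
  rw [hlen]
  nlinarith

end WordRAM

/-! ### Collecting the asymptotic constants. -/

namespace WordRAM

/-- The constant of the asymptotic bounds. -/
noncomputable def asymptoticConstant (K B : ℝ) : ℝ :=
  (22 * |B| * K + 15 * K * (K * (K + 3))) + (60 * K + 16 * K ^ 2 + 16 + 32 * (K * (K + 3))) +
    (10 + 2 * K * (1 / (1 / (2 * (2 * K + 1) ^ 2)) ^ 4 + 1)) +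
    (9 * K + 5 * K ^ 2 + 4 + 2 * K * (K * (K + 3)))

section

variable {K B : ℝ}

theorem asymptoticConstant_bounds (hK : 0 < K) :
    0 < asymptoticConstant K B ∧
    22 * |B| * K + 15 * K * (K * (K + 3)) ≤ asymptoticConstant K B ∧
    60 * K + 16 * K ^ 2 + 16 + 32 * (K * (K + 3)) ≤ asymptoticConstant K B ∧
    10 + 2 * K * (1 / (1 / (2 * (2 * K + 1) ^ 2)) ^ 4 + 1) ≤ asymptoticConstant K B ∧
    9 * K + 5 * K ^ 2 + 4 + 2 * K * (K * (K + 3)) ≤ asymptoticConstant K B := by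
  have h1 : 0 < 22 * |B| * K + 15 * K * (K * (K + 3)) := by positivity
  have h2 : 0 < 60 * K + 16 * K ^ 2 + 16 + 32 * (K * (K + 3)) := by positivity
  have h3 : 0 < 10 + 2 * K * (1 / (1 / (2 * (2 * K + 1) ^ 2)) ^ 4 + 1) := by positivity
  have h4 : 0 < 9 * K + 5 * K ^ 2 + 4 + 2 * K * (K * (K + 3)) := by positivity
  rw [asymptoticConstant]
  generalize 22 * |B| * K + 15 * K * (K * (K + 3)) = a at *
  generalize 60 * K + 16 * K ^ 2 + 16 + 32 * (K * (K + 3)) = b at *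
  generalize 10 + 2 * K * (1 / (1 / (2 * (2 * K + 1) ^ 2)) ^ 4 + 1) = c at *
  generalize 9 * K + 5 * K ^ 2 + 4 + 2 * K * (K * (K + 3)) = e at *
  refine ⟨?_, ?_, ?_, ?_, ?_⟩ <;> linarith

end

theorem bits_le_of_parameters {K B L D ℓ k m s w S : ℝ} (hK : 1 ≤ K) (hk : 1 ≤ k)
    (hD : 0 ≤ D) (hw : w ≤ B * (D + K * L)) (hw0 : 0 ≤ w)
    (hS : S ≤ 2 * k) (hℓ : ℓ ≤ 7 * K * k) (hs : s ≤ K * k) (hm0 : 0 ≤ m) (hB : 0 ≤ B)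
    (hm : m ≤ K * (K + 3) * L) :
    (18 + 2 * S) * w + 2 * ℓ * m + s * m ≤
      (22 * B * K + 15 * K * (K * (K + 3))) * (k * (D + L)) := by
  have h1 : (18 + 2 * S) * w ≤ 22 * B * K * (k * (D + L)) := by
    calc (18 + 2 * S) * w ≤ 22 * k * w := by gcongr; linarith
      _ ≤ 22 * k * (B * (K * (D + L))) := by
        refine mul_le_mul_of_nonneg_left (hw.trans (mul_le_mul_of_nonneg_left ?_ hB))
          (by positivity)
        nlinarith
      _ = _ := by ring
  have h2 : (2 * ℓ + s) * m ≤ 15 * K * (K * (K + 3)) * (k * (D + L)) := by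
    calc (2 * ℓ + s) * m ≤ 15 * K * k * m := by gcongr; linarith
      _ ≤ 15 * K * k * (K * (K + 3) * L) := by gcongr
      _ ≤ 15 * K * k * (K * (K + 3) * (D + L)) := by gcongr; linarith
      _ = _ := by ring
  linarith

/-- A code has about `2 log d` bits up to a constant. By `k = Ω(log d)` this is `O(k)`, so the hash
functions take no more space, up to a constant, than `k` bits per column. -/
theorem size_modulus_le {p d : ℕ} {K k : ℝ} (hp : 1 < p) (hpd : p ≤ 2 * d) (hd : 1 ≤ d)
    (hKk : 1 ≤ K * k) (hlog : Real.log d ≤ K * k) : ((p * (p - 1)).size : ℝ) ≤ 7 * K * k := by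
  have hN : 0 < p * (p - 1) := Nat.mul_pos (by omega) (by omega)
  have hd' : (0 : ℝ) < d := Nat.cast_pos.2 hd
  have h1 := size_le_log hN
  have h2 : Real.log ((p * (p - 1) : ℕ) : ℝ) ≤ Real.log ((2 * d) ^ 2) := by
    refine Real.log_le_log (by exact_mod_cast hN) ?_
    have : p * (p - 1) ≤ (2 * d) ^ 2 := by
      rw [sq]
      exact Nat.mul_le_mul hpd (by omega)
    exact_mod_cast this
  rw [Real.log_pow, Real.log_mul (by norm_num) hd'.ne'] at h2
  have := Real.log_two_lt_d9
  rw [Nat.cast_ofNat] at h2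
  linarith

theorem bits_encodeOutput_le_log {d N p s m k J w : ℕ} {K B L α ε u : ℝ} (hK : 1 ≤ K)
    (hp : 1 < p) (hpd : p ≤ 2 * d) (hd : 1 ≤ d) (hsize : (p * (p - 1)).size < w) (hk : 1 ≤ k)
    (hJ : 2 ^ J ≤ 2 * k) (hlog : Real.log d ≤ K * k) (hs : (s : ℝ) ≤ K * k) (hu : 0 ≤ u)
    (hL : 1 ≤ K * L) (hw : (w : ℝ) ≤ B * Real.log (d + u + 1)) (hm : (m : ℝ) + 1 ≤ K * (K + 3) * L)
    (r : (Fin d → ℝ) × ALPOutput N s m) :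
    ((encodeOutput (thresholdHeader p s m J w α ε u) w u r).bits : ℝ) ≤
      (22 * |B| * K + 15 * K * (K * (K + 3))) * (k * (Real.log (d + u) + L)) := by
  have hbits : ((encodeOutput (thresholdHeader p s m J w α ε u) w u r).bits : ℝ) ≤
      (18 + 2 * ((2 ^ J : ℕ) : ℝ)) * w + 2 * (p * (p - 1)).size * m + s * m := by
    exact_mod_cast bits_encodeOutput_le hp hsize r
  have hk' : (1 : ℝ) ≤ k := by exact_mod_cast hk
  have hd' : (1 : ℝ) ≤ d := by exact_mod_cast hd
  have hJ' : ((2 ^ J : ℕ) : ℝ) ≤ 2 * k := by exact_mod_cast hJ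
  have hZ0 : 0 ≤ Real.log (d + u + 1) := Real.log_nonneg (by linarith)
  refine hbits.trans (bits_le_of_parameters hK hk' (Real.log_nonneg (by linarith)) ?_
    (Nat.cast_nonneg _) hJ' (size_modulus_le hp hpd hd (by nlinarith) hlog) hs
    (Nat.cast_nonneg _) (abs_nonneg B) (by linarith))
  calc (w : ℝ) ≤ B * Real.log (d + u + 1) := hw
    _ ≤ |B| * Real.log (d + u + 1) := mul_le_mul_of_nonneg_right (le_abs_self B) hZ0
    _ ≤ _ := mul_le_mul_of_nonneg_left (log_add_add_one_le hd' hu hL) (abs_nonneg B)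

theorem time_le_of_parameters {K L J l m : ℝ} (hK : 0 < K) (hL : 1 ≤ K * L)
    (hJ : J ≤ 1 + 3 / 2 * l) (hl : l ≤ K + L) (hL0 : 0 < L) (hm : m + 1 ≤ K * (K + 3) * L) :
    8 * J + 32 * m + 52 ≤ (60 * K + 16 * K ^ 2 + 16 + 32 * (K * (K + 3))) * L := by
  have h : K ≤ K ^ 2 * L := by nlinarith
  linarith

theorem error_le_of_parameters {K α ε δ G : ℝ} (hα : α ≤ K) (hε : 0 < ε) (hδ1 : δ ≤ 1)
    (hG : 0 ≤ G) :
    8 / ε + δ * Real.exp (-(ε / 2)) / 2 + α / (ε / 2) * G + 1 / ε ≤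
      (10 + 2 * K * G) * (1 / ε) := by
  have h1 : δ * Real.exp (-(ε / 2)) / 2 ≤ 1 / ε := by
    calc δ * Real.exp (-(ε / 2)) / 2 ≤ 1 * (2 / ε) / 2 := by
          gcongr
          exact exp_neg_half_le hε
      _ = 1 / ε := by ring
  have h2 : α / (ε / 2) * G ≤ K / (ε / 2) * G := by gcongr
  calc _ ≤ 8 / ε + 1 / ε + K / (ε / 2) * G + 1 / ε := by gcongr
    _ = _ := by field_simp; ring

theorem max_error_le_of_parameters {K L k α ε δ l m : ℝ} (hK : 0 < K) (hαK : α ≤ K)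
    (hε : 0 < ε) (hkδ : k * δ ≤ K) (hL : 1 ≤ K * L) (hl : l ≤ K + L) (hm0 : 0 ≤ m)
    (hm : m ≤ K * (K + 3) * L) :
    4 * l / ε + α / (ε / 2) * m + (8 / ε + k * (δ * Real.exp (-(ε / 2)) / 2)) + 1 / ε ≤
      (9 * K + 5 * K ^ 2 + 4 + 2 * K * (K * (K + 3))) * L / ε := by
  have h1 : k * (δ * Real.exp (-(ε / 2)) / 2) ≤ K / ε := by
    calc k * (δ * Real.exp (-(ε / 2)) / 2) = k * δ * (Real.exp (-(ε / 2)) / 2) := by ring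
      _ ≤ K * (2 / ε / 2) := by
        gcongr
        exact exp_neg_half_le hε
      _ = K / ε := by ring
  have h2 : α / (ε / 2) * m ≤ K / (ε / 2) * (K * (K + 3) * L) := by gcongr
  have h3 : K ≤ K ^ 2 * L := by nlinarith
  calc _ ≤ 4 * (K + L) / ε + K / (ε / 2) * (K * (K + 3) * L) + (8 / ε + K / ε) + 1 / ε := by
        gcongr
    _ = (9 + 5 * K + 4 * L + 2 * K * (K * (K + 3) * L)) / ε := by
      field_simp
      ring
    _ ≤ _ := by
      gcongr
      linarith

end WordRAM

/-- A pointwise additive error adds to the expectation. -/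
theorem lintegral_le_ofReal_add {Ω : Type*} [MeasurableSpace Ω] {μ : Measure Ω}
    [IsProbabilityMeasure μ] {f g : Ω → ℝ} {a b c : ℝ} (hfg : ∀ᵐ r ∂μ, f r ≤ g r + a)
    (ha : 0 ≤ a) (hb : 0 ≤ b) (hg : ∫⁻ r, ENNReal.ofReal (g r) ∂μ ≤ ENNReal.ofReal b)
    (hc : b + a ≤ c) : ∫⁻ r, ENNReal.ofReal (f r) ∂μ ≤ ENNReal.ofReal c :=
  calc ∫⁻ r, ENNReal.ofReal (f r) ∂μ
      ≤ ∫⁻ r, (ENNReal.ofReal (g r) + ENNReal.ofReal a) ∂μ := by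
        refine lintegral_mono_ae (hfg.mono fun r hr => ?_)
        exact (ENNReal.ofReal_le_ofReal hr).trans ENNReal.ofReal_add_le
    _ = ∫⁻ r, ENNReal.ofReal (g r) ∂μ + ENNReal.ofReal a := by
        rw [lintegral_add_right _ measurable_const, lintegral_const, measure_univ, mul_one]
    _ ≤ ENNReal.ofReal b + ENNReal.ofReal a := by gcongr
    _ = ENNReal.ofReal (b + a) := (ENNReal.ofReal_add hb ha).symm
    _ ≤ ENNReal.ofReal c := ENNReal.ofReal_le_ofReal hc

/-! ### From the error of the estimates to the error of the answers. -/

section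

variable {d N k s : ℕ} {hash : Fin N → Fin d → Fin s} {K α ε δ u : ℝ} {x : Fin d → ℝ}
  {a : (Fin d → ℝ) × ALPOutput N s (columns α ε δ) → Fin d → ℝ}

theorem lintegral_abs_sub_le_of_close (hK : 1 ≤ K) (hN : 0 < N) (hs : 0 < s) (hk : 0 < k)
    (hu : IsUniversal hash) (hα : 1 / K ≤ α) (hαK : α ≤ K) (hsk : (2 + 1 / K) * k ≤ s)
    (hε : 0 < ε) (hδ : 0 < δ) (hδ1 : δ ≤ 1) (hx : ∀ i, 0 ≤ x i) (hxu : ∀ i, x i ≤ u)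
    (hsp : IsSparse k x) (i : Fin d)
    (ha : ∀ᵐ r ∂thresholdALP α ε δ hash x, ∀ i,
      |x i - a r i| ≤ |x i - thresholdALPEstimate α ε u hash r i| + 1 / ε) :
    ∫⁻ r, ENNReal.ofReal |x i - a r i| ∂thresholdALP α ε δ hash x ≤
      ENNReal.ofReal
        ((10 + 2 * K * (1 / (1 / (2 * (2 * K + 1) ^ 2)) ^ 4 + 1)) * (1 / ε)) := by
  have hα0 : 0 < α := lt_of_lt_of_le (by positivity) hα
  have := isProbabilityMeasure_thresholdALP (δ := δ) hN hα0 hε hash hx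
  have hγ0 : 0 < 1 / (2 * (2 * K + 1) ^ 2) := by positivity
  have hγ1 : 1 / (2 * (2 * K + 1) ^ 2) ≤ 1 / 2 := by
    gcongr
    nlinarith
  exact lintegral_le_ofReal_add (ha.mono fun r hr => hr i) (by positivity) (by positivity)
    (lintegral_error_le hN hs hu hα0 hε hδ hδ1 hγ0 hγ1
      (error_margin hK hα (Nat.cast_pos.2 hk) hsk) hx hxu hsp i)
    (WordRAM.error_le_of_parameters hαK hε hδ1 (by positivity))

theorem lintegral_iSup_abs_sub_le_of_close (hK : 0 < K) (hN : 0 < N) (hk : 1 ≤ k) (hd : 0 < d)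
    (hα : 0 < α) (hαK : α ≤ K) (hkδ : k * δ ≤ K)
    (hL : 1 ≤ K * Real.log (1 / δ)) (hl : Real.log k ≤ K + Real.log (1 / δ))
    (hm : (columns α ε δ : ℝ) ≤ K * (K + 3) * Real.log (1 / δ))
    (hε : 0 < ε) (hδ : 0 < δ) (hδ1 : δ ≤ 1) (hx : ∀ i, 0 ≤ x i) (hxu : ∀ i, x i ≤ u)
    (hsp : IsSparse k x)
    (ha : ∀ᵐ r ∂thresholdALP α ε δ hash x, ∀ i,
      |x i - a r i| ≤ |x i - thresholdALPEstimate α ε u hash r i| + 1 / ε) :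
    ∫⁻ r, ENNReal.ofReal (⨆ i, |x i - a r i|) ∂thresholdALP α ε δ hash x ≤
      ENNReal.ofReal ((9 * K + 5 * K ^ 2 + 4 + 2 * K * (K * (K + 3))) * Real.log (1 / δ) / ε) := by
  have := isProbabilityMeasure_thresholdALP (δ := δ) hN hα hε hash hx
  have : Nonempty (Fin d) := ⟨⟨0, hd⟩⟩
  have hmax : ∀ᵐ r ∂thresholdALP α ε δ hash x, (⨆ i, |x i - a r i|) ≤
      (⨆ i, |x i - thresholdALPEstimate α ε u hash r i|) + 1 / ε := by
    filter_upwards [ha] with r hr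
    refine ciSup_le fun i => (hr i).trans ?_
    gcongr
    exact le_ciSup (f := fun i => |x i - thresholdALPEstimate α ε u hash r i|)
      (Set.finite_range _).bddAbove i
  have hlogk0 : 0 ≤ Real.log k := Real.log_nonneg (by exact_mod_cast hk)
  exact lintegral_le_ofReal_add hmax (by positivity) (by positivity)
    (lintegral_iSup_error_le hN hα hε hδ hδ1 hk hd hx hxu hsp)
    (WordRAM.max_error_le_of_parameters hK hαK hε hkδ hL hl (Nat.cast_nonneg _) hm)

end

/-- There is one access program `P` for all parameters. The number `K` bounds all the constants in
the hypotheses `α = Θ(1)`, `s = Θ(k)` (with `s / k` bounded away from `2`), `k = Ω(log d)`,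
`δ = O(1 / k)`, and so on; `A ≤ w / log (d + u + 1) ≤ B` is the word length of the machine, and `C`
is the constant of all the asymptotic bounds. -/
theorem theorem5 :
    ∃ P : WordRAM.Program, ∀ K : ℕ, 0 < K → ∃ A : ℝ, 0 < A ∧ ∀ B : ℝ, ∃ C : ℝ, 0 < C ∧
      ∀ (d k s w : ℕ) (u α ε δ : ℝ),
        1 ≤ k → k ≤ d → Real.log d ≤ K * k →
        (2 + 1 / (K : ℝ)) * k ≤ s → (s : ℝ) ≤ K * k →
        1 / (K : ℝ) ≤ α → α ≤ K →
        0 ≤ u →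
        0 < ε → 0 < δ → k * δ ≤ K → 1 ≤ K * Real.log (1 / δ) → ε ≤ K * Real.log (1 / δ) →
        Real.log (1 / δ) ≤ (d + u + 1) ^ K →
        A * Real.log (d + u + 1) ≤ w → (w : ℝ) ≤ B * Real.log (d + u + 1) →
        ∃ (N : ℕ) (hash : Fin N → Fin d → Fin s), 0 < N ∧ IsUniversal hash ∧
          IsDP k ε δ (thresholdALP α ε δ hash) ∧
          ∃ (enc : (Fin d → ℝ) × ALPOutput N s (columns α ε δ) → WordRAM.Image w)
            (ans : WordRAM.Image w → Fin d → ℝ),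
            Measurable enc ∧
            IsDP k ε δ (fun x => (thresholdALP α ε δ hash x).map enc) ∧
            ∀ x : Fin d → ℝ, (∀ i, 0 ≤ x i) → (∀ i, x i ≤ u) → IsSparse k x →
              (∀ᵐ r ∂(thresholdALP α ε δ hash x),
                ((enc r).bits : ℝ) ≤ C * (k * (Real.log (d + u) + Real.log (1 / δ))) ∧
                ∀ i : Fin d,
                  WordRAM.Answers P (enc r) i ⌊C * Real.log (1 / δ)⌋₊ (ans (enc r) i) ∧
                  |ans (enc r) i - thresholdALPEstimate α ε u hash r i| ≤ 1 / ε) ∧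
              (∀ i : Fin d,
                ∫⁻ r, ENNReal.ofReal |x i - ans (enc r) i| ∂(thresholdALP α ε δ hash x) ≤
                  ENNReal.ofReal (C * (1 / ε))) ∧
              ∫⁻ r, ENNReal.ofReal (⨆ i : Fin d, |x i - ans (enc r) i|)
                  ∂(thresholdALP α ε δ hash x) ≤
                ENNReal.ofReal (C * (Real.log (1 / δ) / ε)) := by
  refine ⟨WordRAM.accessProgram, fun K hK => ?_⟩
  -- The exponent `6 * K + 4` bounds every number of the header as a power of `d + u + 1`; the
  -- factor `4` confines each of them to a quarter of a word.
  refine ⟨4 * (((6 * K + 4 : ℕ) : ℝ) + 1) / Real.log 2, ?_, fun B => ?_⟩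
  · have := Real.log_pos (by norm_num : (1 : ℝ) < 2)
    positivity
  have hK' : (0 : ℝ) < K := Nat.cast_pos.2 hK
  have hK1 : (1 : ℝ) ≤ K := by exact_mod_cast hK
  obtain ⟨hC0, hCbits, hCtime, hCerr, hCmax⟩ :=
    WordRAM.asymptoticConstant_bounds (K := K) (B := B) hK'
  refine ⟨WordRAM.asymptoticConstant K B, hC0, ?_⟩
  generalize WordRAM.asymptoticConstant K B = C at hC0 hCbits hCtime hCerr hCmax
  intro d k s w u α ε δ hk hkd hlogd hs hsK hα hαK hu hε hδ hkδ hL1 hεL hLZ hwA hwB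
  have hd : 1 ≤ d := hk.trans hkd
  have hd' : (1 : ℝ) ≤ d := by exact_mod_cast hd
  have hk' : (1 : ℝ) ≤ k := by exact_mod_cast hk
  have hkd' : (k : ℝ) ≤ d := by exact_mod_cast hkd
  have hα0 : 0 < α := lt_of_lt_of_le (by positivity) hα
  have hs0 : 0 < s := by
    have : (0 : ℝ) < s := lt_of_lt_of_le (by positivity) hs
    exact_mod_cast this
  have hL0 : 0 < Real.log (1 / δ) := pos_of_mul_pos_right (by linarith : 0 < K * Real.log (1 / δ)) hK'.le
  have hδ1 : δ ≤ 1 := by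
    by_contra h
    push Not at h
    have : Real.log (1 / δ) ≤ 0 := Real.log_nonpos (by positivity) (by
      rw [div_le_one hδ]; exact h.le)
    linarith
  -- Bertrand's postulate provides a modulus that exceeds all keys and still has only `O(log d)`
  -- bits.
  obtain ⟨p, hp, hdp, hpd⟩ := Nat.exists_prime_lt_and_le_two_mul d (by omega)
  have hN : 0 < p * (p - 1) := Nat.mul_pos hp.pos (by have := hp.two_le; omega)
  have hm := columns_add_one_le hK1 hα hε hL1 hεL
  set Z : ℝ := d + u + 1 with hZ
  have hZ2 : 2 ≤ Z := by linarith
  have hZb := pow_le_two_pow_of_log_le hZ2 hwA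
  set b := w / 4 with hb
  -- The strict inequality `k < 2 ^ J` leaves a padding key, so the rank found by the search is
  -- always a valid position.
  set J := k.size with hJ
  have hkJ : k < 2 ^ J := Nat.lt_size_self k
  have hJk : 2 ^ J ≤ 2 * k := by
    have h0 : 0 < J := Nat.size_pos.2 hk
    have h1 : 2 ^ (J - 1) ≤ k := Nat.lt_size.1 (by omega)
    calc 2 ^ J = 2 * 2 ^ (J - 1) := by rw [← pow_succ']; congr 1; omega
      _ ≤ 2 * k := Nat.mul_le_mul_left _ h1
  have hcast : ∀ n : ℕ, (n : ℝ) ≤ Z ^ (6 * K + 4) → n ≤ 2 ^ b := fun n hn => by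
    exact_mod_cast hn.trans hZb
  have hmono : ∀ a : ℕ, a ≤ 6 * K + 4 → Z ^ a ≤ Z ^ (6 * K + 4) :=
    fun a h => pow_le_pow_right₀ (by linarith) h
  have h2d : 2 * d ≤ 2 ^ b := hcast _ (le_trans (by push_cast; nlinarith) (hmono 2 (by omega)))
  have hsb : s ≤ 2 ^ b := hcast _ (le_trans (by
    calc (s : ℝ) ≤ K * k := hsK
      _ ≤ Z ^ K * Z := by
        have : (K : ℝ) ≤ Z ^ K :=
          (natCast_le_two_pow K).trans (pow_le_pow_left₀ (by norm_num) hZ2 K)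
        gcongr
        linarith
      _ = Z ^ (K + 1) := by ring) (hmono (K + 1) (by omega)))
  have hb4 : 4 ≤ b := by
    have h16 : 2 ^ 4 ≤ 2 ^ b := hcast _ (by
      rw [Nat.cast_pow, Nat.cast_ofNat]
      exact (pow_le_pow_left₀ (by norm_num) hZ2 4).trans (hmono 4 (by omega)))
    exact (Nat.pow_le_pow_iff_right (by norm_num)).1 h16
  have hbw : 4 * b ≤ w := Nat.mul_div_le w 4
  obtain ⟨b1, b2, b3, b4⟩ := WordRAM.thresholdHeader_le (p := p) (s := s) (J := J) (w := w)
    (m := columns α ε δ) hK hZ2 (by linarith) hu hα0 hαK hε hεL hLZ hL0 hm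
  set c := WordRAM.thresholdHeader p s (columns α ε δ) J w α ε u with hc
  have hfits : c.Fits w := WordRAM.fits_thresholdHeader hb4 hbw (by omega) (by omega) hsb
    (hcast _ (by push_cast; exact b1)) (hcast _ b2) (hcast _ b3) (hcast _ b4)
  have hsize : (p * (p - 1)).size < w :=
    WordRAM.size_modulus_lt (by omega) hbw (by omega)
  have hbb : 2 ^ b * 2 ≤ 2 ^ w := by
    rw [← pow_succ]
    exact Nat.pow_le_pow_right (by norm_num) (by omega)
  have hpos : 0 < 2 ^ b := by positivity
  set hash := affineFamily d p s hs0 with hhash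
  have hdp1 := isDP_thresholdALP (k := k) hN hα0 hε hδ hδ1 hash
  have hmeas := WordRAM.measurable_encodeOutput (d := d) (N := p * (p - 1)) (s := s)
    (m := columns α ε δ) c w u
  set T := 8 * J + 32 * columns α ε δ + 52 with hT
  have hTC : T ≤ ⌊C * Real.log (1 / δ)⌋₊ := by
    refine Nat.le_floor ?_
    refine le_trans ?_ (mul_le_mul_of_nonneg_right hCtime hL0.le)
    rw [hT]
    push_cast
    exact WordRAM.time_le_of_parameters hK' hL1 (size_le_log hk)
      (log_natCast_le hk hK hδ hkδ) hL0 hm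
  refine ⟨p * (p - 1), hash, hN, affineFamily_isUniversal hp hdp.le hs0, hdp1,
    WordRAM.encodeOutput c w u, fun I i => WordRAM.answer WordRAM.accessProgram T I i, hmeas,
    hdp1.map hmeas, fun x hx hxu hsp => ?_⟩
  have := isProbabilityMeasure_thresholdALP (δ := δ) hN hα0 hε hash hx
  have hans : ∀ᵐ r ∂(thresholdALP α ε δ hash x), ∀ i : Fin d,
      WordRAM.Answers WordRAM.accessProgram (WordRAM.encodeOutput c w u r) i T
        (WordRAM.answerNum c u hash r i / c.den) := by
    filter_upwards [ae_thresholdALP_eq_zero (δ := δ) (hash := hash) hN hα0 hε hx] with r hr i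
    refine WordRAM.answers_encodeOutput hs0 hp.one_lt (by omega) hε hu hsize (by omega) hdp.le
      (by omega) hfits r (lt_of_le_of_lt (Set.ncard_le_ncard ?_ (Set.toFinite _))
        (lt_of_le_of_lt hsp hkJ)) i
    exact fun j hj hxj => hj (hr j hxj)
  have herr : ∀ᵐ r ∂(thresholdALP α ε δ hash x), ∀ i : Fin d,
      |WordRAM.answer WordRAM.accessProgram T (WordRAM.encodeOutput c w u r) i -
        thresholdALPEstimate α ε u hash r i| ≤ 1 / ε := by
    filter_upwards [hans] with r hr i
    rw [(hr i).answer_eq]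
    exact WordRAM.abs_answerNum_sub_le hα0 hε hu hash r i
  have herr' : ∀ᵐ r ∂(thresholdALP α ε δ hash x), ∀ i : Fin d,
      |x i - WordRAM.answer WordRAM.accessProgram T (WordRAM.encodeOutput c w u r) i| ≤
        |x i - thresholdALPEstimate α ε u hash r i| + 1 / ε := by
    filter_upwards [herr] with r hr i
    have := abs_sub_le (x i) (thresholdALPEstimate α ε u hash r i)
      (WordRAM.answer WordRAM.accessProgram T (WordRAM.encodeOutput c w u r) i)
    have := hr i
    rw [abs_sub_comm] at this
    linarith
  have hD : 0 ≤ k * (Real.log (d + u) + Real.log (1 / δ)) :=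
    mul_nonneg (by positivity) (add_nonneg (Real.log_nonneg (by linarith)) hL0.le)
  refine ⟨?_, fun i => ?_, ?_⟩
  · filter_upwards [hans, herr] with r hr hr'
    refine ⟨?_, fun i => ⟨?_, hr' i⟩⟩
    · exact (WordRAM.bits_encodeOutput_le_log hK1 hp.one_lt hpd hd hsize hk hJk hlogd hsK hu hL1
        hwB hm r).trans (mul_le_mul_of_nonneg_right hCbits hD)
    -- The budget `T` defines the answer; a larger budget yields the same value, since a halted run
    -- is not affected by it.
    · have := (hr i).mono hTC
      rwa [← (hr i).answer_eq] at this
  · exact (lintegral_abs_sub_le_of_close hK1 hN hs0 hk (affineFamily_isUniversal hp hdp.le hs0)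
      hα hαK hs hε hδ hδ1 hx hxu hsp i herr').trans
      (ENNReal.ofReal_le_ofReal (mul_le_mul_of_nonneg_right hCerr (by positivity)))
  · refine (lintegral_iSup_abs_sub_le_of_close hK' hN hk hd hα0 hαK hkδ hL1
      (log_natCast_le hk hK hδ hkδ) (by linarith) hε hδ hδ1 hx hxu hsp herr').trans
      (ENNReal.ofReal_le_ofReal ?_)
    rw [mul_div_assoc]
    exact mul_le_mul_of_nonneg_right hCmax (by positivity)
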